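/- Let $\mathcal X$ be a measurable space with measurable singletons. Let $r(x,dy)$ be a kernel on $\mathcal X$ (measurable in $x$) with $0<\hat r(x):=r(x,\mathcal X)<\infty$ and $r(x,\{x\})=0$ for all $x$, and let $\nu$ be a probability measure on $\mathcal X$. Let $(X_s)_{s\ge 0}$ be the Markov jump process with $X_0\sim\nu$ which waits at $x$ an exponential time of parameter $\hat r(x)$ and then jumps according to $r(x,dy)/\hat r(x)$; assume that it does not explode, $\mathbb P_\nu$-a.s. Let $g:[0,\infty)\times\mathcal X\times\mathcal X\to\mathbb R$ be bounded and measurable. For $\lambda\in\mathbb R$ let $X^\lambda$ be the time-inhomogeneous Markov jump process with $X^\lambda_0\sim\nu$ and jump kernel $r^\lambda_s(x,dy)=e^{\lambda g(s,x,y)}r(x,dy)$: having entered $x$ at time $s$, it is still at $x$ at time $u\ge s$ with probability $\exp\{-\int_s^u r^\lambda_w(x,\mathcal X)\,dw\}$, and if it leaves $x$ at time $u$ it jumps according to $r^\lambda_u(x,dy)/r^\lambda_u(x,\mathcal X)$; after explosion it sits in a cemetery state, where observables are set to $0$. For measurable $\alpha$ write $\alpha_r(s,x)=\int\alpha(s,x,y)\,r(x,dy)$.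 Write $\sum_{u\in(0,s]}\alpha(u,X_{u-},X_u)$ for the sum over the jump times $u$ in $(0,s]$, and $$G_s=\sum_{u\in(0,s]}g(u,X_{u-},X_u)-\int_0^s g_r(u,X_u)\,du .$$ Fix $t\ge 0$ and assume condition $C[\nu,t]$: $\ \mathbb E_\nu\big[\exp\{\theta\int_0^t|g|_r(s,X_s)\,ds\}\big]<\infty$ for some $\theta>0$. Then, for all $\lambda$ in a neighbourhood of $0$, $X^\lambda$ a.s. does not explode in $[0,t]$, and the following hold. All expectations on the left-hand sides are finite for $\lambda$ near $0$, and the derivatives are two-sided. The expectations and time integrals on the right-hand sides are well defined: the random variables are integrable (for almost every $s\in[0,t]$ where a time $s$ is involved), and their expectations are integrable in $s$ over $[0,t]$. 1. If $v:\mathcal X\to\mathbb R$ is measurable and $v(X_t)\in L^p(\mathbb P_\nu)$ for some $p\in(1,\infty]$, then $$\partial_{\lambda=0}\,\mathbb E_\nu[v(X^\lambda_t)]=\mathbb E_\nu[v(X_t)\,G_t].$$ 2. If $v:[0,t]\times\mathcal X\to\mathbb R$ is measurable and $\int_0^t\|v(s,X_s)\|_{L^p(\mathbb P_\nu)}\,ds<\infty$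 for some $p\in(1,\infty]$, then $$\partial_{\lambda=0}\,\mathbb E_\nu\Big[\int_0^t v(s,X^\lambda_s)\,ds\Big]=\int_0^t\mathbb E_\nu[v(s,X_s)\,G_s]\,ds .$$ 3. Let $\alpha:[0,t]\times\mathcal X\times\mathcal X\to\mathbb R$ be measurable and $\mathbb P_\nu$-integrable, that is, $\mathbb E_\nu\big[\sum_{s\in(0,t]}|\alpha(s,X_{s-},X_s)|\big]<\infty$ or (equivalently) $\mathbb E_\nu\big[\int_0^t|\alpha|_r(s,X_s)\,ds\big]<\infty$. Put $F(X_{[0,t]})=\sum_{s\in(0,t]}\alpha(s,X_{s-},X_s)$ and assume $F(X_{[0,t]})\in L^p(\mathbb P_\nu)$ for some $p\in(1,\infty]$. Then $$\partial_{\lambda=0}\,\mathbb E_\nu\big[F(X^\lambda_{[0,t]})\big]=\mathbb E_\nu\big[F(X_{[0,t]})\,G_t\big].$$ If moreover $\sum_{s\in(0,t]}|\alpha(s,X_{s-},X_s)|\in L^q(\mathbb P_\nu)$ for some $q\in(1,\infty]$ (which is automatic when $\alpha\ge 0$), then $$\partial_{\lambda=0}\,\mathbb E_\nu\big[F(X^\lambda_{[0,t]})\big]=\int_0^t\mathbb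 E_\nu[(\alpha g)_r(s,X_s)]\,ds+\int_0^t\mathbb E_\nu[\alpha_r(s,X_s)\,G_s]\,ds .$$ -/

import Mathlib

open MeasureTheory ProbabilityTheory Set Filter Topology
open scoped ENNReal

noncomputable section

namespace MarkovJump

/-- A time-homogeneous jump kernel `r(x, dy)`: measurable in `x`, with finite and positive total
mass, and without mass at `x` itself. -/
structure TransitionKernel (X : Type*) [MeasurableSpace X] where
  kernel : Kernel X X
  finite : ∀ x, kernel x univ < ∞
  pos : ∀ x, 0 < kernel x univ
  no_self : ∀ x, kernel x {x} = 0

/-- A bounded measurable perturbation `g(s, x, y)`. Only its values at times `s ≥ 0` matter. -/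
structure Perturbation (X : Type*) [MeasurableSpace X] where
  toFun : ℝ → X → X → ℝ
  measurable : Measurable (fun p : ℝ × X × X => toFun p.1 p.2.1 p.2.2)
  bounded : ∃ M : ℝ, ∀ s x y, |toFun s x y| ≤ M

/-- A time-dependent jump kernel `R((s, x), dy)` whose total mass is, for each fixed `x`,
bounded and bounded away from zero in time. -/
class IsRateKernel {X : Type*} [MeasurableSpace X] (R : Kernel (ℝ × X) X) : Prop where
  exists_bounds : ∀ x, ∃ c C : ℝ, 0 < c ∧ ∀ s,
    ENNReal.ofReal c ≤ R (s, x) univ ∧ R (s, x) univ ≤ ENNReal.ofReal C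

section Construction

variable {X : Type*} [MeasurableSpace X]

/-- The total jump rate `R((s, x), X)`. -/
def totalRate (R : Kernel (ℝ × X) X) (s : ℝ) (x : X) : ℝ := (R (s, x)).real univ

/-- The density at time `u` of the next jump time of a process sitting in `x` since time `s`,
that is, minus the derivative in `u` of the survival probability
`exp (-∫_s^u totalRate R w x dw)`. -/
def holdingDensity (R : Kernel (ℝ × X) X) (p : ℝ × X) (u : ℝ) : ℝ≥0∞ :=
  if p.1 < u then
    ENNReal.ofReal (totalRate R u p.2 * Real.exp (-∫ w in p.1..u, totalRate R w p.2))
  else 0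

/-- The law of the next jump time, given the last jump time and the current state. -/
def holdingKernel (R : Kernel (ℝ × X) X) : Kernel (ℝ × X) ℝ :=
  Kernel.withDensity (Kernel.const (ℝ × X) (volume : Measure ℝ)) (holdingDensity R)

/-- The law `R((s, x), dy) / R((s, x), X)` of the state after a jump from `x` at time `s`. -/
def jumpKernel (R : Kernel (ℝ × X) X) : Kernel (ℝ × X) X where
  toFun p := (R p univ)⁻¹ • R p
  measurable' := by
    refine Measure.measurable_of_measurable_coe _ fun s hs => ?_
    simp only [Measure.smul_apply, smul_eq_mul]
    exact (R.measurable_coe MeasurableSet.univ).inv.mul (R.measurable_coe hs)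

/-- The law of (next jump time, next state), given (last jump time, current state). -/
def stepKernel (R : Kernel (ℝ × X) X) : Kernel (ℝ × X) (ℝ × X) :=
  holdingKernel R ⊗ₖ
    (jumpKernel R).comap (fun q : (ℝ × X) × ℝ => (q.2, q.1.2)) (by fun_prop)

lemma measurable_totalRate (R : Kernel (ℝ × X) X) :
    Measurable (fun p : ℝ × X => totalRate R p.1 p.2) :=
  (R.measurable_coe MeasurableSet.univ).ennreal_toReal

lemma exists_totalRate_bounds (R : Kernel (ℝ × X) X) [h : IsRateKernel R] (x : X) :
    ∃ c C : ℝ, 0 < c ∧ ∀ s, c ≤ totalRate R s x ∧ totalRate R s x ≤ C := by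
  obtain ⟨c, C, hc, hb⟩ := h.exists_bounds x
  refine ⟨c, max C 0, hc, fun s => ⟨?_, ?_⟩⟩
  · have h2 : R (s, x) univ ≠ ∞ := ((hb s).2.trans_lt ENNReal.ofReal_lt_top).ne
    exact (ENNReal.ofReal_le_iff_le_toReal h2).1 (hb s).1
  · exact ENNReal.toReal_le_of_le_ofReal (le_max_right _ _)
      ((hb s).2.trans (ENNReal.ofReal_le_ofReal (le_max_left _ _)))

lemma measurable_holdingDensity (R : Kernel (ℝ × X) X) :
    Measurable (Function.uncurry (holdingDensity R)) := by
  have hrate := measurable_totalRate R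
  have hset : MeasurableSet {q : ((ℝ × X) × ℝ) × ℝ | q.1.1.1 < q.2 ∧ q.2 ≤ q.1.2} :=
    MeasurableSet.inter
      (measurableSet_lt (f := fun q : ((ℝ × X) × ℝ) × ℝ => q.1.1.1)
        (g := fun q : ((ℝ × X) × ℝ) × ℝ => q.2) (by fun_prop) (by fun_prop))
      (measurableSet_le (f := fun q : ((ℝ × X) × ℝ) × ℝ => q.2)
        (g := fun q : ((ℝ × X) × ℝ) × ℝ => q.1.2) (by fun_prop) (by fun_prop))
  have hF : Measurable (fun q : ((ℝ × X) × ℝ) × ℝ =>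
      {q : ((ℝ × X) × ℝ) × ℝ | q.1.1.1 < q.2 ∧ q.2 ≤ q.1.2}.indicator
        (fun q => totalRate R q.2 q.1.1.2) q) :=
    Measurable.indicator (hrate.comp (by fun_prop :
      Measurable fun q : ((ℝ × X) × ℝ) × ℝ => (q.2, q.1.1.2))) hset
  have hI := (hF.stronglyMeasurable.integral_prod_right' (ν := (volume : Measure ℝ))).measurable
  have hlt : MeasurableSet {q : (ℝ × X) × ℝ | q.1.1 < q.2} :=
    measurableSet_lt (by fun_prop) (by fun_prop)
  have hG : Measurable (fun q : (ℝ × X) × ℝ => if q.1.1 < q.2 then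
      ENNReal.ofReal (totalRate R q.2 q.1.2 * Real.exp (-∫ w,
        {q : ((ℝ × X) × ℝ) × ℝ | q.1.1.1 < q.2 ∧ q.2 ≤ q.1.2}.indicator
        (fun q => totalRate R q.2 q.1.1.2) (q, w))) else 0) := by
    refine Measurable.ite hlt ?_ measurable_const
    refine ENNReal.measurable_ofReal.comp (Measurable.mul ?_ ?_)
    · exact hrate.comp (by fun_prop : Measurable fun q : (ℝ × X) × ℝ => (q.2, q.1.2))
    · exact Real.measurable_exp.comp hI.neg
  convert hG using 1
  ext ⟨⟨s, x⟩, u⟩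
  simp only [Function.uncurry_apply_pair, holdingDensity]
  split_ifs with h
  · rw [intervalIntegral.integral_of_le h.le, ← integral_indicator measurableSet_Ioc]
    rfl
  · rfl

lemma lintegral_hazard {h : ℝ → ℝ} (hm : Measurable h) {c C : ℝ} (hc : 0 < c)
    (hb : ∀ s, c ≤ h s ∧ h s ≤ C) (s : ℝ) :
    ∫⁻ u in Ioi s, ENNReal.ofReal (h u * Real.exp (-∫ w in s..u, h w)) = 1 := by
  have hnn : ∀ u, 0 ≤ h u := fun u => hc.le.trans (hb u).1
  have hloc : LocallyIntegrable h volume := by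
    refine (locallyIntegrable_const C).mono hm.aestronglyMeasurable (ae_of_all _ fun u => ?_)
    rw [Real.norm_of_nonneg (hnn u), Real.norm_of_nonneg ((hnn u).trans (hb u).2)]
    exact (hb u).2
  have hii : ∀ a b, IntervalIntegrable h volume a b := fun a b =>
    (hloc.integrableOn_isCompact isCompact_uIcc).intervalIntegrable
  set H : ℝ → ℝ := fun u => ∫ w in s..u, h w with hH
  have hHcont : Continuous H := intervalIntegral.continuous_primitive hii s
  have hHlow : ∀ u, s ≤ u → c * (u - s) ≤ H u := by
    intro u hu
    have := intervalIntegral.integral_mono_on hu (intervalIntegrable_const (c := c)) (hii s u)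
      (fun x _ => (hb x).1)
    simpa [mul_comm] using this
  have hHnn : ∀ u, s ≤ u → 0 ≤ H u := fun u hu =>
    (mul_nonneg hc.le (sub_nonneg.2 hu)).trans (hHlow u hu)
  have hint : ∀ b, IntervalIntegrable (fun u => h u * Real.exp (-H u)) volume s b := fun b =>
    (hii s b).mul_continuousOn (by fun_prop)
  have hftc : ∀ b, s ≤ b →
      ∫ u in s..b, h u * Real.exp (-H u) = 1 - Real.exp (-H b) := by
    intro b hsb
    have hac : AbsolutelyContinuousOnInterval (fun u => Real.exp (-H u)) s b := by
      have hlip : LipschitzOnWith (Real.toNNReal C) (fun u => Real.exp (-H u)) (uIcc s b) := by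
        refine LipschitzOnWith.of_dist_le_mul ?_
        have key : ∀ x ∈ uIcc s b, ∀ y ∈ uIcc s b, x ≤ y →
            dist (Real.exp (-H x)) (Real.exp (-H y)) ≤ C * (y - x) := by
          intro x hx y hy hxy
          rw [uIcc_of_le hsb] at hx hy
          have hdiff : H y - H x = ∫ w in x..y, h w := by
            rw [hH]
            exact intervalIntegral.integral_interval_sub_left (hii _ _) (hii _ _)
          have h1 : 0 ≤ H y - H x := by
            rw [hdiff]; exact intervalIntegral.integral_nonneg hxy fun u _ => hnn u
          have h2 : H y - H x ≤ C * (y - x) := by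
            rw [hdiff]
            have := intervalIntegral.integral_mono_on hxy (hii x y)
              (intervalIntegrable_const (c := C)) (fun x _ => (hb x).2)
            simpa [mul_comm] using this
          have h3 : Real.exp (-H y) ≤ Real.exp (-H x) := Real.exp_le_exp.2 (by linarith)
          rw [Real.dist_eq, abs_of_nonneg (sub_nonneg.2 h3)]
          have h4 : Real.exp (-H y) = Real.exp (-H x) * Real.exp (-(H y - H x)) := by
            rw [← Real.exp_add]; congr 1; ring
          have h5 : 1 - (H y - H x) ≤ Real.exp (-(H y - H x)) := by
            have := Real.add_one_le_exp (-(H y - H x)); linarith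
          have h6 : Real.exp (-H x) ≤ 1 := Real.exp_le_one_iff.2 (by linarith [hHnn x hx.1])
          have h7 := Real.exp_pos (-H x)
          rw [h4]
          nlinarith
        have hCnn : (0 : ℝ) ≤ C := (hnn s).trans (hb s).2
        intro x hx y hy
        rw [Real.coe_toNNReal _ hCnn]
        rcases le_total x y with hxy | hxy
        · have := key x hx y hy hxy
          rwa [dist_comm x y, Real.dist_eq y x, abs_of_nonneg (sub_nonneg.2 hxy)]
        · have := key y hy x hx hxy
          rwa [dist_comm, Real.dist_eq x y, abs_of_nonneg (sub_nonneg.2 hxy)]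
      exact hlip.absolutelyContinuousOnInterval
    have h1 := hac.integral_deriv_eq_sub
    have h2 : ∫ u in s..b, deriv (fun u => Real.exp (-H u)) u
        = ∫ u in s..b, -(h u * Real.exp (-H u)) := by
      refine intervalIntegral.integral_congr_ae ?_
      filter_upwards [LocallyIntegrable.ae_hasDerivAt_integral hloc] with u hu _
      have h3 : HasDerivAt (fun u => Real.exp (-H u)) (Real.exp (-H u) * -h u) u :=
        (hu s).neg.exp
      rw [h3.deriv]; ring
    rw [h2, intervalIntegral.integral_neg] at h1
    have h4 : H s = 0 := by simp [hH]
    rw [h4] at h1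
    simp only [neg_zero, Real.exp_zero] at h1
    linarith
  have htend : Tendsto (fun b => ∫ u in s..b, h u * Real.exp (-H u)) atTop (𝓝 1) := by
    have hHt : Tendsto H atTop atTop := by
      refine tendsto_atTop_mono' atTop
        ((eventually_ge_atTop s).mono fun u hu => hHlow u hu) ?_
      exact (tendsto_atTop_add_const_right _ (-s) tendsto_id).const_mul_atTop hc
    have h1 : Tendsto (fun b => 1 - Real.exp (-H b)) atTop (𝓝 (1 - 0)) :=
      tendsto_const_nhds.sub (Real.tendsto_exp_neg_atTop_nhds_zero.comp hHt)
    rw [sub_zero] at h1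
    exact h1.congr' ((eventually_ge_atTop s).mono fun b hb' => (hftc b hb').symm)
  have hpos : ∀ u, 0 ≤ h u * Real.exp (-H u) := fun u => mul_nonneg (hnn u) (Real.exp_pos _).le
  have hInt : IntegrableOn (fun u => h u * Real.exp (-H u)) (Ioi s) := by
    refine integrableOn_Ioi_of_intervalIntegral_norm_tendsto 1 s
      (fun b => ?_) tendsto_id ?_
    · rcases le_total s b with hsb | hsb
      · exact (intervalIntegrable_iff_integrableOn_Ioc_of_le hsb).1 (hint b)
      · simp [Ioc_eq_empty_of_le hsb]
    · simpa only [id, Real.norm_of_nonneg (hpos _)] using htend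
  have hval := intervalIntegral_tendsto_integral_Ioi s hInt tendsto_id
  have h1 := tendsto_nhds_unique hval htend
  rw [← ofReal_integral_eq_lintegral_ofReal hInt (ae_of_all _ hpos), h1, ENNReal.ofReal_one]

instance (R : Kernel (ℝ × X) X) [IsRateKernel R] : IsMarkovKernel (holdingKernel R) := by
  refine ⟨fun p => ⟨?_⟩⟩
  obtain ⟨s, x⟩ := p
  obtain ⟨c, C, hc, hb⟩ := exists_totalRate_bounds R x
  rw [holdingKernel, Kernel.withDensity_apply' _ (measurable_holdingDensity R),
    Kernel.const_apply, setLIntegral_univ]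
  have hm : Measurable fun u => totalRate R u x :=
    (measurable_totalRate R).comp (by fun_prop : Measurable fun u : ℝ => (u, x))
  rw [← lintegral_hazard hm hc hb s, ← lintegral_indicator measurableSet_Ioi]
  rfl

instance (R : Kernel (ℝ × X) X) [h : IsRateKernel R] : IsMarkovKernel (jumpKernel R) := by
  refine ⟨fun p => ⟨?_⟩⟩
  obtain ⟨c, C, hc, hb⟩ := h.exists_bounds p.2
  have h1 : R p univ ≠ 0 := ((ENNReal.ofReal_pos.2 hc).trans_le (hb p.1).1).ne'
  have h2 : R p univ ≠ ∞ := ((hb p.1).2.trans_lt ENNReal.ofReal_lt_top).ne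
  exact ENNReal.inv_mul_cancel h1 h2

instance (R : Kernel (ℝ × X) X) [IsRateKernel R] : IsMarkovKernel (stepKernel R) := by
  unfold stepKernel; infer_instance

/-- `stepKernel` as a function of the whole past of the sequence (jump times, states). -/
def chainKernel (R : Kernel (ℝ × X) X) (n : ℕ) :
    Kernel (Π _ : Finset.Iic n, ℝ × X) (ℝ × X) :=
  (stepKernel R).comap (fun h => h ⟨n, Finset.mem_Iic.2 le_rfl⟩) (by fun_prop)

instance (R : Kernel (ℝ × X) X) [IsRateKernel R] (n : ℕ) : IsMarkovKernel (chainKernel R n) := by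
  unfold chainKernel; infer_instance

/-- The law, on sequences `ω n = (time of the n-th jump, state entered at the n-th jump)`, of the
Markov jump process with time-dependent jump kernel `R` and initial distribution `ν`. The `0`-th
entry is `(0, initial state)`. -/
def pathLaw (R : Kernel (ℝ × X) X) [IsRateKernel R] (ν : Measure X) : Measure (ℕ → ℝ × X) :=
  Kernel.trajMeasure (X := fun _ : ℕ => ℝ × X) ((Measure.dirac (0 : ℝ)).prod ν) (chainKernel R)

/-! ### The unperturbed and the perturbed jump kernels -/

instance (r : TransitionKernel X) : IsSFiniteKernel r.kernel := by
  have hm : ∀ n : ℕ, MeasurableSet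
      {x | (n : ℝ≥0∞) ≤ r.kernel x univ ∧ r.kernel x univ < (n : ℝ≥0∞) + 1} := fun n =>
    (measurableSet_le measurable_const (r.kernel.measurable_coe MeasurableSet.univ)).inter
      (measurableSet_lt (r.kernel.measurable_coe MeasurableSet.univ) measurable_const)
  classical
  refine ⟨fun n => Kernel.piecewise (hm n) r.kernel 0, fun n => ?_, ?_⟩
  · refine ⟨(n : ℝ≥0∞) + 1, by finiteness, fun x => ?_⟩
    rw [Kernel.piecewise_apply]
    split_ifs with h
    · exact h.2.le
    · simp
  · ext x s hs
    rw [Kernel.sum_apply' _ _ hs]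
    have htop : r.kernel x univ ≠ ∞ := (r.finite x).ne
    set m := ⌊(r.kernel x univ).toReal⌋₊ with hmdef
    have hcast : ∀ n : ℕ, ((n : ℝ≥0∞) ≤ r.kernel x univ ∧ r.kernel x univ < (n : ℝ≥0∞) + 1)
        ↔ n = m := by
      intro n
      have e1 : (n : ℝ≥0∞) ≤ r.kernel x univ ↔ (n : ℝ) ≤ (r.kernel x univ).toReal := by
        rw [← ENNReal.toReal_le_toReal (by finiteness) htop]; simp
      have e2 : r.kernel x univ < (n : ℝ≥0∞) + 1 ↔ (r.kernel x univ).toReal < n + 1 := by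
        rw [← ENNReal.toReal_lt_toReal htop (by finiteness),
          ENNReal.toReal_add (by finiteness) (by finiteness)]; simp
      rw [e1, e2, hmdef, eq_comm, Nat.floor_eq_iff ENNReal.toReal_nonneg]
    rw [tsum_eq_single m]
    · rw [Kernel.piecewise_apply, if_pos]
      exact (hcast m).2 rfl
    · intro n hn
      rw [Kernel.piecewise_apply, if_neg]
      · simp
      · exact fun h => hn ((hcast n).1 h)

/-- The unperturbed jump kernel, regarded as a (constant) time-dependent one. -/
def unperturbedRate (r : TransitionKernel X) : Kernel (ℝ × X) X :=
  r.kernel.comap Prod.snd measurable_snd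

instance (r : TransitionKernel X) : IsSFiniteKernel (unperturbedRate r) := by
  unfold unperturbedRate; infer_instance

/-- The perturbed jump kernel `r^l_s(x, dy) = exp (l * g(s, x, y)) r(x, dy)`. -/
def perturbedRate (r : TransitionKernel X) (g : Perturbation X) (l : ℝ) : Kernel (ℝ × X) X :=
  Kernel.withDensity (unperturbedRate r)
    (fun p y => ENNReal.ofReal (Real.exp (l * g.toFun p.1 p.2 y)))

lemma perturbedRate_apply (r : TransitionKernel X) (g : Perturbation X) (l : ℝ) (s : ℝ) (x : X) :
    perturbedRate r g l (s, x)
      = (r.kernel x).withDensity (fun y => ENNReal.ofReal (Real.exp (l * g.toFun s x y))) := by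
  have hm : Measurable (Function.uncurry fun (p : ℝ × X) (y : X) =>
      ENNReal.ofReal (Real.exp (l * g.toFun p.1 p.2 y))) := by
    have := g.measurable.comp
      (by fun_prop : Measurable fun q : (ℝ × X) × X => (q.1.1, q.1.2, q.2))
    exact ENNReal.measurable_ofReal.comp (Real.measurable_exp.comp (this.const_mul l))
  rw [perturbedRate, Kernel.withDensity_apply _ hm]
  rfl

instance (r : TransitionKernel X) : IsRateKernel (unperturbedRate r) := by
  refine ⟨fun x => ⟨(r.kernel x univ).toReal, (r.kernel x univ).toReal,
    ENNReal.toReal_pos (r.pos x).ne' (r.finite x).ne, fun s => ?_⟩⟩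
  rw [ENNReal.ofReal_toReal (r.finite x).ne]
  exact ⟨le_rfl, le_rfl⟩

instance (r : TransitionKernel X) (g : Perturbation X) (l : ℝ) :
    IsRateKernel (perturbedRate r g l) := by
  obtain ⟨M, hM⟩ := g.bounded
  have hb : ∀ s x y, |l * g.toFun s x y| ≤ |l| * M := fun s x y => by
    rw [abs_mul]; exact mul_le_mul_of_nonneg_left (hM s x y) (abs_nonneg l)
  refine ⟨fun x => ⟨Real.exp (-(|l| * M)) * (r.kernel x univ).toReal,
    Real.exp (|l| * M) * (r.kernel x univ).toReal,
    mul_pos (Real.exp_pos _) (ENNReal.toReal_pos (r.pos x).ne' (r.finite x).ne), fun s => ?_⟩⟩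
  rw [ENNReal.ofReal_mul (Real.exp_pos _).le, ENNReal.ofReal_mul (Real.exp_pos _).le,
    ENNReal.ofReal_toReal (r.finite x).ne, perturbedRate_apply,
    withDensity_apply _ MeasurableSet.univ, setLIntegral_univ, ← lintegral_const,
    ← lintegral_const]
  exact ⟨lintegral_mono fun y => ENNReal.ofReal_le_ofReal
      (Real.exp_le_exp.2 (neg_le_of_abs_le (hb s x y))),
    lintegral_mono fun y => ENNReal.ofReal_le_ofReal
      (Real.exp_le_exp.2 (le_of_abs_le (hb s x y)))⟩

/-- The law of the unperturbed Markov jump process with initial distribution `ν`. -/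
def unperturbedLaw (r : TransitionKernel X) (ν : Measure X) : Measure (ℕ → ℝ × X) :=
  pathLaw (unperturbedRate r) ν

/-- The law of the `l`-perturbed Markov jump process with initial distribution `ν`. -/
def perturbedLaw (r : TransitionKernel X) (g : Perturbation X) (l : ℝ) (ν : Measure X) :
    Measure (ℕ → ℝ × X) :=
  pathLaw (perturbedRate r g l) ν

end Construction

section Paths

variable {X : Type*}

/-- The explosion time, the supremum of the jump times. -/
def explosionTime (ω : ℕ → ℝ × X) : ℝ≥0∞ := ⨆ n, ENNReal.ofReal (ω n).1

open Classical in
/-- The state at time `s`: the state entered at the last jump before or at time `s`, or the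
cemetery state `none` if the process has exploded by time `s`. -/
def stateAt (ω : ℕ → ℝ × X) (s : ℝ) : Option X :=
  if h : ∃ n, s < (ω (n + 1)).1 then some (ω (Nat.find h)).2 else none

/-- Extension of a function on `X` by zero at the cemetery state. -/
def onState {M : Type*} [Zero M] (f : X → M) (o : Option X) : M := o.elim 0 f

open Classical in
/-- The sum of `a (u, ω_{u-}, ω_u)` over the jump times `u ∈ (0, s]` of the path. -/
def jumpSum (a : ℝ → X → X → ℝ) (ω : ℕ → ℝ × X) (s : ℝ) : ℝ :=
  ∑' n, if (ω (n + 1)).1 ≤ s then a (ω (n + 1)).1 (ω n).2 (ω (n + 1)).2 else 0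

open Classical in
/-- The sum of `|a (u, ω_{u-}, ω_u)|` over the jump times `u ∈ (0, s]`, as an extended real. -/
def absJumpSum (a : ℝ → X → X → ℝ) (ω : ℕ → ℝ × X) (s : ℝ) : ℝ≥0∞ :=
  ∑' n, if (ω (n + 1)).1 ≤ s then ‖a (ω (n + 1)).1 (ω n).2 (ω (n + 1)).2‖ₑ else 0

end Paths

section Functionals

variable {X : Type*} [MeasurableSpace X]

/-- The contraction `a_r(s, x) = ∫ a(s, x, y) r(x, dy)`. -/
def contraction (r : TransitionKernel X) (a : ℝ → X → X → ℝ) (s : ℝ) (x : X) : ℝ :=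
  ∫ y, a s x y ∂(r.kernel x)

/-- The contraction `|a|_r(s, x) = ∫ |a(s, x, y)| r(x, dy)`, possibly infinite. -/
def absContraction (r : TransitionKernel X) (a : ℝ → X → X → ℝ) (s : ℝ) (x : X) : ℝ≥0∞ :=
  ∫⁻ y, ‖a s x y‖ₑ ∂(r.kernel x)

/-- Condition `C[ν, t]`: for some `θ > 0` the random variable `∫_0^t |a|_r(s, X_s) ds` has a
finite exponential moment of parameter `θ` under the unperturbed law. -/
def ExpMomentCondition (r : TransitionKernel X) (ν : Measure X) (t : ℝ)
    (a : ℝ → X → X → ℝ) : Prop :=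
  ∃ θ : ℝ, 0 < θ ∧
    ∫⁻ ω, EReal.exp (((ENNReal.ofReal θ *
      ∫⁻ s in Ioc (0 : ℝ) t, onState (absContraction r a s) (stateAt ω s) : ℝ≥0∞)) : EReal)
      ∂(unperturbedLaw r ν) < ∞

/-- Integrability of `a` with respect to the unperturbed process: one of two (equivalent)
bounds holds. -/
def IsIntegrableJumpFunction (r : TransitionKernel X) (ν : Measure X) (t : ℝ)
    (a : ℝ → X → X → ℝ) : Prop :=
  ∫⁻ ω, absJumpSum a ω t ∂(unperturbedLaw r ν) < ∞ ∨
  ∫⁻ ω, (∫⁻ s in Ioc (0 : ℝ) t, onState (absContraction r a s) (stateAt ω s))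
    ∂(unperturbedLaw r ν) < ∞

/-- `G_s = ∑_{u ≤ s} g(u, X_{u-}, X_u) - ∫_0^s g_r(u, X_u) du`, the sum being over jump times. -/
def responseMartingale (r : TransitionKernel X) (g : Perturbation X) (ω : ℕ → ℝ × X) (s : ℝ) : ℝ :=
  jumpSum g.toFun ω s - ∫ u in (0 : ℝ)..s, onState (contraction r g.toFun u) (stateAt ω u)

end Functionals

end MarkovJump

end

open MarkovJump

open MeasureTheory ProbabilityTheory Set Filter Topology
open scoped ENNReal

noncomputable section

namespace MarkovJump

/-! ### Steps of the jump chain, and the density of a perturbed step. -/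

section Kernels

variable {X : Type*} [MeasurableSpace X]

/-! On paths up to time `t` the law of `X^λ` has with respect to that of `X` the Girsanov density
`exp Λ_λ`, where `Λ_λ = λ ∑ g - ∫_0^t (e^{λ g} - 1)_r du`. To first order in `λ` the exponent is `λ
G_t`, so the derivative at `0` of `E[F(X^λ)] = E[F e^{Λ_λ}]` should be `E[F G_t]`. The work lies in
the change of measure and in the domination.

Change of measure: the density of one step is `e^{λ g}` at the jump times the ratio of the survival
probabilities (`lintegral_stepKernel_perturbed`). Multiplying over `n` steps, and adding the
survival factor of the sojourn in progress at `t`, gives the density on the paths with `n` jumps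
(`setLIntegral_perturbedLaw`). Summation over `n` requires that `X^λ` does not explode. On the event
of `n` jumps before `t`, the second moment of the `n`-step density at `λ` is bounded, uniformly in
`n`, by the mass (one) of the density at `4λ` plus an exponential moment of `∫|g|_r du`. The
densities are thus uniformly integrable there, and the event has vanishing probability under both
laws (`ae_isGood_perturbedLaw`).

Domination: put `Y = ∑|g| + ∫_0^t |g|_r du` (`activity`). As `g` is bounded, `|Λ_λ| ≤ |λ| b Y` and
`|Λ_λ - λ G| ≤ λ² c Y`, so `|e^{Λ_λ} - 1 - λ G|` is at most a constant times `λ² e^{εY}`. If `F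
e^{εY}` is integrable, the error is quadratic in `λ` (`hasDerivAt_integral_perturbedLaw`). Condition
`C[ν, t]` controls only the integral in `Y`; the jump part is controlled because the density for the
perturbation `|g|` has mass at most one (`exists_exp_activity`). Hölder's inequality then admits
every `F` in `L^p` with `p > 1`.

For time integrals, Fubini leaves `E[v(s, X_s) G_t]`, in which `G_t` may be replaced by `G_s`
because both expressions are the derivative of the same function of `λ`. For `A = ∑ α`, integration
by parts gives `A_t G_t = ∑ α g + ∑ α G_{u-} + ∫ A_{u-} dG_u`; the compensation formula
(`integral_predictableSum`) turns the first two means into time integrals and makes the third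
vanish. -/

lemma intervalIntegrable_of_abs_le {f : ℝ → ℝ} (hm : Measurable f) {C : ℝ}
    (hC : ∀ s, |f s| ≤ C) (a b : ℝ) : IntervalIntegrable f volume a b :=
  (intervalIntegrable_const (c := C)).mono_fun hm.aestronglyMeasurable
    (ae_of_all _ fun s => by
      change |f s| ≤ |C|; exact (hC s).trans (le_abs_self C))

lemma measurable_totalRate_right (R : Kernel (ℝ × X) X) (x : X) :
    Measurable fun w => totalRate R w x :=
  (measurable_totalRate R).comp (by fun_prop : Measurable fun w : ℝ => (w, x))

lemma intervalIntegrable_totalRate (R : Kernel (ℝ × X) X) [IsRateKernel R] (x : X) (a b : ℝ) :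
    IntervalIntegrable (fun w => totalRate R w x) volume a b := by
  obtain ⟨c, C, hc, hb⟩ := exists_totalRate_bounds R x
  refine intervalIntegrable_of_abs_le (measurable_totalRate_right R x) (C := C) (fun s => ?_) a b
  rw [abs_of_nonneg (hc.le.trans (hb s).1)]
  exact (hb s).2

lemma totalRate_pos (R : Kernel (ℝ × X) X) [IsRateKernel R] (s : ℝ) (x : X) :
    0 < totalRate R s x := by
  obtain ⟨c, C, hc, hb⟩ := exists_totalRate_bounds R x
  exact hc.trans_le (hb s).1

lemma ofReal_totalRate (R : Kernel (ℝ × X) X) [h : IsRateKernel R] (s : ℝ) (x : X) :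
    ENNReal.ofReal (totalRate R s x) = R (s, x) univ := by
  obtain ⟨c, C, hc, hb⟩ := h.exists_bounds x
  exact ENNReal.ofReal_toReal ((hb s).2.trans_lt ENNReal.ofReal_lt_top).ne

/-- Integration against the step kernel: the density of the jump time is the survival probability
times the rate, which cancels the normalization of the jump kernel. -/
lemma lintegral_stepKernel (R : Kernel (ℝ × X) X) [IsRateKernel R] [IsSFiniteKernel R]
    (s : ℝ) (x : X) {f : ℝ × X → ℝ≥0∞} (hf : Measurable f) :
    ∫⁻ q, f q ∂(stepKernel R (s, x)) = ∫⁻ u in Ioi s,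
      ENNReal.ofReal (Real.exp (-∫ w in s..u, totalRate R w x)) * ∫⁻ y, f (u, y) ∂(R (u, x)) := by
  rw [stepKernel, Kernel.lintegral_compProd _ _ _ hf, holdingKernel,
    Kernel.lintegral_withDensity _ (measurable_holdingDensity R)]
  · rw [Kernel.const_apply, ← lintegral_indicator measurableSet_Ioi]
    refine lintegral_congr fun u => ?_
    by_cases hu : s < u
    · rw [indicator_of_mem (show u ∈ Ioi s from hu), holdingDensity, if_pos hu,
        ENNReal.ofReal_mul (totalRate_pos R u x).le, ofReal_totalRate, Kernel.comap_apply]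
      change _ * ∫⁻ c, f (u, c) ∂((R (u, x) univ)⁻¹ • R (u, x)) = _
      rw [lintegral_smul_measure, smul_eq_mul]
      have h1 : R (u, x) univ ≠ 0 := by
        rw [← ofReal_totalRate]; exact (ENNReal.ofReal_pos.2 (totalRate_pos R u x)).ne'
      have h2 : R (u, x) univ ≠ ∞ := by
        rw [← ofReal_totalRate]; exact ENNReal.ofReal_ne_top
      rw [mul_comm (R (u, x) univ), mul_assoc, ← mul_assoc (R (u, x) univ),
        ENNReal.mul_inv_cancel h1 h2, one_mul]
    · rw [indicator_of_notMem (show u ∉ Ioi s from hu), holdingDensity, if_neg hu, zero_mul]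
  · exact Measurable.lintegral_kernel_prod_right'' hf

/-- The survival probability. -/
lemma stepKernel_tail (R : Kernel (ℝ × X) X) [IsRateKernel R] [IsSFiniteKernel R]
    {s t : ℝ} (hst : s ≤ t) (x : X) :
    stepKernel R (s, x) {q | t < q.1}
      = ENNReal.ofReal (Real.exp (-∫ w in s..t, totalRate R w x)) := by
  have hset : MeasurableSet {q : ℝ × X | t < q.1} := measurableSet_lt measurable_const measurable_fst
  obtain ⟨c, C, hc, hb⟩ := exists_totalRate_bounds R x
  have hii := intervalIntegrable_totalRate R x
  have key := lintegral_hazard (measurable_totalRate_right R x) hc hb t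
  rw [← lintegral_indicator_one hset, lintegral_stepKernel R s x (measurable_one.indicator hset)]
  -- Beyond `t`, survival from `s` to `u` splits into survival from `s` to `t` and from `t` to `u`;
  -- the latter times the rate is a probability density on `Ioi t` by `key`.
  have h1 : ∀ u ∈ Ioi s, ENNReal.ofReal (Real.exp (-∫ w in s..u, totalRate R w x)) *
      ∫⁻ y, {q : ℝ × X | t < q.1}.indicator 1 (u, y) ∂(R (u, x))
      = (Ioi t).indicator (fun u => ENNReal.ofReal (Real.exp (-∫ w in s..t, totalRate R w x)) *
        ENNReal.ofReal (totalRate R u x * Real.exp (-∫ w in t..u, totalRate R w x))) u := by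
    intro u hu
    by_cases htu : t < u
    · have e1 : ∀ y : X, {q : ℝ × X | t < q.1}.indicator (1 : ℝ × X → ℝ≥0∞) (u, y) = 1 :=
        fun y => indicator_of_mem (show (u, y) ∈ {q : ℝ × X | t < q.1} from htu) _
      simp only [e1, lintegral_one, indicator_of_mem (show u ∈ Ioi t from htu)]
      rw [← ofReal_totalRate, ← ENNReal.ofReal_mul (Real.exp_pos _).le,
        ← ENNReal.ofReal_mul (Real.exp_pos _).le,
        ← intervalIntegral.integral_add_adjacent_intervals (hii s t) (hii t u), neg_add,
        Real.exp_add]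
      congr 1; ring
    · have e1 : ∀ y : X, {q : ℝ × X | t < q.1}.indicator (1 : ℝ × X → ℝ≥0∞) (u, y) = 0 :=
        fun y => indicator_of_notMem (show (u, y) ∉ {q : ℝ × X | t < q.1} from htu) _
      simp only [e1, lintegral_zero, mul_zero, indicator_of_notMem (show u ∉ Ioi t from htu)]
  rw [setLIntegral_congr_fun measurableSet_Ioi h1, lintegral_indicator measurableSet_Ioi,
    Measure.restrict_restrict measurableSet_Ioi, Ioi_inter_Ioi, sup_of_le_left hst,
    lintegral_const_mul', key, mul_one]
  exact ENNReal.ofReal_ne_top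

lemma stepKernel_ae_lt (R : Kernel (ℝ × X) X) [IsRateKernel R] [IsSFiniteKernel R]
    (p : ℝ × X) : ∀ᵐ q ∂(stepKernel R p), p.1 < q.1 := by
  have h := stepKernel_tail R (le_refl p.1) p.2
  rw [intervalIntegral.integral_same, neg_zero, Real.exp_zero, ENNReal.ofReal_one] at h
  rwa [← prob_compl_eq_zero_iff
    (measurableSet_lt measurable_const measurable_fst : MeasurableSet {q : ℝ × X | p.1 < q.1})] at h

lemma measurable_contraction (r : TransitionKernel X) {a : ℝ → X → X → ℝ}
    (ha : Measurable (fun p : ℝ × X × X => a p.1 p.2.1 p.2.2)) :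
    Measurable (fun p : ℝ × X => contraction r a p.1 p.2) := by
  have h : Measurable fun q : (ℝ × X) × X => a q.1.1 q.1.2 q.2 :=
    ha.comp (by fun_prop : Measurable fun q : (ℝ × X) × X => (q.1.1, q.1.2, q.2))
  exact (h.stronglyMeasurable.integral_kernel_prod_right' (κ := unperturbedRate r)).measurable

lemma isFiniteMeasure_kernel (r : TransitionKernel X) (x : X) : IsFiniteMeasure (r.kernel x) :=
  ⟨r.finite x⟩

lemma integrable_of_bounded (r : TransitionKernel X) {a : ℝ → X → X → ℝ}
    (ha : Measurable (fun p : ℝ × X × X => a p.1 p.2.1 p.2.2)) {C : ℝ}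
    (hC : ∀ s x y, |a s x y| ≤ C) (s : ℝ) (x : X) :
    Integrable (a s x) (r.kernel x) := by
  have := isFiniteMeasure_kernel r x
  exact Integrable.of_bound (ha.comp (by fun_prop : Measurable fun y : X =>
    (s, x, y))).aestronglyMeasurable C (ae_of_all _ fun y => hC s x y)

lemma abs_contraction_le (r : TransitionKernel X) {a b : ℝ → X → X → ℝ} {s : ℝ} {x : X}
    (hb : Integrable (b s x) (r.kernel x)) (h : ∀ y, |a s x y| ≤ b s x y) :
    |contraction r a s x| ≤ contraction r b s x :=
  norm_integral_le_of_norm_le (f := a s x) hb (ae_of_all _ h)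

lemma abs_contraction_le_const (r : TransitionKernel X) {a : ℝ → X → X → ℝ} {C : ℝ}
    (hC : ∀ s x y, |a s x y| ≤ C) (s : ℝ) (x : X) :
    |contraction r a s x| ≤ C * (r.kernel x).real univ := by
  have := isFiniteMeasure_kernel r x
  exact norm_integral_le_of_norm_le_const (f := a s x) (ae_of_all _ fun y => hC s x y)

/-- The relative increase `exp (l * g) - 1` of the rates. -/
def tilt (g : Perturbation X) (l : ℝ) (s : ℝ) (x y : X) : ℝ := Real.exp (l * g.toFun s x y) - 1

lemma measurable_tilt (g : Perturbation X) (l : ℝ) :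
    Measurable (fun p : ℝ × X × X => tilt g l p.1 p.2.1 p.2.2) :=
  (Real.measurable_exp.comp (g.measurable.const_mul l)).sub_const 1

lemma abs_exp_sub_one_le_mul (x : ℝ) : |Real.exp x - 1| ≤ |x| * Real.exp |x| := by
  rcases le_total 0 x with h | h
  · rw [abs_of_nonneg h, abs_of_nonneg (by linarith [Real.one_le_exp h])]
    have h1 := Real.add_one_le_exp (-x)
    have h2 : Real.exp x * Real.exp (-x) = 1 := by rw [← Real.exp_add]; simp
    nlinarith [Real.exp_pos x]
  · rw [abs_of_nonpos h, abs_of_nonpos (by linarith [Real.exp_le_one_iff.2 h])]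
    have h1 := Real.add_one_le_exp x
    have h2 : 1 ≤ Real.exp (-x) := Real.one_le_exp (by linarith)
    nlinarith

/-- The bound is proportional to `|g|` rather than uniform, so that after contraction and
integration it is a multiple of `∫|g|_r du`, the quantity that condition `C[ν, t]` controls. -/
lemma abs_tilt_le {g : Perturbation X} {M : ℝ} (hM : ∀ s x y, |g.toFun s x y| ≤ M) (l : ℝ)
    (s : ℝ) (x y : X) :
    |tilt g l s x y| ≤ |l| * Real.exp (|l| * M) * |g.toFun s x y| := by
  refine (abs_exp_sub_one_le_mul _).trans ?_
  rw [abs_mul]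
  have := Real.exp_le_exp.2 (mul_le_mul_of_nonneg_left (hM s x y) (abs_nonneg l))
  calc |l| * |g.toFun s x y| * Real.exp (|l| * |g.toFun s x y|)
      ≤ |l| * |g.toFun s x y| * Real.exp (|l| * M) := by gcongr
    _ = _ := by ring

lemma exists_tilt_bound (g : Perturbation X) (l : ℝ) : ∃ C : ℝ, ∀ s x y, |tilt g l s x y| ≤ C := by
  obtain ⟨M, hM⟩ := g.bounded
  refine ⟨|l| * Real.exp (|l| * M) * M, fun s x y => (abs_tilt_le hM l s x y).trans ?_⟩
  gcongr
  exact hM s x y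

instance (r : TransitionKernel X) (g : Perturbation X) (l : ℝ) :
    IsSFiniteKernel (perturbedRate r g l) := by
  unfold perturbedRate
  exact Kernel.IsSFiniteKernel.withDensity _ fun _ _ => ENNReal.ofReal_ne_top

/-- This is the origin of the integral in the Girsanov exponent: the survival probabilities of the
two processes differ by the factor `exp (-∫ contraction r (tilt g l))`. -/
lemma totalRate_perturbedRate (r : TransitionKernel X) (g : Perturbation X) (l s : ℝ) (x : X) :
    totalRate (perturbedRate r g l) s x
      = totalRate (unperturbedRate r) s x + contraction r (tilt g l) s x := by
  have := isFiniteMeasure_kernel r x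
  obtain ⟨C, hC⟩ := exists_tilt_bound g l
  have h1 := integrable_of_bounded r (measurable_tilt g l) hC s x
  have h2 : Integrable (fun y => Real.exp (l * g.toFun s x y)) (r.kernel x) := by
    refine (h1.add (integrable_const (1 : ℝ))).congr (ae_of_all _ fun y => ?_)
    simp [tilt]
  have h3 : contraction r (tilt g l) s x
      = ∫ y, Real.exp (l * g.toFun s x y) ∂(r.kernel x) - (r.kernel x).real univ := by
    simp only [contraction, tilt]
    rw [integral_sub h2 (integrable_const _)]; simp
  rw [h3, totalRate, totalRate, perturbedRate_apply, Measure.real,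
    withDensity_apply _ MeasurableSet.univ, setLIntegral_univ,
    ← ofReal_integral_eq_lintegral_ofReal h2 (ae_of_all _ fun y => (Real.exp_pos _).le),
    ENNReal.toReal_ofReal (integral_nonneg fun y => (Real.exp_pos _).le)]
  simp [unperturbedRate, Kernel.comap_apply]

/-- The logarithm of the density of a step of the perturbed chain with respect to the
unperturbed one. -/
def stepLogDensity (r : TransitionKernel X) (g : Perturbation X) (l : ℝ) (p q : ℝ × X) : ℝ :=
  l * g.toFun q.1 p.2 q.2 - ∫ w in p.1..q.1, contraction r (tilt g l) w p.2

lemma measurable_intervalIntegral_param {Y : Type*} [MeasurableSpace Y] {f : Y → ℝ → ℝ}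
    (hf : Measurable (Function.uncurry f)) {a b : Y → ℝ} (ha : Measurable a) (hb : Measurable b) :
    Measurable fun y => ∫ w in (a y)..(b y), f y w := by
  have key : ∀ {a b : Y → ℝ}, Measurable a → Measurable b →
      Measurable fun y => ∫ w in Ioc (a y) (b y), f y w := by
    intro a b ha hb
    have hset : MeasurableSet {q : Y × ℝ | a q.1 < q.2 ∧ q.2 ≤ b q.1} :=
      (measurableSet_lt (ha.comp measurable_fst) measurable_snd).inter
        (measurableSet_le measurable_snd (hb.comp measurable_fst))
    have h := ((hf.indicator hset).stronglyMeasurable.integral_prod_right'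
      (ν := (volume : Measure ℝ))).measurable
    convert h using 2 with y
    rw [← integral_indicator measurableSet_Ioc]
    rfl
  exact (key ha hb).sub (key hb ha)

lemma measurable_stepLogDensity (r : TransitionKernel X) (g : Perturbation X) (l : ℝ) :
    Measurable (Function.uncurry (stepLogDensity r g l)) := by
  refine Measurable.sub ?_ ?_
  · exact (g.measurable.comp (by fun_prop : Measurable fun z : (ℝ × X) × (ℝ × X) =>
      (z.2.1, z.1.2, z.2.2))).const_mul l
  · refine measurable_intervalIntegral_param
      (f := fun (z : (ℝ × X) × (ℝ × X)) w => contraction r (tilt g l) w z.1.2) ?_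
      (by fun_prop) (by fun_prop)
    exact (measurable_contraction r (measurable_tilt g l)).comp
      (by fun_prop : Measurable fun z : ((ℝ × X) × (ℝ × X)) × ℝ => (z.2, z.1.1.2))

lemma intervalIntegrable_contraction (r : TransitionKernel X) {a : ℝ → X → X → ℝ}
    (ha : Measurable (fun p : ℝ × X × X => a p.1 p.2.1 p.2.2)) {C : ℝ}
    (hC : ∀ s x y, |a s x y| ≤ C) (x : X) (u v : ℝ) :
    IntervalIntegrable (fun w => contraction r a w x) volume u v :=
  intervalIntegrable_of_abs_le ((measurable_contraction r ha).comp
    (by fun_prop : Measurable fun w : ℝ => (w, x)))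
    (fun s => abs_contraction_le_const r hC s x) u v

/-- In `lintegral_stepKernel` the normalization of the jump law has cancelled, so the ratio of the
two steps is `exp (l * g)` from the jump kernels times the ratio of the survival probabilities. -/
lemma lintegral_stepKernel_perturbed (r : TransitionKernel X) (g : Perturbation X) (l : ℝ)
    (p : ℝ × X) {f : ℝ × X → ℝ≥0∞} (hf : Measurable f) :
    ∫⁻ q, f q ∂(stepKernel (perturbedRate r g l) p)
      = ∫⁻ q, f q * ENNReal.ofReal (Real.exp (stepLogDensity r g l p q))
        ∂(stepKernel (unperturbedRate r) p) := by
  obtain ⟨s, x⟩ := p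
  obtain ⟨C, hC⟩ := exists_tilt_bound g l
  have hexp : Measurable fun q => ENNReal.ofReal (Real.exp (stepLogDensity r g l (s, x) q)) :=
    ENNReal.measurable_ofReal.comp (Real.measurable_exp.comp
      ((measurable_stepLogDensity r g l).comp measurable_prodMk_left))
  have hprod : Measurable fun q => f q * ENNReal.ofReal (Real.exp (stepLogDensity r g l (s, x) q)) :=
    hf.mul hexp
  rw [lintegral_stepKernel _ s x hf, lintegral_stepKernel _ s x hprod]
  refine setLIntegral_congr_fun measurableSet_Ioi fun u hu => ?_
  have hm : Measurable fun y : X => f (u, y) := hf.comp measurable_prodMk_left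
  have hg : Measurable fun y : X => ENNReal.ofReal (Real.exp (l * g.toFun u x y)) :=
    ENNReal.measurable_ofReal.comp (Real.measurable_exp.comp ((g.measurable.comp
      (by fun_prop : Measurable fun y : X => (u, x, y))).const_mul l))
  change _ * ∫⁻ y, f (u, y) ∂(perturbedRate r g l (u, x)) = _ * ∫⁻ y, _ ∂(r.kernel x)
  rw [perturbedRate_apply, lintegral_withDensity_eq_lintegral_mul _ hg hm,
    ← lintegral_const_mul' _ _ ENNReal.ofReal_ne_top,
    ← lintegral_const_mul' _ _ ENNReal.ofReal_ne_top]
  refine lintegral_congr fun y => ?_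
  have e1 : ∫ w in s..u, totalRate (perturbedRate r g l) w x
      = (∫ w in s..u, totalRate (unperturbedRate r) w x)
        + ∫ w in s..u, contraction r (tilt g l) w x := by
    rw [← intervalIntegral.integral_add (intervalIntegrable_totalRate _ x s u)
      (intervalIntegrable_contraction r (measurable_tilt g l) hC x s u)]
    exact intervalIntegral.integral_congr fun w _ => totalRate_perturbedRate r g l w x
  simp only [Pi.mul_apply, stepLogDensity]
  rw [e1, mul_comm (ENNReal.ofReal (Real.exp (l * g.toFun u x y))), mul_left_comm,
    mul_left_comm _ (f (u, y)), ← ENNReal.ofReal_mul (Real.exp_pos _).le,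
    ← ENNReal.ofReal_mul (Real.exp_pos _).le, ← Real.exp_add, ← Real.exp_add]
  congr 3; ring

end Kernels

/-! ### The Markov property of the chain of jump times and states. -/

section Chain

variable {X : Type*} [MeasurableSpace X]

instance (R : Kernel (ℝ × X) X) [IsRateKernel R] (ν : Measure X) [IsProbabilityMeasure ν] :
    IsProbabilityMeasure (pathLaw R ν) := by
  unfold pathLaw; infer_instance

/-- Extension of a finite sequence by its last entry. -/
def extendLast (n : ℕ) (h : Π _ : Finset.Iic n, ℝ × X) (k : ℕ) : ℝ × X :=
  h ⟨min k n, Finset.mem_Iic.2 (min_le_right k n)⟩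

lemma measurable_extendLast (n : ℕ) : Measurable (extendLast (X := X) n) := by
  unfold extendLast; fun_prop

/-- The Markov property of the chain of jump times and states. -/
lemma lintegral_pathLaw_succ (R : Kernel (ℝ × X) X) [IsRateKernel R] (ν : Measure X)
    [IsProbabilityMeasure ν] (n : ℕ) {f : (ℕ → ℝ × X) → ℝ × X → ℝ≥0∞}
    (hf : Measurable (Function.uncurry f)) (hdep : ∀ q, DependsOn (fun ω => f ω q) (Iic n)) :
    ∫⁻ ω, f ω (ω (n + 1)) ∂(pathLaw R ν)
      = ∫⁻ ω, ∫⁻ q, f ω q ∂(stepKernel R (ω n)) ∂(pathLaw R ν) := by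
  -- The trajectory measure disintegrates over its first `n + 1` entries, so `f` is factored through
  -- them; by `hdep` it does not see the artificial constant tail of `extendLast`.
  set F : (Π _ : Finset.Iic n, ℝ × X) × (ℝ × X) → ℝ≥0∞ := fun z => f (extendLast n z.1) z.2
  have hF : Measurable F := hf.comp
    (((measurable_extendLast n).comp measurable_fst).prodMk measurable_snd)
  have hfF : ∀ ω q, f ω q = F (Preorder.frestrictLe n ω, q) := fun ω q =>
    hdep q fun k hk => by
      have hk' : min k n = k := min_eq_left hk
      simp [extendLast, hk']
  have key := Kernel.map_frestrictLe_trajMeasure_compProd_eq_map_trajMeasure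
    (X := fun _ : ℕ => ℝ × X) (κ := chainKernel R) (μ₀ := (Measure.dirac (0 : ℝ)).prod ν) (a := n)
  have hmr : Measurable (Preorder.frestrictLe (π := fun _ : ℕ => ℝ × X) n) := by fun_prop
  calc ∫⁻ ω, f ω (ω (n + 1)) ∂(pathLaw R ν)
      = ∫⁻ ω, F (Preorder.frestrictLe n ω, ω (n + 1)) ∂(pathLaw R ν) := by simp_rw [hfF]
    _ = ∫⁻ z, F z ∂((pathLaw R ν).map (fun ω => (Preorder.frestrictLe n ω, ω (n + 1)))) := by
      rw [lintegral_map hF (by fun_prop)]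
    _ = ∫⁻ z, F z ∂(((pathLaw R ν).map (Preorder.frestrictLe n)) ⊗ₘ chainKernel R n) := by
      rw [pathLaw, key]
    _ = ∫⁻ h, ∫⁻ q, F (h, q) ∂(chainKernel R n h) ∂((pathLaw R ν).map (Preorder.frestrictLe n)) :=
      Measure.lintegral_compProd hF
    _ = ∫⁻ ω, ∫⁻ q, F (Preorder.frestrictLe n ω, q)
          ∂(chainKernel R n (Preorder.frestrictLe n ω)) ∂(pathLaw R ν) :=
      lintegral_map hF.lintegral_kernel_prod_right' hmr
    _ = _ := by
      simp_rw [hfF]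
      rfl

lemma pathLaw_map_zero (R : Kernel (ℝ × X) X) [IsRateKernel R] (ν : Measure X)
    [IsProbabilityMeasure ν] :
    (pathLaw R ν).map (fun ω => ω 0) = (Measure.dirac (0 : ℝ)).prod ν := by
  have h1 : (fun ω : ℕ → ℝ × X => ω 0)
      = (fun h : Π _ : Finset.Iic 0, ℝ × X => h ⟨0, by simp⟩) ∘ Preorder.frestrictLe 0 := rfl
  rw [h1, ← Measure.map_map (by fun_prop) (by fun_prop), pathLaw, Kernel.trajMeasure,
    Measure.map_comp _ _ (by fun_prop), Kernel.traj_map_frestrictLe, Kernel.partialTraj_self,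
    Measure.id_comp, Measure.map_map (by fun_prop) (by fun_prop)]
  exact Measure.map_id

end Chain

/-! ### Deterministic paths: jump counts, frozen paths, local functionals. -/

section PathLemmas

variable {X : Type*}

/-- Paths whose jump times start at `0` and increase. -/
def IsRegular (ω : ℕ → ℝ × X) : Prop := (ω 0).1 = 0 ∧ Monotone fun n => (ω n).1

/-- The paths that make exactly `n` jumps up to time `t`. -/
def jumpCountSet (t : ℝ) (n : ℕ) : Set (ℕ → ℝ × X) := {ω | (ω n).1 ≤ t ∧ t < (ω (n + 1)).1}

/-- The path which follows `ω` for `n` jumps and then waits until time `u + 1`. -/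
def freeze (n : ℕ) (u : ℝ) (ω : ℕ → ℝ × X) (k : ℕ) : ℝ × X :=
  if k ≤ n then ω k else (u + 1, (ω n).2)

/-- Functionals of non-exploding paths which only depend on the path up to time `t`. -/
def IsLocal {E : Type*} (t : ℝ) (F : (ℕ → ℝ × X) → E) : Prop :=
  ∀ n ω ω', IsRegular ω → IsRegular ω' → (∀ k ≤ n, ω k = ω' k) →
    ω ∈ jumpCountSet t n → ω' ∈ jumpCountSet t n → F ω = F ω'

lemma freeze_of_le {n k : ℕ} (h : k ≤ n) (u : ℝ) (ω : ℕ → ℝ × X) : freeze n u ω k = ω k := if_pos h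

lemma freeze_mem_jumpCountSet {n : ℕ} {u : ℝ} {ω : ℕ → ℝ × X} (h : (ω n).1 ≤ u) :
    freeze n u ω ∈ jumpCountSet u n := by
  refine ⟨by rwa [freeze_of_le le_rfl], ?_⟩
  simp [freeze]

lemma IsRegular.freeze {n : ℕ} {u : ℝ} {ω : ℕ → ℝ × X} (hω : IsRegular ω) (h : (ω n).1 ≤ u) :
    IsRegular (freeze n u ω) := by
  refine ⟨by rw [freeze_of_le (Nat.zero_le n)]; exact hω.1, fun i j hij => ?_⟩
  simp only [MarkovJump.freeze]
  split_ifs with h1 h2 h2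
  · exact hω.2 hij
  · exact (hω.2 h1).trans (by simp only; linarith)
  · omega
  · exact le_rfl

lemma dependsOn_freeze {E : Type*} (F : (ℕ → ℝ × X) → E) (n : ℕ) (u : ℝ) :
    DependsOn (fun ω => F (freeze n u ω)) (Iic n) := by
  intro ω ω' h
  have : freeze n u ω = freeze n u ω' := by
    funext k
    simp only [freeze]
    split_ifs with hk
    · exact h k hk
    · rw [h n (mem_Iic.2 le_rfl)]
  simp only [this]

/-- On `jumpCountSet t n` a local functional can thus be replaced by one that depends on the entries
up to `n` alone (`dependsOn_freeze`), the form which the Markov property at step `n` accepts. -/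
lemma IsLocal.freeze_eq {E : Type*} {t : ℝ} {F : (ℕ → ℝ × X) → E} (hF : IsLocal t F) {n : ℕ}
    {ω : ℕ → ℝ × X} (hω : IsRegular ω) (hn : ω ∈ jumpCountSet t n) : F (freeze n t ω) = F ω :=
  hF n _ _ (hω.freeze hn.1) hω (fun _ hk => freeze_of_le hk t ω)
    (freeze_mem_jumpCountSet hn.1) hn

lemma IsLocal.comp {E E' : Type*} {t : ℝ} {F : (ℕ → ℝ × X) → E} (hF : IsLocal t F) (φ : E → E') :
    IsLocal t fun ω => φ (F ω) :=
  fun n ω ω' h h' he hn hn' => congrArg φ (hF n ω ω' h h' he hn hn')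

lemma IsRegular.nonneg {ω : ℕ → ℝ × X} (hω : IsRegular ω) (n : ℕ) : 0 ≤ (ω n).1 := by
  rw [← hω.1]; exact hω.2 (Nat.zero_le n)

lemma IsRegular.le_of_mem_jumpCountSet {ω : ℕ → ℝ × X} (hω : IsRegular ω) {s t : ℝ} (hst : s ≤ t)
    {m n : ℕ} (hm : ω ∈ jumpCountSet s m) (hn : ω ∈ jumpCountSet t n) : m ≤ n := by
  by_contra! h
  have := hω.2 (Nat.succ_le_of_lt h)
  simp only [Nat.succ_eq_add_one] at this
  linarith [hm.1, hn.2]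

lemma IsRegular.eq_of_mem_jumpCountSet {ω : ℕ → ℝ × X} (hω : IsRegular ω) {t : ℝ}
    {m n : ℕ} (hm : ω ∈ jumpCountSet t m) (hn : ω ∈ jumpCountSet t n) : m = n :=
  le_antisymm (hω.le_of_mem_jumpCountSet le_rfl hm hn) (hω.le_of_mem_jumpCountSet le_rfl hn hm)

lemma IsRegular.exists_mem_jumpCountSet {ω : ℕ → ℝ × X} (hω : IsRegular ω) {s : ℝ} (hs : 0 ≤ s)
    {n : ℕ} (hn : s < (ω (n + 1)).1) : ∃ m ≤ n, ω ∈ jumpCountSet s m := by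
  classical
  have h : ∃ n, s < (ω (n + 1)).1 := ⟨n, hn⟩
  refine ⟨Nat.find h, Nat.find_min' h hn, ?_, Nat.find_spec h⟩
  rcases Nat.eq_zero_or_pos (Nat.find h) with h0 | h0
  · rw [h0, hω.1]; exact hs
  · have := Nat.find_min h (Nat.sub_lt h0 one_pos)
    rw [Nat.sub_add_cancel (Nat.one_le_iff_ne_zero.2 h0.ne')] at this
    exact not_lt.1 this

/-- If `ω` has `m ≤ n` jumps up to `s`, so does `ω'`: for `m < n` the entry `m + 1` is among the
shared ones, and for `m = n` the next jump of `ω'` comes after `t ≥ s`. -/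
lemma IsLocal.mono {E : Type*} {s t : ℝ} {F : (ℕ → ℝ × X) → E} (hF : IsLocal s F) (hs : 0 ≤ s)
    (hst : s ≤ t) : IsLocal t F := by
  intro n ω ω' h h' he hn hn'
  obtain ⟨m, hmn, hm⟩ := h.exists_mem_jumpCountSet hs (hst.trans_lt hn.2)
  refine hF m ω ω' h h' (fun k hk => he k (hk.trans hmn)) hm ⟨?_, ?_⟩
  · rw [← he m hmn]; exact hm.1
  · rcases hmn.eq_or_lt with rfl | hlt
    · exact hst.trans_lt hn'.2
    · rw [← he (m + 1) hlt]; exact hm.2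

lemma IsRegular.stateAt_eq {ω : ℕ → ℝ × X} (hω : IsRegular ω) {s : ℝ} {n : ℕ}
    (hn : ω ∈ jumpCountSet s n) : stateAt ω s = some (ω n).2 := by
  classical
  have h : ∃ n, s < (ω (n + 1)).1 := ⟨n, hn.2⟩
  have hf : Nat.find h = n := (Nat.find_eq_iff h).2
    ⟨hn.2, fun m hm => not_lt.2 ((hω.2 (Nat.succ_le_of_lt hm)).trans hn.1)⟩
  rw [stateAt, dif_pos h, hf]

lemma isLocal_stateAt (s : ℝ) : IsLocal s fun ω : ℕ → ℝ × X => stateAt ω s := by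
  intro n ω ω' h h' he hn hn'
  simp only
  rw [h.stateAt_eq hn, h'.stateAt_eq hn', he n le_rfl]

lemma IsRegular.jump_le_iff {ω : ℕ → ℝ × X} (hω : IsRegular ω) {s : ℝ} {n : ℕ}
    (hn : ω ∈ jumpCountSet s n) (k : ℕ) : (ω (k + 1)).1 ≤ s ↔ k < n := by
  constructor
  · intro h
    by_contra! hk
    have := hω.2 (Nat.succ_le_succ hk)
    simp only [Nat.succ_eq_add_one] at this
    linarith [hn.2]
  · exact fun h => (hω.2 (Nat.succ_le_of_lt h)).trans hn.1

lemma IsRegular.jumpSum_eq {ω : ℕ → ℝ × X} (hω : IsRegular ω) (a : ℝ → X → X → ℝ) {s : ℝ} {n : ℕ}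
    (hn : ω ∈ jumpCountSet s n) :
    jumpSum a ω s = ∑ k ∈ Finset.range n, a (ω (k + 1)).1 (ω k).2 (ω (k + 1)).2 := by
  rw [jumpSum, tsum_eq_sum (s := Finset.range n)]
  · exact Finset.sum_congr rfl fun k hk =>
      if_pos ((hω.jump_le_iff hn k).2 (Finset.mem_range.1 hk))
  · exact fun k hk => if_neg fun h => hk (Finset.mem_range.2 ((hω.jump_le_iff hn k).1 h))

lemma isLocal_jumpSum (a : ℝ → X → X → ℝ) (s : ℝ) :
    IsLocal s fun ω : ℕ → ℝ × X => jumpSum a ω s := by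
  intro n ω ω' h h' he hn hn'
  simp only
  rw [h.jumpSum_eq a hn, h'.jumpSum_eq a hn']
  refine Finset.sum_congr rfl fun k hk => ?_
  have := Finset.mem_range.1 hk
  rw [he k (by omega), he (k + 1) (by omega)]

lemma isLocal_integral_stateAt {M : Type*} [Zero M] (f : ℝ → X → M) {E : Type*} [NormedAddCommGroup E]
    [NormedSpace ℝ E] (φ : M → E) {s : ℝ} (hs : 0 ≤ s) :
    IsLocal s fun ω : ℕ → ℝ × X => ∫ u in (0 : ℝ)..s, φ (onState (f u) (stateAt ω u)) := by
  intro n ω ω' h h' he hn hn'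
  refine intervalIntegral.integral_congr fun u hu => ?_
  rw [uIcc_of_le hs] at hu
  have := ((isLocal_stateAt u).mono hu.1 hu.2) n ω ω' h h' he hn hn'
  simp only at this ⊢
  rw [this]

lemma isLocal_lintegral_stateAt (f : ℝ → X → ℝ≥0∞) (s : ℝ) :
    IsLocal s fun ω : ℕ → ℝ × X => ∫⁻ u in Ioc 0 s, onState (f u) (stateAt ω u) := by
  intro n ω ω' h h' he hn hn'
  refine setLIntegral_congr_fun measurableSet_Ioc fun u hu => ?_
  have := ((isLocal_stateAt u).mono hu.1.le hu.2) n ω ω' h h' he hn hn'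
  simp only at this ⊢
  rw [this]

/-- A null set must be excluded: `u` may be the next jump time, at which the right-continuous path
has already left `(ω n).2`. -/
lemma IsRegular.onState_piece {ω : ℕ → ℝ × X} (hω : IsRegular ω) (f : ℝ → X → ℝ)
    {n : ℕ} {u : ℝ} (hu : u ≤ (ω (n + 1)).1) :
    ∀ᵐ w ∂volume, w ∈ Ioc (ω n).1 u → onState (f w) (stateAt ω w) = f w (ω n).2 := by
  filter_upwards [compl_mem_ae_iff.2 (measure_singleton ((ω (n + 1)).1))] with w hw hwu
  rw [hω.stateAt_eq (n := n) ⟨hwu.1.le, lt_of_le_of_ne (hwu.2.trans hu) hw⟩]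
  rfl

/-- The integral of an observable along a path, as a sum over the sojourns. -/
lemma IsRegular.integral_onState {ω : ℕ → ℝ × X} (hω : IsRegular ω) {f : ℝ → X → ℝ}
    (hf : ∀ x a b, IntervalIntegrable (fun w => f w x) volume a b) (n : ℕ) :
    ∀ {u : ℝ}, (ω n).1 ≤ u → u ≤ (ω (n + 1)).1 →
      IntervalIntegrable (fun w => onState (f w) (stateAt ω w)) volume 0 u ∧
      ∫ w in (0 : ℝ)..u, onState (f w) (stateAt ω w)
        = ∑ k ∈ Finset.range n, (∫ w in (ω k).1..(ω (k + 1)).1, f w (ω k).2)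
          + ∫ w in (ω n).1..u, f w (ω n).2 := by
  have piece : ∀ (n : ℕ) {u : ℝ}, (ω n).1 ≤ u → u ≤ (ω (n + 1)).1 →
      IntervalIntegrable (fun w => onState (f w) (stateAt ω w)) volume (ω n).1 u ∧
      ∫ w in (ω n).1..u, onState (f w) (stateAt ω w) = ∫ w in (ω n).1..u, f w (ω n).2 := by
    intro n u h1 h2
    have hae := hω.onState_piece f h2
    constructor
    · refine (hf (ω n).2 (ω n).1 u).congr_ae ?_
      rw [uIoc_of_le h1]
      refine (ae_restrict_iff' measurableSet_Ioc).2 ?_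
      filter_upwards [hae] with w hw hwu using (hw hwu).symm
    · refine intervalIntegral.integral_congr_ae ?_
      rw [uIoc_of_le h1]; exact hae
  induction n with
  | zero =>
    intro u h1 h2
    have := piece 0 h1 h2
    rw [hω.1] at this
    simpa [hω.1] using this
  | succ n ih =>
    intro u h1 h2
    obtain ⟨i1, e1⟩ := ih (hω.2 (Nat.le_succ n)) le_rfl
    obtain ⟨i2, e2⟩ := piece (n + 1) h1 h2
    refine ⟨i1.trans i2, ?_⟩
    rw [← intervalIntegral.integral_add_adjacent_intervals i1 i2, e1, e2, Finset.sum_range_succ]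

end PathLemmas

/-! ### Joint measurability in the path and the time; almost sure regularity. -/

section PathMeasurability

variable {X : Type*} [MeasurableSpace X]

lemma measurable_freeze (n : ℕ) :
    Measurable fun p : (ℕ → ℝ × X) × ℝ => freeze n p.2 p.1 := by
  refine measurable_pi_lambda _ fun k => ?_
  by_cases hk : k ≤ n
  · simp only [freeze, if_pos hk]; fun_prop
  · simp only [freeze, if_neg hk]; fun_prop

lemma measurable_freeze_left (n : ℕ) (u : ℝ) : Measurable (freeze (X := X) n u) :=
  (measurable_freeze n).comp (by fun_prop : Measurable fun ω : ℕ → ℝ × X => (ω, u))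

lemma measurableSet_jumpCountSet (t : ℝ) (n : ℕ) :
    MeasurableSet (jumpCountSet (X := X) t n) := by
  have h1 : MeasurableSet {ω : ℕ → ℝ × X | (ω n).1 ≤ t} :=
    measurableSet_le (by fun_prop) measurable_const
  have h2 : MeasurableSet {ω : ℕ → ℝ × X | t < (ω (n + 1)).1} :=
    measurableSet_lt measurable_const (by fun_prop)
  exact h1.inter h2

/-- The observable is written as a series in `n`, in which the only term that can be nonzero is that
of the first `n` whose successor jump comes after the given time. Each term is visibly measurable.
-/
lemma measurable_onState_stateAt_param {E : Type*} [AddCommMonoid E] [TopologicalSpace E]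
    [TopologicalSpace.IsCompletelyPseudoMetrizableSpace E] [SecondCountableTopology E]
    [MeasurableSpace E] [BorelSpace E] [MeasurableAdd₂ E] [T2Space E]
    {f : (ℕ → ℝ × X) × ℝ → X → E} (hf : Measurable (Function.uncurry f)) :
    Measurable fun p : (ℕ → ℝ × X) × ℝ => onState (f p) (stateAt p.1 p.2) := by
  classical
  have h1 : ∀ p : (ℕ → ℝ × X) × ℝ, onState (f p) (stateAt p.1 p.2)
      = ∑' n, if p.2 < (p.1 (n + 1)).1 ∧ ∀ m < n, (p.1 (m + 1)).1 ≤ p.2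
          then f p (p.1 n).2 else 0 := by
    rintro ⟨ω, s⟩
    simp only
    by_cases h : ∃ n, s < (ω (n + 1)).1
    · have hiff : ∀ n, (s < (ω (n + 1)).1 ∧ ∀ m < n, (ω (m + 1)).1 ≤ s) ↔ Nat.find h = n := by
        intro n
        rw [Nat.find_eq_iff]
        simp only [not_lt]
      rw [stateAt, dif_pos h, tsum_eq_single (Nat.find h), if_pos ((hiff _).2 rfl)]
      · rfl
      · exact fun n hn => if_neg fun h' => hn ((hiff n).1 h').symm
    · rw [stateAt, dif_neg h]
      have : ∀ n, ¬ (s < (ω (n + 1)).1 ∧ ∀ m < n, (ω (m + 1)).1 ≤ s) :=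
        fun n hn => h ⟨n, hn.1⟩
      simp only [this, if_false, tsum_zero]
      rfl
  simp_rw [h1]
  refine Measurable.tsum fun n => Measurable.ite ?_ ?_ measurable_const
  · have h0 : MeasurableSet {p : (ℕ → ℝ × X) × ℝ | p.2 < (p.1 (n + 1)).1} :=
      measurableSet_lt (by fun_prop) (by fun_prop)
    have h2 : MeasurableSet {p : (ℕ → ℝ × X) × ℝ | ∀ m < n, (p.1 (m + 1)).1 ≤ p.2} := by
      simp only [Set.ofPred_forall]
      exact MeasurableSet.iInter fun m => MeasurableSet.iInter fun _ =>
        measurableSet_le (by fun_prop) (by fun_prop)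
    exact h0.inter h2
  · exact hf.comp (by fun_prop : Measurable fun p : (ℕ → ℝ × X) × ℝ => (p, (p.1 n).2))

lemma measurable_onState_stateAt {E : Type*} [AddCommMonoid E] [TopologicalSpace E]
    [TopologicalSpace.IsCompletelyPseudoMetrizableSpace E] [SecondCountableTopology E]
    [MeasurableSpace E] [BorelSpace E] [MeasurableAdd₂ E] [T2Space E] {f : ℝ → X → E}
    (hf : Measurable (Function.uncurry f)) :
    Measurable fun p : (ℕ → ℝ × X) × ℝ => onState (f p.2) (stateAt p.1 p.2) :=
  measurable_onState_stateAt_param (f := fun p x => f p.2 x)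
    (hf.comp (by fun_prop : Measurable fun z : ((ℕ → ℝ × X) × ℝ) × X => (z.1.2, z.2)))

lemma measurable_jumpSum {a : ℝ → X → X → ℝ}
    (ha : Measurable (fun p : ℝ × X × X => a p.1 p.2.1 p.2.2)) :
    Measurable fun p : (ℕ → ℝ × X) × ℝ => jumpSum a p.1 p.2 := by
  refine Measurable.tsum fun n => Measurable.ite
    (measurableSet_le (by fun_prop) (by fun_prop)) ?_ measurable_const
  exact ha.comp (by fun_prop : Measurable fun p : (ℕ → ℝ × X) × ℝ =>
    ((p.1 (n + 1)).1, (p.1 n).2, (p.1 (n + 1)).2))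

lemma measurable_integral_onState {f : ℝ → X → ℝ} (hf : Measurable (Function.uncurry f)) :
    Measurable fun p : (ℕ → ℝ × X) × ℝ => ∫ u in (0 : ℝ)..p.2, onState (f u) (stateAt p.1 u) :=
  measurable_intervalIntegral_param
    (f := fun (p : (ℕ → ℝ × X) × ℝ) u => onState (f u) (stateAt p.1 u))
    ((measurable_onState_stateAt hf).comp
      (by fun_prop : Measurable fun q : ((ℕ → ℝ × X) × ℝ) × ℝ => (q.1.1, q.2)))
    measurable_const measurable_snd

lemma measurable_responseMartingale (r : TransitionKernel X) (g : Perturbation X) :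
    Measurable fun p : (ℕ → ℝ × X) × ℝ => responseMartingale r g p.1 p.2 :=
  (measurable_jumpSum g.measurable).sub
    (measurable_integral_onState (measurable_contraction r g.measurable))

lemma isLocal_responseMartingale (r : TransitionKernel X) (g : Perturbation X) {s : ℝ}
    (hs : 0 ≤ s) : IsLocal s fun ω => responseMartingale r g ω s := by
  intro n ω ω' h h' he hn hn'
  exact congrArg₂ (· - ·) (isLocal_jumpSum g.toFun s n ω ω' h h' he hn hn')
    (isLocal_integral_stateAt (contraction r g.toFun) id hs n ω ω' h h' he hn hn')

variable (R : Kernel (ℝ × X) X) [IsRateKernel R] [IsSFiniteKernel R] (ν : Measure X)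
  [IsProbabilityMeasure ν]

lemma ae_isRegular : ∀ᵐ ω ∂(pathLaw R ν), IsRegular ω := by
  have h0 : ∀ᵐ ω ∂(pathLaw R ν), (ω 0).1 = 0 := by
    have h : ∀ᵐ p ∂((pathLaw R ν).map (fun ω => ω 0)), p.1 = 0 := by
      rw [pathLaw_map_zero]
      have : ∀ᵐ s ∂(((Measure.dirac (0 : ℝ)).prod ν).map Prod.fst), s = 0 := by
        rw [← Measure.fst, Measure.fst_prod]
        exact (ae_dirac_iff (p := fun s : ℝ => s = 0) (measurableSet_singleton 0)).2 rfl
      exact ae_of_ae_map (by fun_prop) this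
    exact ae_of_ae_map (measurable_pi_apply 0).aemeasurable h
  have h1 : ∀ n, ∀ᵐ ω ∂(pathLaw R ν), (ω n).1 ≤ (ω (n + 1)).1 := by
    intro n
    have hset : MeasurableSet {z : (ℕ → ℝ × X) × (ℝ × X) | z.2.1 < (z.1 n).1} :=
      measurableSet_lt (by fun_prop) (by fun_prop)
    have key := lintegral_pathLaw_succ R ν n
      (f := fun ω q => {z : (ℕ → ℝ × X) × (ℝ × X) | z.2.1 < (z.1 n).1}.indicator 1 (ω, q))
      (measurable_one.indicator hset) (fun q ω ω' h => by
        simp only [indicator, mem_ofPred_eq, h n (mem_Iic.2 le_rfl), Pi.one_apply])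
    have hz : ∀ ω : ℕ → ℝ × X, ∫⁻ q, {z : (ℕ → ℝ × X) × (ℝ × X) | z.2.1 < (z.1 n).1}.indicator
        (1 : (ℕ → ℝ × X) × (ℝ × X) → ℝ≥0∞) (ω, q) ∂(stepKernel R (ω n)) = 0 := by
      intro ω
      refine (lintegral_congr_ae ?_).trans lintegral_zero
      filter_upwards [stepKernel_ae_lt R (ω n)] with q hq
      exact indicator_of_notMem (by simpa using hq.le) _
    simp only [hz, lintegral_zero] at key
    have hm : Measurable fun ω : ℕ → ℝ × X =>
        {z : (ℕ → ℝ × X) × (ℝ × X) | z.2.1 < (z.1 n).1}.indicator (1 : (ℕ → ℝ × X) × (ℝ × X) → ℝ≥0∞) (ω, ω (n + 1)) :=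
      (measurable_one.indicator hset).comp
        (by fun_prop : Measurable fun ω : ℕ → ℝ × X => (ω, ω (n + 1)))
    filter_upwards [(lintegral_eq_zero_iff hm).1 key] with ω hω
    by_contra! hlt
    have h2 := indicator_of_mem (show (ω, ω (n + 1)) ∈
      {z : (ℕ → ℝ × X) × (ℝ × X) | z.2.1 < (z.1 n).1} from hlt) (1 : (ℕ → ℝ × X) × (ℝ × X) → ℝ≥0∞)
    exact one_ne_zero (h2.symm.trans hω)
  filter_upwards [h0, ae_all_iff.2 h1] with ω h0 h1
  exact ⟨h0, monotone_nat_of_le_succ h1⟩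

end PathMeasurability

/-! ### Change of measure for finitely many steps, and for paths with `n` jumps. -/

section Girsanov

variable {X : Type*} [MeasurableSpace X] (r : TransitionKernel X) (g : Perturbation X) (l : ℝ)

/-- The logarithm of the density of the first `n` steps of the perturbed chain with respect to
the unperturbed one. -/
def chainLogDensity (n : ℕ) (ω : ℕ → ℝ × X) : ℝ :=
  ∑ k ∈ Finset.range n, stepLogDensity r g l (ω k) (ω (k + 1))

/-- The logarithm of the density, up to time `t`, of the law of the perturbed process with respect
to that of the unperturbed one. -/
def pathLogDensity (t : ℝ) (ω : ℕ → ℝ × X) : ℝ :=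
  l * jumpSum g.toFun ω t
    - ∫ u in (0 : ℝ)..t, onState (contraction r (tilt g l) u) (stateAt ω u)

lemma measurable_chainLogDensity (n : ℕ) : Measurable (chainLogDensity r g l n) :=
  Finset.measurable_fun_sum _ fun k _ => (measurable_stepLogDensity r g l).comp
    (by fun_prop : Measurable fun ω : ℕ → ℝ × X => (ω k, ω (k + 1)))

lemma dependsOn_chainLogDensity (n : ℕ) : DependsOn (chainLogDensity r g l n) (Iic n) := by
  intro ω ω' h
  refine Finset.sum_congr rfl fun k hk => ?_
  have := Finset.mem_range.1 hk
  rw [h k (mem_Iic.2 this.le), h (k + 1) (mem_Iic.2 this)]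

lemma measurable_pathLogDensity (t : ℝ) : Measurable (pathLogDensity r g l t) :=
  (((measurable_jumpSum g.measurable).comp measurable_prodMk_right).const_mul l).sub
    ((measurable_integral_onState (measurable_contraction r (measurable_tilt g l))).comp
      measurable_prodMk_right)

lemma intervalIntegrable_contraction_tilt (x : X) (a b : ℝ) :
    IntervalIntegrable (fun w => contraction r (tilt g l) w x) volume a b :=
  let ⟨_, hC⟩ := exists_tilt_bound g l
  intervalIntegrable_contraction r (measurable_tilt g l) hC x a b

/-- The sojourn integrals of the single steps join into one integral along the path, which can then
be compared with the integral of `|g|_r`. -/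
lemma IsRegular.chainLogDensity_eq {ω : ℕ → ℝ × X} (hω : IsRegular ω) (n : ℕ) :
    chainLogDensity r g l n ω
      = l * ∑ k ∈ Finset.range n, g.toFun (ω (k + 1)).1 (ω k).2 (ω (k + 1)).2
        - ∫ u in (0 : ℝ)..(ω n).1, onState (contraction r (tilt g l) u) (stateAt ω u) := by
  rw [(hω.integral_onState (intervalIntegrable_contraction_tilt r g l) n le_rfl
    (hω.2 (Nat.le_succ n))).2, intervalIntegral.integral_same, add_zero, Finset.mul_sum,
    ← Finset.sum_sub_distrib]
  rfl

/-- The sojourn in progress at time `t` contributes a survival factor and no jump term. -/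
lemma IsRegular.pathLogDensity_eq {ω : ℕ → ℝ × X} (hω : IsRegular ω) {t : ℝ} {n : ℕ}
    (hn : ω ∈ jumpCountSet t n) :
    pathLogDensity r g l t ω
      = chainLogDensity r g l n ω - ∫ u in (ω n).1..t, contraction r (tilt g l) u (ω n).2 := by
  have h1 := (hω.integral_onState (intervalIntegrable_contraction_tilt r g l) n hn.1 hn.2.le).2
  have h2 := (hω.integral_onState (intervalIntegrable_contraction_tilt r g l) n le_rfl
    (hω.2 (Nat.le_succ n))).2
  rw [intervalIntegral.integral_same, add_zero] at h2
  rw [pathLogDensity, hω.chainLogDensity_eq, hω.jumpSum_eq g.toFun hn, h1, h2]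
  ring

variable (ν : Measure X) [IsProbabilityMeasure ν]

/-- Induction on `n`: the two chains have the same initial law, and the Markov property isolates the
last step, which is exchanged for its density. -/
lemma lintegral_perturbedLaw_chain (n : ℕ) : ∀ {f : (ℕ → ℝ × X) → ℝ≥0∞}, Measurable f →
    DependsOn f (Iic n) →
    ∫⁻ ω, f ω ∂(perturbedLaw r g l ν)
      = ∫⁻ ω, f ω * ENNReal.ofReal (Real.exp (chainLogDensity r g l n ω))
        ∂(unperturbedLaw r ν) := by
  induction n with
  | zero =>
    intro f hf hdep
    have h1 : ∀ (R : Kernel (ℝ × X) X) [IsRateKernel R],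
        ∫⁻ ω, f ω ∂(pathLaw R ν) = ∫⁻ p, f (fun _ => p) ∂((Measure.dirac (0 : ℝ)).prod ν) := by
      intro R _
      have hm : Measurable fun p : ℝ × X => f (fun _ => p) :=
        hf.comp (measurable_pi_lambda _ fun _ => measurable_id)
      rw [← pathLaw_map_zero R ν, lintegral_map hm (measurable_pi_apply 0)]
      exact lintegral_congr fun ω => hdep fun k hk => by
        rw [Nat.le_zero.1 hk]
    simp only [chainLogDensity, Finset.range_zero, Finset.sum_empty, Real.exp_zero,
      ENNReal.ofReal_one, mul_one]
    rw [perturbedLaw, unperturbedLaw, h1, h1]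
  | succ n ih =>
    intro f hf hdep
    -- Entry `n + 1` becomes a separate argument, so that what remains depends on the entries up to
    -- `n`.
    set f' : (ℕ → ℝ × X) → ℝ × X → ℝ≥0∞ := fun ω q => f (Function.update ω (n + 1) q) with hf'
    have hmf' : Measurable (Function.uncurry f') :=
      hf.comp (measurable_update' (X := fun _ : ℕ => ℝ × X) (a := n + 1))
    have hdep' : ∀ q, DependsOn (fun ω => f' ω q) (Iic n) := fun q ω ω' h => hdep fun k hk => by
      rcases eq_or_ne k (n + 1) with rfl | hne
      · simp
      · have hk' : k ≤ n + 1 := hk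
        rw [Function.update_of_ne hne, Function.update_of_ne hne, h k (mem_Iic.2 (by omega))]
    have hff' : ∀ ω, f ω = f' ω (ω (n + 1)) := fun ω => by
      rw [hf']; simp only [Function.update_eq_self]
    have hρ : Measurable fun z : (ℕ → ℝ × X) × (ℝ × X) =>
        ENNReal.ofReal (Real.exp (stepLogDensity r g l (z.1 n) z.2)) :=
      ENNReal.measurable_ofReal.comp (Real.measurable_exp.comp
        ((measurable_stepLogDensity r g l).comp
          (by fun_prop : Measurable fun z : (ℕ → ℝ × X) × (ℝ × X) => (z.1 n, z.2))))
    have hZ : Measurable fun ω => ENNReal.ofReal (Real.exp (chainLogDensity r g l n ω)) :=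
      ENNReal.measurable_ofReal.comp
        (Real.measurable_exp.comp (measurable_chainLogDensity r g l n))
    have hmono : Measurable fun z : (ℕ → ℝ × X) × (ℝ × X) =>
        f' z.1 z.2 * ENNReal.ofReal (Real.exp (stepLogDensity r g l (z.1 n) z.2)) := hmf'.mul hρ
    have hstep : ∀ ω : ℕ → ℝ × X, ∫⁻ q, f' ω q ∂(stepKernel (perturbedRate r g l) (ω n))
        = ∫⁻ q, f' ω q * ENNReal.ofReal (Real.exp (stepLogDensity r g l (ω n) q))
          ∂(stepKernel (unperturbedRate r) (ω n)) := fun ω =>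
      lintegral_stepKernel_perturbed r g l (ω n) (hmf'.comp measurable_prodMk_left)
    have hinner : Measurable fun ω : ℕ → ℝ × X =>
        ∫⁻ q, f' ω q * ENNReal.ofReal (Real.exp (stepLogDensity r g l (ω n) q))
          ∂(stepKernel (unperturbedRate r) (ω n)) :=
      hmono.lintegral_kernel_prod_right'
        (κ := (stepKernel (unperturbedRate r)).comap (fun ω : ℕ → ℝ × X => ω n) (by fun_prop))
    calc ∫⁻ ω, f ω ∂(perturbedLaw r g l ν)
        = ∫⁻ ω, f' ω (ω (n + 1)) ∂(perturbedLaw r g l ν) := by simp_rw [← hff']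
      _ = ∫⁻ ω, ∫⁻ q, f' ω q * ENNReal.ofReal (Real.exp (stepLogDensity r g l (ω n) q))
          ∂(stepKernel (unperturbedRate r) (ω n)) ∂(perturbedLaw r g l ν) := by
        rw [perturbedLaw, lintegral_pathLaw_succ _ ν n hmf' hdep']
        simp_rw [hstep]
      _ = ∫⁻ ω, (∫⁻ q, f' ω q * ENNReal.ofReal (Real.exp (stepLogDensity r g l (ω n) q))
          ∂(stepKernel (unperturbedRate r) (ω n)))
            * ENNReal.ofReal (Real.exp (chainLogDensity r g l n ω)) ∂(unperturbedLaw r ν) := by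
        refine ih hinner fun ω ω' h => ?_
        have e : ∀ q, f' ω q = f' ω' q := fun q => hdep' q h
        simp only [e, h n (mem_Iic.2 le_rfl)]
      _ = ∫⁻ ω, ∫⁻ q, f' ω q * ENNReal.ofReal (Real.exp (stepLogDensity r g l (ω n) q))
            * ENNReal.ofReal (Real.exp (chainLogDensity r g l n ω))
          ∂(stepKernel (unperturbedRate r) (ω n)) ∂(unperturbedLaw r ν) :=
        lintegral_congr fun ω => (lintegral_mul_const' _ _ ENNReal.ofReal_ne_top).symm
      _ = ∫⁻ ω, f' ω (ω (n + 1))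
            * ENNReal.ofReal (Real.exp (stepLogDensity r g l (ω n) (ω (n + 1))))
            * ENNReal.ofReal (Real.exp (chainLogDensity r g l n ω)) ∂(unperturbedLaw r ν) := by
        rw [unperturbedLaw]
        refine (lintegral_pathLaw_succ (unperturbedRate r) ν n
          (f := fun ω q => f' ω q * ENNReal.ofReal (Real.exp (stepLogDensity r g l (ω n) q))
            * ENNReal.ofReal (Real.exp (chainLogDensity r g l n ω)))
          (hmono.mul (hZ.comp measurable_fst)) fun q ω ω' h => ?_).symm
        have e : f' ω q = f' ω' q := hdep' q h
        simp only [e, h n (mem_Iic.2 le_rfl), dependsOn_chainLogDensity r g l n h]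
      _ = _ := by
        refine lintegral_congr fun ω => ?_
        rw [← hff', mul_assoc, ← ENNReal.ofReal_mul (Real.exp_pos _).le, ← Real.exp_add,
          chainLogDensity, chainLogDensity, Finset.sum_range_succ, add_comm]

/-- Only finitely many steps are compared, so the mass is exactly one even if the perturbed process
explodes. This makes it available for the proof of non-explosion. -/
lemma lintegral_exp_chainLogDensity (n : ℕ) :
    ∫⁻ ω, ENNReal.ofReal (Real.exp (chainLogDensity r g l n ω)) ∂(unperturbedLaw r ν) = 1 := by
  have h := lintegral_perturbedLaw_chain r g l ν n (f := fun _ => 1) measurable_const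
    (fun _ _ _ => rfl)
  simp only [one_mul] at h
  rw [← h, lintegral_one, perturbedLaw, measure_univ]

/-- Change of measure up to time `t`, on the paths with `n` jumps. -/
lemma setLIntegral_perturbedLaw {t : ℝ} {F : (ℕ → ℝ × X) → ℝ≥0∞} (hF : Measurable F)
    (hloc : IsLocal t F) (n : ℕ) :
    ∫⁻ ω in jumpCountSet t n, F ω ∂(perturbedLaw r g l ν)
      = ∫⁻ ω in jumpCountSet t n, F ω * ENNReal.ofReal (Real.exp (pathLogDensity r g l t ω))
        ∂(unperturbedLaw r ν) := by
  set A : Set (ℕ → ℝ × X) := {ω | (ω n).1 ≤ t} with hA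
  have hmA : MeasurableSet A := measurableSet_le (by fun_prop) measurable_const
  have hmB : MeasurableSet {q : ℝ × X | t < q.1} := measurableSet_lt measurable_const measurable_fst
  -- On regular paths `φ` agrees with `F` on `jumpCountSet t n`, and it is determined by the entries
  -- up to `n`.
  set φ : (ℕ → ℝ × X) → ℝ≥0∞ := A.indicator fun ω => F (freeze n t ω) with hφ
  have hmφ : Measurable φ := (hF.comp (measurable_freeze_left n t)).indicator hmA
  have hdφ : DependsOn φ (Iic n) := fun ω ω' h => by
    have h1 : ω ∈ A ↔ ω' ∈ A := by simp only [hA, mem_ofPred_eq, h n (mem_Iic.2 le_rfl)]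
    simp only [hφ, indicator, h1, dependsOn_freeze F n t h]
  -- Integrating out entry `n + 1` turns the event that jump `n + 1` comes after `t` into the
  -- survival probability from the `n`-th jump to `t`.
  have hmul : ∀ (ψ : (ℕ → ℝ × X) → ℝ≥0∞), Measurable ψ → DependsOn ψ (Iic n) →
      ∀ (R : Kernel (ℝ × X) X) [IsRateKernel R] [IsSFiniteKernel R],
      ∫⁻ ω, φ ω * ψ ω * {q : ℝ × X | t < q.1}.indicator 1 (ω (n + 1)) ∂(pathLaw R ν)
        = ∫⁻ ω, φ ω * ψ ω * ENNReal.ofReal (Real.exp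
          (-∫ w in (ω n).1..t, totalRate R w (ω n).2)) ∂(pathLaw R ν) := by
    intro ψ hψ hdψ R _ _
    rw [lintegral_pathLaw_succ R ν n
      (f := fun ω q => φ ω * ψ ω * {q : ℝ × X | t < q.1}.indicator 1 q)]
    · refine lintegral_congr fun ω => ?_
      rw [lintegral_const_mul _ (measurable_one.indicator hmB), lintegral_indicator_one hmB]
      by_cases hω : ω ∈ A
      · rw [stepKernel_tail R (s := (ω n).1) hω]
      · simp [hφ, hω]
    · exact ((hmφ.mul hψ).comp measurable_fst).mul
        ((measurable_one.indicator hmB).comp measurable_snd)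
    · intro q ω ω' h
      simp only [hdφ h, hdψ h]
  have hset : ∀ (R : Kernel (ℝ × X) X) [IsRateKernel R] [IsSFiniteKernel R]
      (ψ : (ℕ → ℝ × X) → ℝ≥0∞),
      ∫⁻ ω in jumpCountSet t n, F ω * ψ ω ∂(pathLaw R ν)
        = ∫⁻ ω, φ ω * ψ ω * {q : ℝ × X | t < q.1}.indicator 1 (ω (n + 1)) ∂(pathLaw R ν) := by
    intro R _ _ ψ
    rw [← lintegral_indicator (measurableSet_jumpCountSet t n)]
    refine lintegral_congr_ae ?_
    filter_upwards [ae_isRegular R ν] with ω hω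
    by_cases h1 : (ω n).1 ≤ t
    · by_cases h2 : t < (ω (n + 1)).1
      · have h3 : ω ∈ jumpCountSet t n := ⟨h1, h2⟩
        rw [indicator_of_mem h3, hφ, indicator_of_mem (show ω ∈ A from h1),
          indicator_of_mem (show ω (n + 1) ∈ {q : ℝ × X | t < q.1} from h2),
          hloc.freeze_eq hω h3, Pi.one_apply, mul_one]
      · rw [indicator_of_notMem (show ω ∉ jumpCountSet t n from fun h => h2 h.2),
          indicator_of_notMem (show ω (n + 1) ∉ {q : ℝ × X | t < q.1} from h2), mul_zero]
    · rw [indicator_of_notMem (show ω ∉ jumpCountSet t n from fun h => h1 h.1), hφ,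
        indicator_of_notMem (show ω ∉ A from h1), zero_mul, zero_mul]
  have hmD : Measurable fun ω : ℕ → ℝ × X => ∫ u in (ω n).1..t, contraction r (tilt g l) u (ω n).2 :=
    measurable_intervalIntegral_param
      (f := fun (ω : ℕ → ℝ × X) u => contraction r (tilt g l) u (ω n).2)
      ((measurable_contraction r (measurable_tilt g l)).comp
        (by fun_prop : Measurable fun z : (ℕ → ℝ × X) × ℝ => (z.2, (z.1 n).2)))
      (by fun_prop) measurable_const
  -- The Girsanov exponent on paths with `n` jumps, expressed through the entries up to `n`: the
  -- chain density supplies the completed steps, and the difference of the total rates supplies the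
  -- survival factor.
  set Λ : (ℕ → ℝ × X) → ℝ := fun ω =>
    chainLogDensity r g l n ω - ∫ u in (ω n).1..t, contraction r (tilt g l) u (ω n).2 with hΛ
  have hmΛ : Measurable fun ω => ENNReal.ofReal (Real.exp (Λ ω)) :=
    ENNReal.measurable_ofReal.comp (Real.measurable_exp.comp
      ((measurable_chainLogDensity r g l n).sub hmD))
  have hdΛ : DependsOn (fun ω => ENNReal.ofReal (Real.exp (Λ ω))) (Iic n) := fun ω ω' h => by
    simp only [hΛ, dependsOn_chainLogDensity r g l n h, h n (mem_Iic.2 le_rfl)]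
  have hmtail : Measurable fun ω : ℕ → ℝ × X => φ ω * ENNReal.ofReal (Real.exp
      (-∫ w in (ω n).1..t, totalRate (perturbedRate r g l) w (ω n).2)) := by
    refine hmφ.mul (ENNReal.measurable_ofReal.comp (Real.measurable_exp.comp ?_))
    exact (measurable_intervalIntegral_param
      (f := fun (ω : ℕ → ℝ × X) u => totalRate (perturbedRate r g l) u (ω n).2)
      ((measurable_totalRate _).comp
        (by fun_prop : Measurable fun z : (ℕ → ℝ × X) × ℝ => (z.2, (z.1 n).2)))
      (by fun_prop) measurable_const).neg
  calc ∫⁻ ω in jumpCountSet t n, F ω ∂(perturbedLaw r g l ν)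
      = ∫⁻ ω, φ ω * {q : ℝ × X | t < q.1}.indicator 1 (ω (n + 1)) ∂(perturbedLaw r g l ν) := by
        have h := hset (perturbedRate r g l) fun _ => 1
        simp only [mul_one] at h
        exact h
    _ = ∫⁻ ω, φ ω * ENNReal.ofReal (Real.exp
          (-∫ w in (ω n).1..t, totalRate (perturbedRate r g l) w (ω n).2))
          ∂(perturbedLaw r g l ν) := by
        have h := hmul (fun _ => 1) measurable_const (fun _ _ _ => rfl) (perturbedRate r g l)
        simp only [mul_one] at h
        exact h
    _ = ∫⁻ ω, φ ω * ENNReal.ofReal (Real.exp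
          (-∫ w in (ω n).1..t, totalRate (perturbedRate r g l) w (ω n).2))
          * ENNReal.ofReal (Real.exp (chainLogDensity r g l n ω)) ∂(unperturbedLaw r ν) := by
        refine lintegral_perturbedLaw_chain r g l ν n hmtail fun ω ω' h => ?_
        simp only [hdφ h, h n (mem_Iic.2 le_rfl)]
    _ = ∫⁻ ω, φ ω * ENNReal.ofReal (Real.exp (Λ ω)) * ENNReal.ofReal (Real.exp
          (-∫ w in (ω n).1..t, totalRate (unperturbedRate r) w (ω n).2))
          ∂(unperturbedLaw r ν) := by
        refine lintegral_congr fun ω => ?_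
        rw [mul_assoc, mul_assoc, ← ENNReal.ofReal_mul (Real.exp_pos _).le,
          ← ENNReal.ofReal_mul (Real.exp_pos _).le, ← Real.exp_add, ← Real.exp_add]
        have e1 : ∫ w in (ω n).1..t, totalRate (perturbedRate r g l) w (ω n).2
            = (∫ w in (ω n).1..t, totalRate (unperturbedRate r) w (ω n).2)
              + ∫ w in (ω n).1..t, contraction r (tilt g l) w (ω n).2 := by
          rw [← intervalIntegral.integral_add (intervalIntegrable_totalRate _ _ _ _)
            (intervalIntegrable_contraction_tilt r g l _ _ _)]
          exact intervalIntegral.integral_congr fun w _ => totalRate_perturbedRate r g l w _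
        rw [e1, hΛ]
        congr 3; ring
    _ = ∫⁻ ω, φ ω * ENNReal.ofReal (Real.exp (Λ ω))
          * {q : ℝ × X | t < q.1}.indicator 1 (ω (n + 1)) ∂(unperturbedLaw r ν) :=
        (hmul _ hmΛ hdΛ (unperturbedRate r)).symm
    _ = ∫⁻ ω in jumpCountSet t n, F ω * ENNReal.ofReal (Real.exp (Λ ω)) ∂(unperturbedLaw r ν) :=
        (hset (unperturbedRate r) _).symm
    _ = _ := by
        refine setLIntegral_congr_fun_ae (measurableSet_jumpCountSet t n) ?_
        filter_upwards [ae_isRegular (unperturbedRate r) ν] with ω hω hn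
        rw [hω.pathLogDensity_eq r g l hn]

end Girsanov

/-! ### Paths with finitely many jumps up to `t`, and monotonicity of jump sums. -/

section GoodPaths

variable {X : Type*}

lemma IsRegular.exists_mem_of_lt_explosionTime {ω : ℕ → ℝ × X} (hω : IsRegular ω) {s : ℝ}
    (hs : 0 ≤ s) (h : ENNReal.ofReal s < explosionTime ω) : ∃ n, ω ∈ jumpCountSet s n := by
  obtain ⟨n, hn⟩ := lt_iSup_iff.1 h
  have h1 : s < (ω (n + 1)).1 :=
    (lt_of_not_ge fun h => hn.not_ge (ENNReal.ofReal_le_ofReal h)).trans_le (hω.2 (Nat.le_succ n))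
  obtain ⟨m, -, hm⟩ := hω.exists_mem_jumpCountSet hs h1
  exact ⟨m, hm⟩

lemma lt_explosionTime_of_mem {ω : ℕ → ℝ × X} {t : ℝ} (ht : 0 ≤ t) {n : ℕ}
    (h : ω ∈ jumpCountSet t n) : ENNReal.ofReal t < explosionTime ω :=
  ((ENNReal.ofReal_lt_ofReal_iff_of_nonneg ht).2 h.2).trans_le
    (le_iSup (fun n => ENNReal.ofReal (ω n).1) (n + 1))

/-- Regular paths which do not explode up to time `t`. -/
def IsGood (t : ℝ) (ω : ℕ → ℝ × X) : Prop := IsRegular ω ∧ ∃ n, ω ∈ jumpCountSet t n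

lemma IsGood.mono {s t : ℝ} {ω : ℕ → ℝ × X} (h : IsGood t ω) (hs : 0 ≤ s) (hst : s ≤ t) :
    IsGood s ω := by
  obtain ⟨hω, n, hn⟩ := h
  obtain ⟨m, -, hm⟩ := hω.exists_mem_jumpCountSet hs (hst.trans_lt hn.2)
  exact ⟨hω, m, hm⟩

lemma abs_onState_le {f g : X → ℝ} (h : ∀ x, |f x| ≤ g x) (o : Option X) :
    |onState f o| ≤ onState g o := by
  cases o with
  | none => simp [onState]
  | some x => exact h x

lemma onState_nonneg {f : X → ℝ} (h : ∀ x, 0 ≤ f x) (o : Option X) : 0 ≤ onState f o := by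
  cases o with
  | none => simp [onState]
  | some x => exact h x

lemma jumpSum_nonneg {a : ℝ → X → X → ℝ} (ha : ∀ s x y, 0 ≤ a s x y) (ω : ℕ → ℝ × X) (t : ℝ) :
    0 ≤ jumpSum a ω t :=
  tsum_nonneg fun n => by split_ifs; exacts [ha _ _ _, le_rfl]

lemma IsGood.jumpSum_mono {a : ℝ → X → X → ℝ} (ha : ∀ s x y, 0 ≤ a s x y) {ω : ℕ → ℝ × X}
    {s t : ℝ} (hs : 0 ≤ s) (hst : s ≤ t) (hω : IsGood t ω) : jumpSum a ω s ≤ jumpSum a ω t := by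
  obtain ⟨-, m, hm⟩ := hω.mono hs hst
  obtain ⟨hω, n, hn⟩ := hω
  rw [hω.jumpSum_eq a hm, hω.jumpSum_eq a hn]
  exact Finset.sum_le_sum_of_subset_of_nonneg
    (Finset.range_mono (hω.le_of_mem_jumpCountSet hst hm hn)) fun _ _ _ => ha _ _ _

lemma IsGood.abs_jumpSum_le {a b : ℝ → X → X → ℝ} (hab : ∀ s x y, |a s x y| ≤ b s x y)
    {ω : ℕ → ℝ × X} {t : ℝ} (hω : IsGood t ω) : |jumpSum a ω t| ≤ jumpSum b ω t := by
  obtain ⟨hω, n, hn⟩ := hω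
  rw [hω.jumpSum_eq a hn, hω.jumpSum_eq b hn]
  exact (Finset.abs_sum_le_sum_abs _ _).trans (Finset.sum_le_sum fun _ _ => hab _ _ _)

lemma IsGood.abs_jumpSum_le_jumpSum {a b : ℝ → X → X → ℝ} (hab : ∀ s x y, |a s x y| ≤ b s x y)
    {ω : ℕ → ℝ × X} {s t : ℝ} (hs : 0 ≤ s) (hst : s ≤ t) (hω : IsGood t ω) :
    |jumpSum a ω s| ≤ jumpSum b ω t :=
  ((hω.mono hs hst).abs_jumpSum_le hab).trans
    (hω.jumpSum_mono (fun s x y => (abs_nonneg _).trans (hab s x y)) hs hst)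

/-- Plays the part of the Cauchy–Schwarz inequality: half a sum of exponents has a finite
exponential moment when each of the two exponents has one. -/
lemma exp_half_add_le (a b : ℝ) : Real.exp ((a + b) / 2) ≤ Real.exp a + Real.exp b := by
  rcases le_total a b with h | h
  · linarith [Real.exp_le_exp.2 (by linarith : (a + b) / 2 ≤ b), Real.exp_pos a]
  · linarith [Real.exp_le_exp.2 (by linarith : (a + b) / 2 ≤ a), Real.exp_pos b]

lemma measurable_ofReal_exp {Y : Type*} [MeasurableSpace Y] {f : Y → ℝ} (hf : Measurable f) :
    Measurable fun y => ENNReal.ofReal (Real.exp (f y)) :=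
  ENNReal.measurable_ofReal.comp (Real.measurable_exp.comp hf)

end GoodPaths

/-! ### Non-explosion of the perturbed process and exponential moments of the activity. -/

section NonExplosion

variable {X : Type*} [MeasurableSpace X]

section Tsum

variable (R : Kernel (ℝ × X) X) [IsRateKernel R] [IsSFiniteKernel R] (ν : Measure X)
  [IsProbabilityMeasure ν]

/-- The sets `jumpCountSet t n` can overlap only off the regular paths, hence on a null set. -/
lemma tsum_setLIntegral_jumpCountSet (t : ℝ) (f : (ℕ → ℝ × X) → ℝ≥0∞) :
    ∑' n, ∫⁻ ω in jumpCountSet t n, f ω ∂(pathLaw R ν)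
      = ∫⁻ ω in ⋃ n, jumpCountSet t n, f ω ∂(pathLaw R ν) := by
  refine (lintegral_iUnion₀ (fun n => (measurableSet_jumpCountSet t n).nullMeasurableSet)
    (fun m n hmn => ?_) f).symm
  refine measure_mono_null (t := {ω | ¬ IsRegular ω}) (fun ω hω hreg => ?_) (ae_isRegular R ν)
  exact hmn (IsRegular.eq_of_mem_jumpCountSet hreg hω.1 hω.2)

lemma lintegral_eq_tsum_jumpCountSet {t : ℝ} (h : ∀ᵐ ω ∂(pathLaw R ν), IsGood t ω)
    (f : (ℕ → ℝ × X) → ℝ≥0∞) :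
    ∫⁻ ω, f ω ∂(pathLaw R ν) = ∑' n, ∫⁻ ω in jumpCountSet t n, f ω ∂(pathLaw R ν) := by
  rw [tsum_setLIntegral_jumpCountSet, ← setLIntegral_univ]
  refine setLIntegral_congr ?_
  filter_upwards [h] with ω hω
  refine propext ⟨fun _ => mem_iUnion.2 hω.2, fun _ => mem_univ ω⟩

end Tsum

lemma IsGood.intervalIntegrable_contraction {t : ℝ} {ω : ℕ → ℝ × X} (hω : IsGood t ω)
    (r : TransitionKernel X) {a : ℝ → X → X → ℝ}
    (ha : Measurable (fun p : ℝ × X × X => a p.1 p.2.1 p.2.2)) {C : ℝ}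
    (hC : ∀ s x y, |a s x y| ≤ C) :
    IntervalIntegrable (fun w => onState (contraction r a w) (stateAt ω w)) volume 0 t := by
  obtain ⟨hω, n, hn⟩ := hω
  exact (hω.integral_onState (f := contraction r a)
    (fun x a b => MarkovJump.intervalIntegrable_contraction r ha hC x a b) n hn.1 hn.2.le).1

lemma IsGood.abs_integral_contraction_le {t : ℝ} {ω : ℕ → ℝ × X} (hω : IsGood t ω)
    (r : TransitionKernel X) {a b : ℝ → X → X → ℝ}
    (hb : Measurable (fun p : ℝ × X × X => b p.1 p.2.1 p.2.2)) {C : ℝ}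
    (hC : ∀ s x y, |b s x y| ≤ C) (hab : ∀ s x y, |a s x y| ≤ b s x y) {u : ℝ} (hu : 0 ≤ u)
    (hut : u ≤ t) :
    |∫ w in (0 : ℝ)..u, onState (contraction r a w) (stateAt ω w)|
      ≤ ∫ w in (0 : ℝ)..t, onState (contraction r b w) (stateAt ω w) := by
  have hint := hω.intervalIntegrable_contraction r hb hC
  have hle : ∀ w, |onState (contraction r a w) (stateAt ω w)|
      ≤ onState (contraction r b w) (stateAt ω w) := fun w =>
    abs_onState_le (fun x => abs_contraction_le r (integrable_of_bounded r hb hC w x)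
      (hab w x)) _
  have hnn : ∀ w, 0 ≤ onState (contraction r b w) (stateAt ω w) := fun w =>
    (abs_nonneg _).trans (hle w)
  refine (intervalIntegral.norm_integral_le_of_norm_le
    (f := fun w => onState (contraction r a w) (stateAt ω w)) hu
    (ae_of_all _ fun w _ => hle w) (hint.mono_set ?_)).trans ?_
  · rw [uIcc_of_le hu, uIcc_of_le (hu.trans hut)]; exact Icc_subset_Icc_right hut
  · exact intervalIntegral.integral_mono_interval le_rfl hu hut (ae_of_all _ hnn) hint

/-- The perturbation `|g|`. -/
def Perturbation.abs (g : Perturbation X) : Perturbation X where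
  toFun s x y := |g.toFun s x y|
  measurable := g.measurable.abs
  bounded := let ⟨M, hM⟩ := g.bounded; ⟨M, fun s x y => by rw [abs_abs]; exact hM s x y⟩

/-- The integral `∫_0^t |g|_r(s, X_s) ds` along a path, as a real number. -/
def compensator (r : TransitionKernel X) (g : Perturbation X) (t : ℝ) (ω : ℕ → ℝ × X) : ℝ :=
  ∫ w in (0 : ℝ)..t, onState (contraction r g.abs.toFun w) (stateAt ω w)

/-- The jump sum of `|g|` plus its compensator. -/
def activity (r : TransitionKernel X) (g : Perturbation X) (t : ℝ) (ω : ℕ → ℝ × X) : ℝ :=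
  jumpSum g.abs.toFun ω t + compensator r g t ω

lemma measurable_compensator (r : TransitionKernel X) (g : Perturbation X) (t : ℝ) :
    Measurable (compensator r g t) :=
  (measurable_integral_onState (measurable_contraction r g.abs.measurable)).comp
    measurable_prodMk_right

lemma measurable_activity (r : TransitionKernel X) (g : Perturbation X) (t : ℝ) :
    Measurable (activity r g t) :=
  ((measurable_jumpSum g.abs.measurable).comp measurable_prodMk_right).add
    (measurable_compensator r g t)

lemma compensator_nonneg (r : TransitionKernel X) (g : Perturbation X) {t : ℝ} (ht : 0 ≤ t)
    (ω : ℕ → ℝ × X) : 0 ≤ compensator r g t ω :=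
  intervalIntegral.integral_nonneg ht fun _ _ =>
    onState_nonneg (fun _ => integral_nonneg fun _ => abs_nonneg _) _

variable (r : TransitionKernel X) (g : Perturbation X) {M : ℝ}

lemma IsGood.abs_integral_tilt_le (hM : ∀ s x y, |g.toFun s x y| ≤ M) {t : ℝ} {ω : ℕ → ℝ × X}
    (hω : IsGood t ω) (l : ℝ) {u : ℝ} (hu : 0 ≤ u) (hut : u ≤ t) :
    |∫ w in (0 : ℝ)..u, onState (contraction r (tilt g l) w) (stateAt ω w)|
      ≤ |l| * Real.exp (|l| * M) * compensator r g t ω := by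
  have h := hω.abs_integral_contraction_le r
    (b := fun s x y => |l| * Real.exp (|l| * M) * |g.toFun s x y|)
    (C := |l| * Real.exp (|l| * M) * M)
    (g.abs.measurable.const_mul _) (fun s x y => ?_) (abs_tilt_le hM l) hu hut
  · refine h.trans_eq ?_
    rw [compensator, ← intervalIntegral.integral_const_mul]
    refine intervalIntegral.integral_congr fun w _ => ?_
    cases stateAt ω w with
    | none => simp [onState]
    | some x => exact integral_const_mul _ _
  · rw [abs_mul, abs_of_nonneg (by positivity : 0 ≤ |l| * Real.exp (|l| * M)), abs_abs]
    gcongr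
    exact hM s x y

variable (ν : Measure X)

lemma ae_isGood [IsProbabilityMeasure ν] (hne : ∀ᵐ ω ∂(unperturbedLaw r ν), explosionTime ω = ∞) {t : ℝ} (ht : 0 ≤ t) :
    ∀ᵐ ω ∂(unperturbedLaw r ν), IsGood t ω := by
  filter_upwards [hne, ae_isRegular (unperturbedRate r) ν] with ω h1 h2
  exact ⟨h2, h2.exists_mem_of_lt_explosionTime ht (by rw [h1]; exact ENNReal.ofReal_lt_top)⟩

/-- Passes from extended to real values: `|g|_r` is finite at each state because `g` is bounded, and
a good path makes only finitely many sojourns up to `t`, so the time integral is finite. -/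
lemma exists_exp_compensator {t : ℝ} (ht : 0 ≤ t)
    (hgood : ∀ᵐ ω ∂(unperturbedLaw r ν), IsGood t ω) (hC : ExpMomentCondition r ν t g.toFun) :
    ∃ θ : ℝ, 0 < θ ∧ ∫⁻ ω, ENNReal.ofReal (Real.exp (θ * compensator r g t ω))
      ∂(unperturbedLaw r ν) < ∞ := by
  obtain ⟨θ, hθ, hlt⟩ := hC
  refine ⟨θ, hθ, lt_of_le_of_lt (lintegral_mono_ae ?_) hlt⟩
  obtain ⟨M, hM⟩ := g.abs.bounded
  filter_upwards [hgood] with ω hω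
  have hint := hω.intervalIntegrable_contraction r g.abs.measurable hM
  have e1 : ∀ s, onState (absContraction r g.toFun s) (stateAt ω s)
      = ENNReal.ofReal (onState (contraction r g.abs.toFun s) (stateAt ω s)) := by
    intro s
    cases stateAt ω s with
    | none => simp [onState]
    | some x =>
      change absContraction r g.toFun s x = ENNReal.ofReal (contraction r g.abs.toFun s x)
      rw [absContraction, contraction, ofReal_integral_eq_lintegral_ofReal
        (integrable_of_bounded r g.abs.measurable hM s x) (ae_of_all _ fun y => abs_nonneg _)]
      exact lintegral_congr fun y => by rw [← ofReal_norm]; rfl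
  have e2 : ∫⁻ s in Ioc (0 : ℝ) t, onState (absContraction r g.toFun s) (stateAt ω s)
      = ENNReal.ofReal (compensator r g t ω) := by
    simp_rw [e1]
    rw [compensator, intervalIntegral.integral_of_le ht,
      ofReal_integral_eq_lintegral_ofReal ((intervalIntegrable_iff_integrableOn_Ioc_of_le ht).1 hint)
        (ae_of_all _ fun s =>
          onState_nonneg (fun x => integral_nonneg fun y => abs_nonneg _) _)]
  rw [e2, ← ENNReal.ofReal_mul hθ.le, EReal.coe_ennreal_ofReal,
    max_eq_left (mul_nonneg hθ.le (compensator_nonneg r g ht ω)), EReal.exp_coe]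

variable [IsProbabilityMeasure ν]

/-- For small `l`, the perturbed process does not explode. -/
lemma ae_isGood_perturbedLaw (hM : ∀ s x y, |g.toFun s x y| ≤ M)
    (hne : ∀ᵐ ω ∂(unperturbedLaw r ν), explosionTime ω = ∞) {t : ℝ} (ht : 0 ≤ t) {θ : ℝ}
    (hθ : ∫⁻ ω, ENNReal.ofReal (Real.exp (θ * compensator r g t ω)) ∂(unperturbedLaw r ν) < ∞)
    {l : ℝ} (hl : 8 * |l| * Real.exp (4 * |l| * M) ≤ θ) :
    ∀ᵐ ω ∂(perturbedLaw r g l ν), IsGood t ω := by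
  have hgood := ae_isGood r ν hne ht
  -- On regular paths the intersection of the `B n` is the event of infinitely many jumps up to time
  -- `t`.
  set B : ℕ → Set (ℕ → ℝ × X) := fun n => {ω | ∀ k ≤ n, (ω k).1 ≤ t} with hB
  have hmB : ∀ n, MeasurableSet (B n) := fun n => by
    simp only [hB, Set.ofPred_forall]
    exact MeasurableSet.iInter fun k => MeasurableSet.iInter fun _ =>
      measurableSet_le (measurable_pi_apply k).fst measurable_const
  have hanti : Antitone B := fun m n hmn ω hω k hk => hω k (hk.trans hmn)
  have hdB : ∀ n, DependsOn ((B n).indicator (1 : (ℕ → ℝ × X) → ℝ≥0∞)) (Iic n) :=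
    fun n ω ω' h => by
      have : ω ∈ B n ↔ ω' ∈ B n := forall₂_congr fun k hk => by rw [h k (mem_Iic.2 hk)]
      simp only [indicator, this, Pi.one_apply]
  have hM0 : 0 ≤ M ∨ IsEmpty X := by
    rcases isEmpty_or_nonempty X with h | ⟨⟨x⟩⟩
    · exact Or.inr h
    · exact Or.inl ((abs_nonneg _).trans (hM 0 x x))
  -- A bound for the second moments of the densities on `B n`, uniform in `n`; the `1` is the mass
  -- of the density with parameter `4 * l`.
  set C : ℝ≥0∞ := 1 + ∫⁻ ω, ENNReal.ofReal (Real.exp (θ * compensator r g t ω))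
    ∂(unperturbedLaw r ν) with hCdef
  have hC : C ≠ ∞ := ENNReal.add_ne_top.2 ⟨ENNReal.one_ne_top, hθ.ne⟩
  -- Twice the exponent at `l` and half the exponent at `4 * l` have the same jump sum. They differ
  -- by `(∫ tilt (4l) - 4 ∫ tilt l) / 2`, where the bracket is at most `8 |l| exp (4 |l| M)` times
  -- the compensator; this is where the hypothesis `hl` comes from.
  have hpt : ∀ n, ∀ ω ∈ B n, IsGood t ω →
      Real.exp (2 * chainLogDensity r g l n ω)
        ≤ Real.exp (chainLogDensity r g (4 * l) n ω) + Real.exp (θ * compensator r g t ω) := by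
    intro n ω hωB hω
    have hM' : 0 ≤ M := hM0.resolve_right fun h => h.elim (ω 0).2
    refine le_trans (Real.exp_le_exp.2 ?_) (exp_half_add_le _ _)
    rw [hω.1.chainLogDensity_eq, hω.1.chainLogDensity_eq]
    have b1 := abs_le.1 (hω.abs_integral_tilt_le r g hM l (hω.1.nonneg n) (hωB n le_rfl))
    have b2 := abs_le.1 (hω.abs_integral_tilt_le r g hM (4 * l) (hω.1.nonneg n) (hωB n le_rfl))
    have hI := compensator_nonneg r g ht ω
    have e4 : |4 * l| = 4 * |l| := by rw [abs_mul]; norm_num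
    rw [e4] at b2
    have h3 : Real.exp (|l| * M) ≤ Real.exp (4 * |l| * M) :=
      Real.exp_le_exp.2 (by nlinarith [mul_nonneg (abs_nonneg l) hM'])
    have h4 : |l| * Real.exp (|l| * M) * compensator r g t ω
        ≤ |l| * Real.exp (4 * |l| * M) * compensator r g t ω := by gcongr
    have h5 := mul_le_mul_of_nonneg_right hl hI
    linarith [b1.1, b1.2, b2.1, b2.2]
  -- Truncation of the density `e` at level `K`, in the form `e ≤ K + e² / K`.
  have hbound : ∀ (n K : ℕ), 0 < K → (perturbedLaw r g l ν) (B n)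
      ≤ K * (unperturbedLaw r ν) (B n) + C * (K : ℝ≥0∞)⁻¹ := by
    intro n K hK
    have hKr : (0 : ℝ) < K := Nat.cast_pos.2 hK
    have h1 := lintegral_perturbedLaw_chain r g l ν n (measurable_one.indicator (hmB n)) (hdB n)
    rw [lintegral_indicator_one (hmB n)] at h1
    rw [h1, ← lintegral_exp_chainLogDensity r g (4 * l) ν n] at *
    rw [hCdef, ← lintegral_indicator_one (hmB n), ← lintegral_const_mul' _ _ (by finiteness),
      ← lintegral_add_left (measurable_ofReal_exp (measurable_chainLogDensity r g (4 * l) n)),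
      ← lintegral_mul_const' _ _ (ENNReal.inv_ne_top.2 (by exact_mod_cast hK.ne')),
      ← lintegral_add_left ((measurable_one.indicator (hmB n)).const_mul _)]
    refine lintegral_mono_ae ?_
    filter_upwards [hgood] with ω hω
    by_cases hωB : ω ∈ B n
    · simp only [indicator_of_mem hωB, Pi.one_apply, one_mul, mul_one]
      rw [← ENNReal.ofReal_natCast, ← ENNReal.ofReal_inv_of_pos hKr,
        ← ENNReal.ofReal_add (Real.exp_pos _).le (Real.exp_pos _).le,
        ← ENNReal.ofReal_mul (by positivity), ← ENNReal.ofReal_add hKr.le (by positivity)]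
      refine ENNReal.ofReal_le_ofReal (le_trans ?_
        (add_le_add_right (mul_le_mul_of_nonneg_right (hpt n ω hωB hω) (by positivity)) _))
      set e := Real.exp (chainLogDensity r g l n ω) with he
      have he2 : Real.exp (2 * chainLogDensity r g l n ω) = e * e := by
        rw [two_mul, Real.exp_add]
      rw [he2, ← div_eq_mul_inv, ← sub_nonneg]
      have : (K : ℝ) + e * e / K - e = ((K - e / 2) ^ 2 + 3 / 4 * e ^ 2) / K := by
        field_simp; ring
      rw [this]; positivity
    · simp only [indicator_of_notMem hωB, zero_mul]; exact zero_le
  have hlim : Tendsto (fun n => (unperturbedLaw r ν) (B n)) atTop (𝓝 0) := by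
    have hz : (unperturbedLaw r ν) (⋂ n, B n) = 0 := by
      refine measure_mono_null (t := {ω | ¬ IsGood t ω}) (fun ω hω h => ?_) hgood
      obtain ⟨-, n, hn⟩ := h
      exact absurd (mem_iInter.1 hω (n + 1) (n + 1) le_rfl) (not_le.2 hn.2)
    rw [← hz]
    exact tendsto_measure_iInter_atTop (fun n => (hmB n).nullMeasurableSet) hanti
      ⟨0, by rw [unperturbedLaw]; exact measure_ne_top _ _⟩
  -- First `n → ∞` with `K` fixed, then `K → ∞`.
  have hq : ∀ K : ℕ, 0 < K → (perturbedLaw r g l ν) (⋂ n, B n) ≤ C * (K : ℝ≥0∞)⁻¹ := by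
    intro K hK
    have h1 : Tendsto (fun n => (K : ℝ≥0∞) * (unperturbedLaw r ν) (B n) + C * (K : ℝ≥0∞)⁻¹) atTop
        (𝓝 (K * 0 + C * (K : ℝ≥0∞)⁻¹)) :=
      (ENNReal.Tendsto.const_mul hlim (Or.inr (by finiteness))).add tendsto_const_nhds
    rw [mul_zero, zero_add] at h1
    exact ge_of_tendsto' h1 fun n => (measure_mono (iInter_subset _ n)).trans (hbound n K hK)
  have hzero : (perturbedLaw r g l ν) (⋂ n, B n) = 0 := by
    have h1 : Tendsto (fun K : ℕ => C * (K : ℝ≥0∞)⁻¹) atTop (𝓝 (C * 0)) :=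
      ENNReal.Tendsto.const_mul ENNReal.tendsto_inv_nat_nhds_zero (Or.inr hC)
    rw [mul_zero] at h1
    refine le_antisymm (ge_of_tendsto h1 ?_) zero_le
    filter_upwards [eventually_gt_atTop 0] with K hK using hq K hK
  have h1 : ∀ᵐ ω ∂(perturbedLaw r g l ν), IsRegular ω := ae_isRegular _ ν
  filter_upwards [h1, measure_eq_zero_iff_ae_notMem.1 hzero] with ω hω hnot
  refine ⟨hω, ?_⟩
  simp only [mem_iInter, not_forall] at hnot
  obtain ⟨n, hn⟩ := hnot
  have hn' : ∃ k ≤ n, t < (ω k).1 := by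
    by_contra! h; exact hn h
  obtain ⟨k, -, hk⟩ := hn'
  obtain ⟨m, -, hm⟩ := hω.exists_mem_jumpCountSet ht (hk.trans_le (hω.2 (Nat.le_succ k)))
  exact ⟨m, hm⟩

/-- The change of measure formula for non-exploding processes. -/
lemma lintegral_perturbedLaw {t : ℝ} {l : ℝ} (hgood : ∀ᵐ ω ∂(unperturbedLaw r ν), IsGood t ω)
    (hgoodl : ∀ᵐ ω ∂(perturbedLaw r g l ν), IsGood t ω) {F : (ℕ → ℝ × X) → ℝ≥0∞}
    (hF : Measurable F) (hloc : IsLocal t F) :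
    ∫⁻ ω, F ω ∂(perturbedLaw r g l ν)
      = ∫⁻ ω, F ω * ENNReal.ofReal (Real.exp (pathLogDensity r g l t ω))
        ∂(unperturbedLaw r ν) := by
  rw [perturbedLaw] at hgoodl ⊢
  rw [unperturbedLaw] at hgood ⊢
  rw [lintegral_eq_tsum_jumpCountSet _ ν hgoodl, lintegral_eq_tsum_jumpCountSet _ ν hgood]
  exact tsum_congr fun n => setLIntegral_perturbedLaw r g l ν hF hloc n

/-- The left-hand side is the perturbed probability of the union of the `jumpCountSet t n`. It may
be less than one, since the perturbed process is allowed to explode, and for this reason `l` is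
arbitrary. -/
lemma lintegral_exp_pathLogDensity_le {t : ℝ} (hgood : ∀ᵐ ω ∂(unperturbedLaw r ν), IsGood t ω)
    (l : ℝ) :
    ∫⁻ ω, ENNReal.ofReal (Real.exp (pathLogDensity r g l t ω)) ∂(unperturbedLaw r ν) ≤ 1 := by
  rw [unperturbedLaw] at hgood ⊢
  rw [lintegral_eq_tsum_jumpCountSet _ ν hgood]
  have h : ∀ n, ∫⁻ ω in jumpCountSet t n, ENNReal.ofReal (Real.exp (pathLogDensity r g l t ω))
      ∂(pathLaw (unperturbedRate r) ν)
      = ∫⁻ ω in jumpCountSet t n, 1 ∂(pathLaw (perturbedRate r g l) ν) := fun n => by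
    have := setLIntegral_perturbedLaw r g l ν (t := t) (F := fun _ => 1) measurable_const
      (fun _ _ _ _ _ _ _ _ => rfl) n
    simp only [one_mul] at this
    exact this.symm
  simp_rw [h]
  rw [tsum_setLIntegral_jumpCountSet, setLIntegral_one]
  exact prob_le_one

/-- Let `J` be the jump sum of `|g|` and `I` its compensator. The Girsanov exponent `Λ` of the
perturbation `|g|` satisfies `κ (J + I) = Λ + ∫ tilt + κ I ≤ Λ + (κ e^{κ M} + κ) I`. Here `exp Λ`
has mass at most one, and for small `κ` the last term is at most `θ I`. -/
lemma exists_exp_activity (hM : ∀ s x y, |g.toFun s x y| ≤ M) {t : ℝ} (ht : 0 ≤ t)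
    (hgood : ∀ᵐ ω ∂(unperturbedLaw r ν), IsGood t ω) {θ : ℝ} (hθ0 : 0 < θ)
    (hθ : ∫⁻ ω, ENNReal.ofReal (Real.exp (θ * compensator r g t ω)) ∂(unperturbedLaw r ν) < ∞) :
    ∃ ε : ℝ, 0 < ε ∧ ∫⁻ ω, ENNReal.ofReal (Real.exp (ε * activity r g t ω))
      ∂(unperturbedLaw r ν) < ∞ := by
  have hcont : Continuous fun κ : ℝ => κ * Real.exp (κ * M) + κ := by fun_prop
  have h0 : ∀ᶠ κ in 𝓝[>] (0 : ℝ), κ * Real.exp (κ * M) + κ < θ :=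
    nhdsWithin_le_nhds ((hcont.tendsto 0).eventually (gt_mem_nhds (by simpa using hθ0)))
  obtain ⟨κ, hκ, hκ0⟩ := (h0.and self_mem_nhdsWithin).exists
  have hκ0 : 0 < κ := hκ0
  refine ⟨κ / 2, by positivity, ?_⟩
  have hle : ∀ᵐ ω ∂(unperturbedLaw r ν), ENNReal.ofReal (Real.exp (κ / 2 * activity r g t ω))
      ≤ ENNReal.ofReal (Real.exp (pathLogDensity r g.abs κ t ω))
        + ENNReal.ofReal (Real.exp (θ * compensator r g t ω)) := by
    filter_upwards [hgood] with ω hω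
    rw [← ENNReal.ofReal_add (Real.exp_pos _).le (Real.exp_pos _).le]
    refine ENNReal.ofReal_le_ofReal (le_trans (Real.exp_le_exp.2 ?_) (exp_half_add_le _ _))
    have hM' : ∀ s x y, |g.abs.toFun s x y| ≤ M := fun s x y => by
      change |(|g.toFun s x y|)| ≤ M
      rw [abs_abs]; exact hM s x y
    have b := (abs_le.1 (hω.abs_integral_tilt_le r g.abs hM' κ ht le_rfl)).2
    have e : compensator r g.abs t ω = compensator r g t ω := by
      simp only [compensator, Perturbation.abs, abs_abs]
    rw [e, abs_of_pos hκ0] at b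
    have hI := mul_le_mul_of_nonneg_right hκ.le (compensator_nonneg r g ht ω)
    rw [pathLogDensity, activity]
    linarith
  refine (lintegral_mono_ae hle).trans_lt ?_
  rw [lintegral_add_left (measurable_ofReal_exp (measurable_pathLogDensity r g.abs κ t))]
  exact ENNReal.add_lt_top.2
    ⟨(lintegral_exp_pathLogDensity_le r g.abs ν hgood κ).trans_lt ENNReal.one_lt_top, hθ⟩

end NonExplosion

/-! ### First order expansion of the density and the linear response formula. -/

section Response

lemma abs_exp_sub_one_sub_le (x : ℝ) : |Real.exp x - 1 - x| ≤ x ^ 2 * Real.exp |x| := by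
  have h1 : 1 ≤ Real.exp |x| := Real.one_le_exp (abs_nonneg x)
  rcases le_or_gt |x| 1 with h | h
  · exact (Real.abs_exp_sub_one_sub_id_le h).trans (le_mul_of_one_le_right (sq_nonneg x) h1)
  · have h2 : 1 ≤ x ^ 2 := (one_le_sq_iff_one_le_abs x).2 h.le
    rw [abs_of_nonneg (by linarith [Real.add_one_le_exp x])]
    rcases le_total 0 x with hx | hx
    · rw [abs_of_nonneg hx] at h1 ⊢
      nlinarith
    · rw [abs_of_nonpos hx] at h h1
      have h3 : Real.exp x ≤ 1 := Real.exp_le_one_iff.2 hx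
      have h4 : x ^ 2 ≤ x ^ 2 * Real.exp |x| :=
        le_mul_of_one_le_right (sq_nonneg x) (Real.one_le_exp (abs_nonneg x))
      nlinarith

/-- A quadratic bound for the first order expansion of an exponential `exp (l * a + o(l))`. -/
lemma abs_exp_sub_one_sub_mul_le {L l a Y b c ε : ℝ} (hY : 0 ≤ Y) (hc : 0 ≤ c)
    (hε : 0 < ε) (h1 : |L| ≤ |l| * b * Y) (h2 : |L - l * a| ≤ l ^ 2 * c * Y)
    (hl : |l| * b ≤ ε / 2) :
    |Real.exp L - 1 - l * a| ≤ (8 * b ^ 2 / ε ^ 2 + c / ε) * l ^ 2 * Real.exp (ε * Y) := by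
  have e1 : |L| ≤ ε / 2 * Y := h1.trans (mul_le_mul_of_nonneg_right hl hY)
  have e2 : L ^ 2 ≤ l ^ 2 * b ^ 2 * Y ^ 2 := by
    rw [← sq_abs L, ← sq_abs l]
    calc |L| ^ 2 ≤ (|l| * b * Y) ^ 2 := pow_le_pow_left₀ (abs_nonneg _) h1 2
      _ = _ := by ring
  -- From `y² / 2 ≤ exp y` at `y = ε Y / 2`. Half of `ε` absorbs `Y²` here, and the other half
  -- bounds `exp |L|` through `e1`.
  have e3 : Y ^ 2 ≤ 8 / ε ^ 2 * Real.exp (ε / 2 * Y) := by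
    have := Real.pow_div_factorial_le_exp (ε / 2 * Y) (by positivity) 2
    rw [div_mul_eq_mul_div, le_div_iff₀ (by positivity)]
    norm_num [Nat.factorial] at this
    nlinarith
  have e4 : Y ≤ 1 / ε * Real.exp (ε * Y) := by
    rw [div_mul_eq_mul_div, one_mul, le_div_iff₀ hε]
    linarith [Real.add_one_le_exp (ε * Y)]
  have e5 : Real.exp (ε / 2 * Y) * Real.exp (ε / 2 * Y) = Real.exp (ε * Y) := by
    rw [← Real.exp_add]; congr 1; ring
  have e6 : |Real.exp L - 1 - L| ≤ l ^ 2 * b ^ 2 * (8 / ε ^ 2) * Real.exp (ε * Y) := by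
    refine (abs_exp_sub_one_sub_le L).trans ?_
    calc L ^ 2 * Real.exp |L|
        ≤ (l ^ 2 * b ^ 2 * (8 / ε ^ 2 * Real.exp (ε / 2 * Y))) * Real.exp (ε / 2 * Y) := by
          refine mul_le_mul ?_ (Real.exp_le_exp.2 e1) (Real.exp_pos _).le (by positivity)
          exact e2.trans (mul_le_mul_of_nonneg_left e3 (by positivity))
      _ = _ := by rw [← e5]; ring
  have e7 : |L - l * a| ≤ l ^ 2 * c * (1 / ε * Real.exp (ε * Y)) :=
    h2.trans (mul_le_mul_of_nonneg_left e4 (by positivity))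
  calc |Real.exp L - 1 - l * a| = |(Real.exp L - 1 - L) + (L - l * a)| := by congr 1; ring
    _ ≤ _ := abs_add_le _ _
    _ ≤ _ := add_le_add e6 e7
    _ = _ := by ring

variable {X : Type*} [MeasurableSpace X] (r : TransitionKernel X) (g : Perturbation X) {M : ℝ}

lemma activity_nonneg {t : ℝ} (ht : 0 ≤ t) (ω : ℕ → ℝ × X) : 0 ≤ activity r g t ω :=
  add_nonneg (jumpSum_nonneg (fun _ _ _ => abs_nonneg _) _ _) (compensator_nonneg r g ht ω)

/-- The activity is taken at the final time `t`, so that one dominating variable serves all `s ≤ t`.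
-/
lemma IsGood.abs_responseMartingale_le {s t : ℝ} (hs : 0 ≤ s) (hst : s ≤ t) {ω : ℕ → ℝ × X}
    (hω : IsGood t ω) : |responseMartingale r g ω s| ≤ activity r g t ω := by
  obtain ⟨M, hM⟩ := g.abs.bounded
  refine (abs_sub _ _).trans (add_le_add ?_ ?_)
  · exact hω.abs_jumpSum_le_jumpSum (b := g.abs.toFun) (fun _ _ _ => le_rfl) hs hst
  · exact hω.abs_integral_contraction_le r g.abs.measurable hM (fun _ _ _ => le_rfl) hs hst

lemma IsGood.abs_pathLogDensity_le (hM0 : 0 ≤ M) (hM : ∀ s x y, |g.toFun s x y| ≤ M) {s t : ℝ}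
    (hs : 0 ≤ s) (hst : s ≤ t) {ω : ℕ → ℝ × X} (hω : IsGood t ω) {l : ℝ} (hl : |l| ≤ 1) :
    |pathLogDensity r g l s ω| ≤ |l| * Real.exp M * activity r g t ω := by
  have h1 := hω.abs_jumpSum_le_jumpSum (a := g.toFun) (b := g.abs.toFun) (fun _ _ _ => le_rfl)
    hs hst
  have h2 := hω.abs_integral_tilt_le r g hM l hs hst
  have h3 : Real.exp (|l| * M) ≤ Real.exp M := Real.exp_le_exp.2 (by nlinarith)
  have hI := compensator_nonneg r g (hs.trans hst) ω
  have hJ := jumpSum_nonneg (a := g.abs.toFun) (fun _ _ _ => abs_nonneg _) ω t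
  have h4 : |l| * Real.exp (|l| * M) * compensator r g t ω
      ≤ |l| * Real.exp M * compensator r g t ω := by gcongr
  have h5 : |l| * |jumpSum g.toFun ω s| ≤ |l| * (Real.exp M * jumpSum g.abs.toFun ω t) := by
    refine mul_le_mul_of_nonneg_left (h1.trans ?_) (abs_nonneg l)
    exact le_mul_of_one_le_left hJ (Real.one_le_exp hM0)
  have h6 : |pathLogDensity r g l s ω| ≤ |l * jumpSum g.toFun ω s| + _ := abs_sub _ _
  rw [abs_mul] at h6
  refine h6.trans ?_
  rw [activity]
  nlinarith

/-- The jump sums cancel and the contraction of `exp (l g) - 1 - l g` remains. Of the two factors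
`|g|` in its quadratic bound one is replaced by `M` and the other is kept, which leaves a multiple
of the compensator. -/
lemma IsGood.abs_pathLogDensity_sub_le (hM0 : 0 ≤ M) (hM : ∀ s x y, |g.toFun s x y| ≤ M) {s t : ℝ}
    (hs : 0 ≤ s) (hst : s ≤ t) {ω : ℕ → ℝ × X} (hω : IsGood t ω) {l : ℝ} (hl : |l| ≤ 1) :
    |pathLogDensity r g l s ω - l * responseMartingale r g ω s|
      ≤ l ^ 2 * (M * Real.exp M) * activity r g t ω := by
  obtain ⟨C, hC⟩ := exists_tilt_bound g l
  have hbound : ∀ s x y, |tilt g l s x y - l * g.toFun s x y|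
      ≤ l ^ 2 * (M * Real.exp M) * |g.toFun s x y| := fun s x y => by
    have h0 := abs_nonneg (g.toFun s x y)
    refine (abs_exp_sub_one_sub_le _).trans ?_
    have h1 : |l * g.toFun s x y| ≤ M := by
      rw [abs_mul]; nlinarith [hM s x y, abs_nonneg l]
    calc (l * g.toFun s x y) ^ 2 * Real.exp |l * g.toFun s x y|
        ≤ (l ^ 2 * (M * |g.toFun s x y|)) * Real.exp M := by
          refine mul_le_mul ?_ (Real.exp_le_exp.2 h1) (Real.exp_pos _).le (by positivity)
          rw [mul_pow, ← sq_abs (g.toFun s x y)]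
          exact mul_le_mul_of_nonneg_left (by nlinarith [hM s x y]) (sq_nonneg l)
      _ = _ := by ring
  have h := hω.abs_integral_contraction_le r
    (a := fun s x y => tilt g l s x y - l * g.toFun s x y)
    (b := fun s x y => l ^ 2 * (M * Real.exp M) * |g.toFun s x y|)
    (C := l ^ 2 * (M * Real.exp M) * M)
    (g.abs.measurable.const_mul _) (fun s x y => ?_) hbound hs hst
  · have hgs := hω.mono hs hst
    have e1 : ∫ w in (0 : ℝ)..s, onState (contraction r
          (fun s x y => tilt g l s x y - l * g.toFun s x y) w) (stateAt ω w)
        = (∫ w in (0 : ℝ)..s, onState (contraction r (tilt g l) w) (stateAt ω w))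
          - l * ∫ w in (0 : ℝ)..s, onState (contraction r g.toFun w) (stateAt ω w) := by
      rw [← intervalIntegral.integral_const_mul, ← intervalIntegral.integral_sub
        (hgs.intervalIntegrable_contraction r (measurable_tilt g l) hC)
        ((hgs.intervalIntegrable_contraction r g.measurable hM).const_mul l)]
      refine intervalIntegral.integral_congr fun w _ => ?_
      cases stateAt ω w with
      | none => simp [onState]
      | some x =>
        simp only [onState, Option.elim, contraction]
        rw [integral_sub (integrable_of_bounded r (measurable_tilt g l) hC w x)
          ((integrable_of_bounded r g.measurable hM w x).const_mul l), integral_const_mul]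
    have e2 : ∫ w in (0 : ℝ)..t, onState (contraction r
          (fun s x y => l ^ 2 * (M * Real.exp M) * |g.toFun s x y|) w) (stateAt ω w)
        = l ^ 2 * (M * Real.exp M) * compensator r g t ω := by
      rw [compensator, ← intervalIntegral.integral_const_mul]
      refine intervalIntegral.integral_congr fun w _ => ?_
      cases stateAt ω w with
      | none => simp [onState]
      | some x => exact integral_const_mul _ _
    rw [e1, e2] at h
    have e3 : pathLogDensity r g l s ω - l * responseMartingale r g ω s
        = -((∫ w in (0 : ℝ)..s, onState (contraction r (tilt g l) w) (stateAt ω w))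
          - l * ∫ w in (0 : ℝ)..s, onState (contraction r g.toFun w) (stateAt ω w)) := by
      rw [pathLogDensity, responseMartingale]; ring
    rw [e3, abs_neg]
    refine h.trans (mul_le_mul_of_nonneg_left ?_ (by positivity))
    exact le_add_of_nonneg_left (jumpSum_nonneg (fun _ _ _ => abs_nonneg _) _ _)
  · rw [abs_mul, abs_of_nonneg (by positivity : 0 ≤ l ^ 2 * (M * Real.exp M)), abs_abs]
    gcongr
    exact hM s x y

variable (ν : Measure X) [IsProbabilityMeasure ν]

lemma integrable_perturbedLaw {t : ℝ} {l : ℝ} (hgood : ∀ᵐ ω ∂(unperturbedLaw r ν), IsGood t ω)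
    (hgoodl : ∀ᵐ ω ∂(perturbedLaw r g l ν), IsGood t ω) {F : (ℕ → ℝ × X) → ℝ}
    (hF : Measurable F) (hloc : IsLocal t F)
    (hint : Integrable (fun ω => F ω * Real.exp (pathLogDensity r g l t ω))
      (unperturbedLaw r ν)) :
    Integrable F (perturbedLaw r g l ν) ∧ ∫ ω, F ω ∂(perturbedLaw r g l ν)
      = ∫ ω, F ω * Real.exp (pathLogDensity r g l t ω) ∂(unperturbedLaw r ν) := by
  have h1 : Integrable F (perturbedLaw r g l ν) := by
    refine ⟨hF.aestronglyMeasurable, ?_⟩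
    rw [HasFiniteIntegral, lintegral_perturbedLaw r g ν hgood hgoodl hF.enorm
      (hloc.comp fun x => ‖x‖ₑ)]
    refine lt_of_eq_of_lt (lintegral_congr fun ω => ?_) hint.2
    rw [enorm_mul, Real.enorm_eq_ofReal (Real.exp_pos _).le]
  refine ⟨h1, ?_⟩
  rw [integral_eq_lintegral_pos_part_sub_lintegral_neg_part h1,
    integral_eq_lintegral_pos_part_sub_lintegral_neg_part hint,
    lintegral_perturbedLaw r g ν hgood hgoodl hF.ennreal_ofReal (hloc.comp _),
    lintegral_perturbedLaw r g ν hgood hgoodl (F := fun ω => ENNReal.ofReal (-F ω))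
      hF.neg.ennreal_ofReal
      (hloc.comp fun x => ENNReal.ofReal (-x))]
  simp_rw [← neg_mul, ENNReal.ofReal_mul' (Real.exp_pos _).le]

/-- The linear response formula for functionals of the path up to time `s`. -/
lemma hasDerivAt_integral_perturbedLaw (hM0 : 0 ≤ M) (hM : ∀ s x y, |g.toFun s x y| ≤ M) {t : ℝ}
    (hgood : ∀ᵐ ω ∂(unperturbedLaw r ν), IsGood t ω)
    (hgoodl : ∀ᶠ l in 𝓝 (0 : ℝ), ∀ᵐ ω ∂(perturbedLaw r g l ν), IsGood t ω)
    {ε : ℝ} (hε : 0 < ε) {s : ℝ} (hs : 0 ≤ s) (hst : s ≤ t) {F : (ℕ → ℝ × X) → ℝ}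
    (hF : Measurable F) (hloc : IsLocal s F)
    (hint : Integrable (fun ω => F ω * Real.exp (ε * activity r g t ω)) (unperturbedLaw r ν)) :
    Integrable (fun ω => F ω * responseMartingale r g ω s) (unperturbedLaw r ν) ∧
    (∀ᶠ l in 𝓝 (0 : ℝ), Integrable F (perturbedLaw r g l ν)) ∧
    HasDerivAt (fun l : ℝ => ∫ ω, F ω ∂(perturbedLaw r g l ν))
      (∫ ω, F ω * responseMartingale r g ω s ∂(unperturbedLaw r ν)) 0 := by
  have ht := hs.trans hst
  have hmG : Measurable fun ω : ℕ → ℝ × X => responseMartingale r g ω s :=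
    (measurable_responseMartingale r g).comp measurable_prodMk_right
  -- All the factors of `F` that occur below (the martingale, `1`, the density and its Taylor
  -- remainder) are dominated by a multiple of `exp (ε * activity)`, so this is the single
  -- integrability argument.
  have dom : ∀ {H : (ℕ → ℝ × X) → ℝ}, Measurable H → ∀ C : ℝ,
      (∀ᵐ ω ∂(unperturbedLaw r ν), |H ω| ≤ C * Real.exp (ε * activity r g t ω)) →
      Integrable (fun ω => F ω * H ω) (unperturbedLaw r ν) ∧
      ∫ ω, |F ω * H ω| ∂(unperturbedLaw r ν)
        ≤ C * ∫ ω, |F ω * Real.exp (ε * activity r g t ω)| ∂(unperturbedLaw r ν) := by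
    intro H hH C hle
    have hle' : ∀ᵐ ω ∂(unperturbedLaw r ν), |F ω * H ω|
        ≤ C * |F ω * Real.exp (ε * activity r g t ω)| := by
      filter_upwards [hle] with ω hω
      rw [abs_mul, abs_mul, Real.abs_exp, mul_left_comm]
      exact mul_le_mul_of_nonneg_left hω (abs_nonneg _)
    have hi : Integrable (fun ω => F ω * H ω) (unperturbedLaw r ν) :=
      (hint.abs.const_mul C).mono' (hF.mul hH).aestronglyMeasurable hle'
    refine ⟨hi, ?_⟩
    rw [← integral_const_mul]
    exact integral_mono_ae hi.abs (hint.abs.const_mul C) hle'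
  have hG := (dom hmG (1 / ε) (by
    filter_upwards [hgood] with ω hω
    refine (hω.abs_responseMartingale_le r g hs hst).trans ?_
    rw [div_mul_eq_mul_div, one_mul, le_div_iff₀ hε]
    linarith [Real.add_one_le_exp (ε * activity r g t ω)])).1
  have hF1 : Integrable F (unperturbedLaw r ν) := by
    have := (dom (H := fun _ => 1) measurable_const 1 (ae_of_all _ fun ω => by
      rw [abs_one, one_mul]
      exact Real.one_le_exp (mul_nonneg hε.le (activity_nonneg r g ht ω)))).1
    simpa only [mul_one] using this
  have hsmall : ∀ᶠ l in 𝓝 (0 : ℝ), |l| ≤ 1 ∧ |l| * Real.exp M ≤ ε / 2 := by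
    have h1 : Tendsto (fun l : ℝ => |l|) (𝓝 0) (𝓝 0) := by
      simpa using (continuous_abs.tendsto (0 : ℝ))
    have h2 : Tendsto (fun l : ℝ => |l| * Real.exp M) (𝓝 0) (𝓝 0) := by
      simpa using h1.mul_const (Real.exp M)
    filter_upwards [h1.eventually (ge_mem_nhds one_pos),
      h2.eventually (ge_mem_nhds (half_pos hε))] with l a b using ⟨a, b⟩
  have hgoods : ∀ᵐ ω ∂(unperturbedLaw r ν), IsGood s ω := hgood.mono fun ω h => h.mono hs hst
  have hchange : ∀ᶠ l in 𝓝 (0 : ℝ), Integrable F (perturbedLaw r g l ν) ∧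
      Integrable (fun ω => F ω * Real.exp (pathLogDensity r g l s ω)) (unperturbedLaw r ν) ∧
      ∫ ω, F ω ∂(perturbedLaw r g l ν)
        = ∫ ω, F ω * Real.exp (pathLogDensity r g l s ω) ∂(unperturbedLaw r ν) := by
    filter_upwards [hgoodl, hsmall] with l hl ⟨hl1, hl2⟩
    have hi := (dom (measurable_pathLogDensity r g l s).exp 1 (by
      filter_upwards [hgood] with ω hω
      rw [Real.abs_exp, one_mul]
      refine Real.exp_le_exp.2 ((le_abs_self _).trans
        ((hω.abs_pathLogDensity_le r g hM0 hM hs hst hl1).trans ?_))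
      exact mul_le_mul_of_nonneg_right (hl2.trans (by linarith)) (activity_nonneg r g ht ω))).1
    have := integrable_perturbedLaw r g ν hgoods (hl.mono fun ω h => h.mono hs hst) hF hloc hi
    exact ⟨this.1, hi, this.2⟩
  refine ⟨hG, hchange.mono fun l h => h.1, ?_⟩
  -- The value at `l = 0` is an integral under `perturbedLaw r g 0 ν`; it equals the unperturbed one
  -- because `tilt g 0` vanishes and the density is `1`.
  have hzero : ∫ ω, F ω ∂(perturbedLaw r g 0 ν) = ∫ ω, F ω ∂(unperturbedLaw r ν) := by
    rw [hchange.self_of_nhds.2.2]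
    refine integral_congr_ae (ae_of_all _ fun ω => ?_)
    have h0 : ∀ w, onState (contraction r (tilt g 0) w) (stateAt ω w) = 0 := fun w => by
      cases stateAt ω w with
      | none => rfl
      | some x => simp [onState, contraction, tilt]
    simp [pathLogDensity, h0]
  set C : ℝ := 8 * Real.exp M ^ 2 / ε ^ 2 + M * Real.exp M / ε with hC
  set K : ℝ := ∫ ω, |F ω * Real.exp (ε * activity r g t ω)| ∂(unperturbedLaw r ν) with hK
  have hquad : ∀ᶠ l in 𝓝 (0 : ℝ), |∫ ω, F ω ∂(perturbedLaw r g l ν)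
      - ∫ ω, F ω ∂(perturbedLaw r g 0 ν)
      - l * ∫ ω, F ω * responseMartingale r g ω s ∂(unperturbedLaw r ν)| ≤ C * K * l ^ 2 := by
    filter_upwards [hchange, hsmall] with l ⟨_, hi, he⟩ ⟨hl1, hl2⟩
    have hd := dom (H := fun ω => Real.exp (pathLogDensity r g l s ω) - 1
        - l * responseMartingale r g ω s)
      (((measurable_pathLogDensity r g l s).exp.sub_const 1).sub (hmG.const_mul l)) (C * l ^ 2) (by
      filter_upwards [hgood] with ω hω
      exact abs_exp_sub_one_sub_mul_le (activity_nonneg r g ht ω) (by positivity)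
        hε (hω.abs_pathLogDensity_le r g hM0 hM hs hst hl1)
        (hω.abs_pathLogDensity_sub_le r g hM0 hM hs hst hl1) hl2)
    have e : ∫ ω, F ω ∂(perturbedLaw r g l ν) - ∫ ω, F ω ∂(perturbedLaw r g 0 ν)
        - l * ∫ ω, F ω * responseMartingale r g ω s ∂(unperturbedLaw r ν)
        = ∫ ω, F ω * (Real.exp (pathLogDensity r g l s ω) - 1
          - l * responseMartingale r g ω s) ∂(unperturbedLaw r ν) := by
      have hi' : Integrable (fun ω => F ω * Real.exp (pathLogDensity r g l s ω) - F ω)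
        (unperturbedLaw r ν) := hi.sub hF1
      rw [he, hzero, ← integral_const_mul, ← integral_sub hi hF1,
        ← integral_sub hi' (hG.const_mul l)]
      exact integral_congr_ae (ae_of_all _ fun ω => by ring)
    rw [e]
    refine (abs_integral_le_integral_abs).trans (hd.2.trans_eq ?_)
    ring
  rw [hasDerivAt_iff_isLittleO]
  refine Asymptotics.IsBigO.trans_isLittleO (g := fun l : ℝ => l ^ 2) ?_ ?_
  · refine Asymptotics.IsBigO.of_bound (C * K) ?_
    filter_upwards [hquad] with l hl
    rw [Real.norm_eq_abs, Real.norm_eq_abs, abs_of_nonneg (sq_nonneg l), sub_zero, smul_eq_mul]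
    exact hl
  · simpa using Asymptotics.isLittleO_pow_id (𝕜 := ℝ) one_lt_two

end Response

/-! ### The compensation formula for predictable integrands. -/

section Predictable

variable {X : Type*}

/-- The value at the `n + 1`-st jump of `β(u, X_{u-}, X_u) * H_{u-}`, where `H` is a process
adapted to the path. -/
def predictableTerm (β : ℝ → X → X → ℝ) (H : (ℕ → ℝ × X) → ℝ → ℝ) (ω : ℕ → ℝ × X) (n : ℕ) : ℝ :=
  β (ω (n + 1)).1 (ω n).2 (ω (n + 1)).2 * H (freeze n (ω (n + 1)).1 ω) (ω (n + 1)).1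

open Classical in
/-- The sum over the jumps in `(0, t]` of `φ (β(u, X_{u-}, X_u) * H_{u-})`. -/
def predictableSum (φ : ℝ → ℝ≥0∞) (β : ℝ → X → X → ℝ) (H : (ℕ → ℝ × X) → ℝ → ℝ) (t : ℝ)
    (ω : ℕ → ℝ × X) : ℝ≥0∞ :=
  ∑' n, if (ω (n + 1)).1 ≤ t then φ (predictableTerm β H ω n) else 0

open Classical in
/-- The sum over the jumps in `(0, t]` of `β(u, X_{u-}, X_u) * H_{u-}`. -/
def predictableIntegral (β : ℝ → X → X → ℝ) (H : (ℕ → ℝ × X) → ℝ → ℝ) (t : ℝ)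
    (ω : ℕ → ℝ × X) : ℝ :=
  ∑' n, if (ω (n + 1)).1 ≤ t then predictableTerm β H ω n else 0

lemma IsRegular.predictableIntegral_eq {ω : ℕ → ℝ × X} (hω : IsRegular ω)
    (β : ℝ → X → X → ℝ) (H : (ℕ → ℝ × X) → ℝ → ℝ) {t : ℝ} {n : ℕ} (hn : ω ∈ jumpCountSet t n) :
    predictableIntegral β H t ω = ∑ k ∈ Finset.range n, predictableTerm β H ω k := by
  rw [predictableIntegral, tsum_eq_sum (s := Finset.range n)]
  · exact Finset.sum_congr rfl fun k hk =>
      if_pos ((hω.jump_le_iff hn k).2 (Finset.mem_range.1 hk))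
  · exact fun k hk => if_neg fun h => hk (Finset.mem_range.2 ((hω.jump_le_iff hn k).1 h))

lemma IsRegular.predictableSum_eq {ω : ℕ → ℝ × X} (hω : IsRegular ω) (φ : ℝ → ℝ≥0∞)
    (β : ℝ → X → X → ℝ) (H : (ℕ → ℝ × X) → ℝ → ℝ) {t : ℝ} {n : ℕ} (hn : ω ∈ jumpCountSet t n) :
    predictableSum φ β H t ω = ∑ k ∈ Finset.range n, φ (predictableTerm β H ω k) := by
  rw [predictableSum, tsum_eq_sum (s := Finset.range n)]
  · exact Finset.sum_congr rfl fun k hk =>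
      if_pos ((hω.jump_le_iff hn k).2 (Finset.mem_range.1 hk))
  · exact fun k hk => if_neg fun h => hk (Finset.mem_range.2 ((hω.jump_le_iff hn k).1 h))

variable [MeasurableSpace X]

lemma measurable_predictableTerm {β : ℝ → X → X → ℝ}
    (hβ : Measurable (fun p : ℝ × X × X => β p.1 p.2.1 p.2.2)) {H : (ℕ → ℝ × X) → ℝ → ℝ}
    (hH : Measurable (Function.uncurry H)) (n : ℕ) :
    Measurable fun z : (ℕ → ℝ × X) × (ℝ × X) =>
      β z.2.1 (z.1 n).2 z.2.2 * H (freeze n z.2.1 z.1) z.2.1 := by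
  refine (hβ.comp (by fun_prop : Measurable fun z : (ℕ → ℝ × X) × (ℝ × X) =>
    (z.2.1, (z.1 n).2, z.2.2))).mul ?_
  exact hH.comp (((measurable_freeze n).comp (by fun_prop : Measurable
    fun z : (ℕ → ℝ × X) × (ℝ × X) => (z.1, z.2.1))).prodMk (by fun_prop))

lemma measurable_predictableSum {φ : ℝ → ℝ≥0∞} (hφ : Measurable φ) {β : ℝ → X → X → ℝ}
    (hβ : Measurable (fun p : ℝ × X × X => β p.1 p.2.1 p.2.2)) {H : (ℕ → ℝ × X) → ℝ → ℝ}
    (hH : Measurable (Function.uncurry H)) (t : ℝ) : Measurable (predictableSum φ β H t) :=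
  Measurable.tsum fun n => Measurable.ite
    (measurableSet_le (measurable_pi_apply (n + 1)).fst measurable_const)
    (hφ.comp ((measurable_predictableTerm hβ hH n).comp
      (by fun_prop : Measurable fun ω : ℕ → ℝ × X => (ω, ω (n + 1))))) measurable_const

variable (r : TransitionKernel X) (ν : Measure X) [IsProbabilityMeasure ν]

/-- The compensation formula for the `n + 1`-st jump. -/
lemma lintegral_jump_eq_lintegral_rate (n : ℕ) (t : ℝ) {f : (ℕ → ℝ × X) → ℝ × X → ℝ≥0∞}
    (hf : Measurable (Function.uncurry f)) (hdep : ∀ q, DependsOn (fun ω => f ω q) (Iic n)) :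
    ∫⁻ ω, {q : ℝ × X | q.1 ≤ t}.indicator (f ω) (ω (n + 1)) ∂(unperturbedLaw r ν)
      = ∫⁻ u in Ioc 0 t, ∫⁻ ω, (jumpCountSet u n).indicator
          (fun ω => ∫⁻ y, f ω (u, y) ∂(r.kernel (ω n).2)) ω ∂(unperturbedLaw r ν) := by
  set P := unperturbedLaw r ν with hP
  have : IsProbabilityMeasure P := by rw [hP, unperturbedLaw]; infer_instance
  set S : (ℕ → ℝ × X) → ℝ → ℝ≥0∞ := fun ω u =>
    ENNReal.ofReal (Real.exp (-∫ w in (ω n).1..u, totalRate (unperturbedRate r) w (ω n).2)) with hS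
  have hmS : Measurable (Function.uncurry S) := by
    refine measurable_ofReal_exp (Measurable.neg ?_)
    exact measurable_intervalIntegral_param
      (f := fun (z : (ℕ → ℝ × X) × ℝ) u => totalRate (unperturbedRate r) u (z.1 n).2)
      ((measurable_totalRate _).comp
        (by fun_prop : Measurable fun z : ((ℕ → ℝ × X) × ℝ) × ℝ => (z.2, (z.1.1 n).2)))
      (by fun_prop) measurable_snd
  set Ψ : (ℕ → ℝ × X) → ℝ → ℝ≥0∞ := fun ω u => ∫⁻ y, f ω (u, y) ∂(r.kernel (ω n).2) with hΨ
  have hmΨ : Measurable (Function.uncurry Ψ) := by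
    have h : Measurable fun z : ((ℕ → ℝ × X) × ℝ) × X => f z.1.1 (z.1.2, z.2) :=
      hf.comp (by fun_prop : Measurable fun z : ((ℕ → ℝ × X) × ℝ) × X => (z.1.1, (z.1.2, z.2)))
    exact h.lintegral_kernel_prod_right' (κ := r.kernel.comap
      (fun z : (ℕ → ℝ × X) × ℝ => (z.1 n).2) (by fun_prop))
  have hdΨ : ∀ u, DependsOn (fun ω => Ψ ω u) (Iic n) := fun u ω ω' h => by
    have e : ∀ q, f ω q = f ω' q := fun q => hdep q h
    simp only [hΨ, e, h n (mem_Iic.2 le_rfl)]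
  have hmt : MeasurableSet {q : ℝ × X | q.1 ≤ t} := measurableSet_le measurable_fst measurable_const
  -- Integrating out entry `n + 1`: the next jump has density survival `S` times the rate of `f`,
  -- which is `Ψ`.
  have left : ∫⁻ ω, {q : ℝ × X | q.1 ≤ t}.indicator (f ω) (ω (n + 1)) ∂P
      = ∫⁻ ω, (∫⁻ u in Ioc (0 : ℝ) t,
          {u | (ω n).1 ≤ u}.indicator (fun u => S ω u * Ψ ω u) u) ∂P := by
    have hmi : Measurable fun z : (ℕ → ℝ × X) × (ℝ × X) =>
        {q : ℝ × X | q.1 ≤ t}.indicator (f z.1) z.2 := by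
      have := hf.indicator (measurable_snd hmt : MeasurableSet
        ((Prod.snd : (ℕ → ℝ × X) × (ℝ × X) → ℝ × X) ⁻¹' {q | q.1 ≤ t}))
      exact this
    rw [hP, unperturbedLaw, lintegral_pathLaw_succ _ ν n
      (f := fun ω q => {q : ℝ × X | q.1 ≤ t}.indicator (f ω) q) hmi (fun q ω ω' h => by
        have e : f ω q = f ω' q := hdep q h
        simp only [indicator, e])]
    refine lintegral_congr_ae ?_
    filter_upwards [ae_isRegular (unperturbedRate r) ν] with ω hω
    have hmω : Measurable ({q : ℝ × X | q.1 ≤ t}.indicator (f ω)) :=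
      hmi.comp (measurable_prodMk_left (x := ω))
    rw [← Prod.mk.eta (p := ω n), lintegral_stepKernel _ (ω n).1 (ω n).2 hmω,
      ← lintegral_indicator measurableSet_Ioi, ← lintegral_indicator measurableSet_Ioc]
    refine lintegral_congr_ae ?_
    filter_upwards [compl_mem_ae_iff.2 (measure_singleton ((ω n).1))] with u hu
    have hu : u ≠ (ω n).1 := hu
    have hT := hω.nonneg n
    by_cases h1 : (ω n).1 < u
    · rw [indicator_of_mem (show u ∈ Ioi (ω n).1 from h1)]
      by_cases h2 : u ≤ t
      · rw [indicator_of_mem (show u ∈ Ioc 0 t from ⟨hT.trans_lt h1, h2⟩),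
          indicator_of_mem (show u ∈ {u | (ω n).1 ≤ u} from h1.le)]
        have e : ∀ y : X, {q : ℝ × X | q.1 ≤ t}.indicator (f ω) (u, y) = f ω (u, y) :=
          fun y => indicator_of_mem (show (u, y) ∈ {q : ℝ × X | q.1 ≤ t} from h2) _
        simp only [e]
        rfl
      · rw [indicator_of_notMem (show u ∉ Ioc 0 t from fun h => h2 h.2)]
        have e : ∀ y : X, {q : ℝ × X | q.1 ≤ t}.indicator (f ω) (u, y) = 0 :=
          fun y => indicator_of_notMem (show (u, y) ∉ {q : ℝ × X | q.1 ≤ t} from h2) _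
        simp only [e, lintegral_zero, mul_zero]
    · have h1' : ¬ (ω n).1 ≤ u := fun h => h1 (lt_of_le_of_ne h (Ne.symm hu))
      rw [indicator_of_notMem (show u ∉ Ioi (ω n).1 from h1)]
      symm
      exact indicator_apply_eq_zero.2 fun _ =>
        indicator_of_notMem (show u ∉ {u | (ω n).1 ≤ u} from h1') _
  -- Here the same factor `S` arises as the conditional probability that jump `n + 1` comes after
  -- `u`; the two sides then agree by Tonelli.
  have right : ∀ u, ∫⁻ ω, (jumpCountSet u n).indicator (fun ω => Ψ ω u) ω ∂P
      = ∫⁻ ω, {ω : ℕ → ℝ × X | (ω n).1 ≤ u}.indicator (fun ω => S ω u * Ψ ω u) ω ∂P := by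
    intro u
    have hmu : MeasurableSet {q : ℝ × X | u < q.1} :=
      measurableSet_lt measurable_const measurable_fst
    have hmA : MeasurableSet {ω : ℕ → ℝ × X | (ω n).1 ≤ u} :=
      measurableSet_le (measurable_pi_apply n).fst measurable_const
    have hmφ : Measurable ({ω : ℕ → ℝ × X | (ω n).1 ≤ u}.indicator fun ω => Ψ ω u) :=
      (hmΨ.comp measurable_prodMk_right).indicator hmA
    have e : ∀ ω : ℕ → ℝ × X, (jumpCountSet u n).indicator (fun ω => Ψ ω u) ω
        = {ω : ℕ → ℝ × X | (ω n).1 ≤ u}.indicator (fun ω => Ψ ω u) ω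
          * {q : ℝ × X | u < q.1}.indicator 1 (ω (n + 1)) := by
      intro ω
      by_cases h1 : (ω n).1 ≤ u
      · by_cases h2 : u < (ω (n + 1)).1
        · rw [indicator_of_mem (show ω ∈ jumpCountSet u n from ⟨h1, h2⟩),
            indicator_of_mem (show ω ∈ {ω : ℕ → ℝ × X | (ω n).1 ≤ u} from h1),
            indicator_of_mem (show ω (n + 1) ∈ {q : ℝ × X | u < q.1} from h2), Pi.one_apply,
            mul_one]
        · rw [indicator_of_notMem (show ω ∉ jumpCountSet u n from fun h => h2 h.2),
            indicator_of_notMem (show ω (n + 1) ∉ {q : ℝ × X | u < q.1} from h2), mul_zero]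
      · rw [indicator_of_notMem (show ω ∉ jumpCountSet u n from fun h => h1 h.1),
          indicator_of_notMem (show ω ∉ {ω : ℕ → ℝ × X | (ω n).1 ≤ u} from h1), zero_mul]
    simp_rw [e]
    rw [hP, unperturbedLaw, lintegral_pathLaw_succ _ ν n
      (f := fun ω q => {ω : ℕ → ℝ × X | (ω n).1 ≤ u}.indicator (fun ω => Ψ ω u) ω
        * {q : ℝ × X | u < q.1}.indicator 1 q)
      ((hmφ.comp measurable_fst).mul ((measurable_one.indicator hmu).comp measurable_snd))
      (fun q ω ω' h => by
        have e : Ψ ω u = Ψ ω' u := hdΨ u h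
        simp only [indicator, mem_ofPred_eq, e, h n (mem_Iic.2 le_rfl)])]
    refine lintegral_congr fun ω => ?_
    rw [lintegral_const_mul _ (measurable_one.indicator hmu), lintegral_indicator_one hmu]
    by_cases h1 : (ω n).1 ≤ u
    · rw [indicator_of_mem (show ω ∈ {ω : ℕ → ℝ × X | (ω n).1 ≤ u} from h1),
        indicator_of_mem (show ω ∈ {ω : ℕ → ℝ × X | (ω n).1 ≤ u} from h1),
        stepKernel_tail _ (s := (ω n).1) h1, mul_comm]
    · rw [indicator_of_notMem (show ω ∉ {ω : ℕ → ℝ × X | (ω n).1 ≤ u} from h1),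
        indicator_of_notMem (show ω ∉ {ω : ℕ → ℝ × X | (ω n).1 ≤ u} from h1), zero_mul]
  rw [left, lintegral_congr right]
  refine lintegral_lintegral_swap (Measurable.aemeasurable ?_)
  have hset : MeasurableSet {z : (ℕ → ℝ × X) × ℝ | (z.1 n).1 ≤ z.2} :=
    measurableSet_le (by fun_prop) (by fun_prop)
  have := (hmS.mul hmΨ).indicator hset
  exact this

/-- The compensation formula. -/
lemma lintegral_predictableSum {t : ℝ} (hgood : ∀ᵐ ω ∂(unperturbedLaw r ν), IsGood t ω)
    {φ : ℝ → ℝ≥0∞} (hφ : Measurable φ) {β : ℝ → X → X → ℝ}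
    (hβ : Measurable (fun p : ℝ × X × X => β p.1 p.2.1 p.2.2)) {H : (ℕ → ℝ × X) → ℝ → ℝ}
    (hH : Measurable (Function.uncurry H)) (hloc : ∀ u, 0 ≤ u → IsLocal u fun ω => H ω u) :
    ∫⁻ ω, predictableSum φ β H t ω ∂(unperturbedLaw r ν)
      = ∫⁻ u in Ioc 0 t, ∫⁻ ω, onState (fun x => ∫⁻ y, φ (β u x y * H ω u) ∂(r.kernel x))
          (stateAt ω u) ∂(unperturbedLaw r ν) := by
  have hterm := fun n => hφ.comp (measurable_predictableTerm hβ hH n)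
  have hdep : ∀ n (q : ℝ × X), DependsOn (fun ω : ℕ → ℝ × X =>
      φ (β q.1 (ω n).2 q.2 * H (freeze n q.1 ω) q.1)) (Iic n) := fun n q ω ω' h => by
    have e : H (freeze n q.1 ω) q.1 = H (freeze n q.1 ω') q.1 :=
      dependsOn_freeze (fun ω => H ω q.1) n q.1 h
    simp only [e, h n (mem_Iic.2 le_rfl)]
  have h1 := fun n => lintegral_jump_eq_lintegral_rate r ν n t
    (f := fun ω q => φ (β q.1 (ω n).2 q.2 * H (freeze n q.1 ω) q.1)) (hterm n) (hdep n)
  have hrate : ∀ n, Measurable fun z : (ℕ → ℝ × X) × ℝ =>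
      ∫⁻ y, φ (β z.2 (z.1 n).2 y * H (freeze n z.2 z.1) z.2) ∂(r.kernel (z.1 n).2) := fun n => by
    have h : Measurable fun z : ((ℕ → ℝ × X) × ℝ) × X =>
        φ (β z.1.2 (z.1.1 n).2 z.2 * H (freeze n z.1.2 z.1.1) z.1.2) :=
      (hterm n).comp
        (by fun_prop : Measurable fun z : ((ℕ → ℝ × X) × ℝ) × X => (z.1.1, (z.1.2, z.2)))
    exact h.lintegral_kernel_prod_right' (κ := r.kernel.comap
      (fun z : (ℕ → ℝ × X) × ℝ => (z.1 n).2) (by fun_prop))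
  have hind : ∀ n, Measurable fun z : (ℕ → ℝ × X) × ℝ => (jumpCountSet z.2 n).indicator
      (fun ω => ∫⁻ y, φ (β z.2 (ω n).2 y * H (freeze n z.2 ω) z.2) ∂(r.kernel (ω n).2)) z.1 :=
    fun n => by
      have ha : MeasurableSet {z : (ℕ → ℝ × X) × ℝ | (z.1 n).1 ≤ z.2} :=
        measurableSet_le (by fun_prop) (by fun_prop)
      have hb : MeasurableSet {z : (ℕ → ℝ × X) × ℝ | z.2 < (z.1 (n + 1)).1} :=
        measurableSet_lt (by fun_prop) (by fun_prop)
      have := (hrate n).indicator (ha.inter hb)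
      exact this
  have : IsProbabilityMeasure (unperturbedLaw r ν) := by rw [unperturbedLaw]; infer_instance
  calc ∫⁻ ω, predictableSum φ β H t ω ∂(unperturbedLaw r ν)
      = ∑' n, ∫⁻ ω, {q : ℝ × X | q.1 ≤ t}.indicator
          (fun q => φ (β q.1 (ω n).2 q.2 * H (freeze n q.1 ω) q.1)) (ω (n + 1))
          ∂(unperturbedLaw r ν) := by
        simp only [predictableSum]
        exact lintegral_tsum fun n => Measurable.aemeasurable (Measurable.ite
          (measurableSet_le (measurable_pi_apply (n + 1)).fst measurable_const)
          ((hterm n).comp (by fun_prop : Measurable fun ω : ℕ → ℝ × X => (ω, ω (n + 1))))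
          measurable_const)
    _ = ∑' n, ∫⁻ u in Ioc 0 t, ∫⁻ ω, (jumpCountSet u n).indicator
          (fun ω => ∫⁻ y, φ (β u (ω n).2 y * H (freeze n u ω) u) ∂(r.kernel (ω n).2)) ω
          ∂(unperturbedLaw r ν) := tsum_congr h1
    _ = ∫⁻ u in Ioc 0 t, ∫⁻ ω, ∑' n, (jumpCountSet u n).indicator
          (fun ω => ∫⁻ y, φ (β u (ω n).2 y * H (freeze n u ω) u) ∂(r.kernel (ω n).2)) ω
          ∂(unperturbedLaw r ν) := by
        rw [← lintegral_tsum fun n => (hind n).lintegral_prod_left'.aemeasurable]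
        refine lintegral_congr fun u => ?_
        exact (lintegral_tsum fun n => Measurable.aemeasurable
          ((hind n).comp (measurable_prodMk_right (y := u)))).symm
    _ = _ := by
        refine setLIntegral_congr_fun measurableSet_Ioc fun u hu => lintegral_congr_ae ?_
        filter_upwards [hgood] with ω hω
        -- At time `u` exactly one `n` contributes, and for it locality of `H` removes the freezing.
        obtain ⟨hω, n, hn⟩ := hω.mono hu.1.le hu.2
        rw [tsum_eq_single n, indicator_of_mem hn, hω.stateAt_eq hn]
        · have e : H (freeze n u ω) u = H ω u := (hloc u hu.1.le).freeze_eq hω hn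
          simp only [e]
          rfl
        · exact fun m hm => indicator_of_notMem
            (fun h => hm (hω.eq_of_mem_jumpCountSet h hn)) _

lemma integral_eq_toReal_lintegral_sub {Y : Type*} [MeasurableSpace Y] {μ : Measure Y}
    {f : Y → ℝ} {p q : Y → ℝ≥0∞} (hp : Measurable p) (hq : Measurable q)
    (hp' : ∫⁻ y, p y ∂μ ≠ ∞) (hq' : ∫⁻ y, q y ∂μ ≠ ∞)
    (h : ∀ᵐ y ∂μ, f y = (p y).toReal - (q y).toReal) :
    Integrable f μ ∧ ∫ y, f y ∂μ = (∫⁻ y, p y ∂μ).toReal - (∫⁻ y, q y ∂μ).toReal := by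
  have ip := integrable_toReal_of_lintegral_ne_top hp.aemeasurable hp'
  have iq := integrable_toReal_of_lintegral_ne_top hq.aemeasurable hq'
  refine ⟨(ip.sub iq).congr (h.mono fun y hy => hy.symm), ?_⟩
  rw [integral_congr_ae h, integral_sub ip iq,
    integral_toReal hp.aemeasurable (ae_lt_top hp hp'),
    integral_toReal hq.aemeasurable (ae_lt_top hq hq')]

/-- The compensation formula for signed integrands. -/
lemma integral_predictableSum {t : ℝ} (hgood : ∀ᵐ ω ∂(unperturbedLaw r ν), IsGood t ω)
    {β : ℝ → X → X → ℝ}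
    (hβ : Measurable (fun p : ℝ × X × X => β p.1 p.2.1 p.2.2)) {H : (ℕ → ℝ × X) → ℝ → ℝ}
    (hH : Measurable (Function.uncurry H)) (hloc : ∀ u, 0 ≤ u → IsLocal u fun ω => H ω u)
    (hfin : ∫⁻ ω, predictableSum (fun z => ‖z‖ₑ) β H t ω ∂(unperturbedLaw r ν) < ∞) :
    Integrable (fun z : (ℕ → ℝ × X) × ℝ =>
      onState (contraction r β z.2) (stateAt z.1 z.2) * H z.1 z.2)
      ((unperturbedLaw r ν).prod (volume.restrict (Ioc 0 t))) ∧
    Integrable (predictableIntegral β H t) (unperturbedLaw r ν) ∧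
    ∫ ω, predictableIntegral β H t ω ∂(unperturbedLaw r ν)
      = ∫ z, onState (contraction r β z.2) (stateAt z.1 z.2) * H z.1 z.2
        ∂((unperturbedLaw r ν).prod (volume.restrict (Ioc 0 t))) := by
  have : IsProbabilityMeasure (unperturbedLaw r ν) := by rw [unperturbedLaw]; infer_instance
  -- The formula is used for three `φ`: the norm, which gives finiteness, and the positive and
  -- negative parts, whose difference is then legitimate.
  set ρ : (ℝ → ℝ≥0∞) → (ℕ → ℝ × X) × ℝ → ℝ≥0∞ := fun φ z =>
    onState (fun x => ∫⁻ y, φ (β z.2 x y * H z.1 z.2) ∂(r.kernel x)) (stateAt z.1 z.2) with hρ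
  have hmρ : ∀ φ, Measurable φ → Measurable (ρ φ) := fun φ hφ => by
    refine measurable_onState_stateAt_param
      (f := fun z x => ∫⁻ y, φ (β z.2 x y * H z.1 z.2) ∂(r.kernel x)) ?_
    have h : Measurable fun q : (((ℕ → ℝ × X) × ℝ) × X) × X =>
        φ (β q.1.1.2 q.1.2 q.2 * H q.1.1.1 q.1.1.2) :=
      hφ.comp ((hβ.comp (by fun_prop : Measurable fun q : (((ℕ → ℝ × X) × ℝ) × X) × X =>
        (q.1.1.2, q.1.2, q.2))).mul (hH.comp measurable_fst.fst))
    exact h.lintegral_kernel_prod_right' (κ := r.kernel.comap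
      (fun q : ((ℕ → ℝ × X) × ℝ) × X => q.2) measurable_snd)
  have hcomp : ∀ φ, Measurable φ → ∫⁻ z, ρ φ z
      ∂((unperturbedLaw r ν).prod (volume.restrict (Ioc 0 t)))
      = ∫⁻ ω, predictableSum φ β H t ω ∂(unperturbedLaw r ν) := fun φ hφ => by
    rw [lintegral_predictableSum r ν hgood hφ hβ hH hloc,
      lintegral_prod_symm' _ (hmρ φ hφ)]
  have hle : ∀ φ : ℝ → ℝ≥0∞, (∀ z, φ z ≤ ‖z‖ₑ) →
      ∫⁻ ω, predictableSum φ β H t ω ∂(unperturbedLaw r ν) ≠ ∞ := fun φ hφ => by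
    refine ((lintegral_mono fun ω => ENNReal.tsum_le_tsum fun n => ?_).trans_lt hfin).ne
    split_ifs
    · exact hφ _
    · exact le_rfl
  have hneg : Measurable fun z : ℝ => ENNReal.ofReal (-z) := measurable_neg.ennreal_ofReal
  have b1 : ∀ z : ℝ, ENNReal.ofReal z ≤ ‖z‖ₑ := fun z => Real.ofReal_le_enorm z
  have b2 : ∀ z : ℝ, ENNReal.ofReal (-z) ≤ ‖z‖ₑ := fun z => by
    rw [← enorm_neg]; exact Real.ofReal_le_enorm (-z)
  have habs : ∀ᵐ z ∂((unperturbedLaw r ν).prod (volume.restrict (Ioc 0 t))),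
      ρ (fun z => ‖z‖ₑ) z < ∞ :=
    ae_lt_top (hmρ _ measurable_enorm) (by rw [hcomp _ measurable_enorm]; exact hfin.ne)
  have hR := integral_eq_toReal_lintegral_sub
    (f := fun z : (ℕ → ℝ × X) × ℝ => onState (contraction r β z.2) (stateAt z.1 z.2) * H z.1 z.2)
    (hmρ _ ENNReal.measurable_ofReal) (hmρ _ hneg)
    (by rw [hcomp _ ENNReal.measurable_ofReal]; exact hle _ b1)
    (by rw [hcomp _ hneg]; exact hle _ b2) (by
      filter_upwards [habs] with z hz
      simp only [hρ] at hz ⊢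
      cases hst : stateAt z.1 z.2 with
      | none => simp [onState]
      | some x =>
        rw [hst] at hz
        simp only [onState, Option.elim] at hz ⊢
        have hi : Integrable (fun y => β z.2 x y * H z.1 z.2) (r.kernel x) :=
          ⟨((hβ.comp (by fun_prop : Measurable fun y : X => (z.2, x, y))).mul_const
            _).aestronglyMeasurable, hz⟩
        rw [← integral_eq_lintegral_pos_part_sub_lintegral_neg_part hi, integral_mul_const]
        rfl)
  have hQ' := integral_eq_toReal_lintegral_sub (μ := unperturbedLaw r ν)
    (f := predictableIntegral β H t)
    (measurable_predictableSum ENNReal.measurable_ofReal hβ hH t)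
    (measurable_predictableSum hneg hβ hH t) (hle _ b1) (hle _ b2) (by
      filter_upwards [hgood] with ω ⟨hω, n, hn⟩
      rw [hω.predictableSum_eq _ β H hn, hω.predictableSum_eq _ β H hn,
        hω.predictableIntegral_eq β H hn,
        ENNReal.toReal_sum fun _ _ => ENNReal.ofReal_ne_top,
        ENNReal.toReal_sum fun _ _ => ENNReal.ofReal_ne_top, ← Finset.sum_sub_distrib]
      refine Finset.sum_congr rfl fun k _ => ?_
      rw [ENNReal.toReal_ofReal', ENNReal.toReal_ofReal', max_zero_sub_max_neg_zero_eq_self])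
  refine ⟨hR.1, hQ'.1, ?_⟩
  rw [hR.2, hQ'.2, hcomp _ ENNReal.measurable_ofReal, hcomp _ hneg]

end Predictable

/-! ### Integration by parts for a jump sum and the response martingale. -/

section IntegrationByParts

/-- The square of index pairs splits into the diagonal and two strict triangles; strictness is what
produces left limits at the jumps. -/
lemma sum_range_mul_sum_range (a b : ℕ → ℝ) (n : ℕ) :
    (∑ k ∈ Finset.range n, a k) * ∑ k ∈ Finset.range n, b k
      = ∑ k ∈ Finset.range n, a k * b k
        + ∑ k ∈ Finset.range n, a k * ∑ j ∈ Finset.range k, b j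
        + ∑ k ∈ Finset.range n, b k * ∑ j ∈ Finset.range k, a j := by
  induction n with
  | zero => simp
  | succ n ih =>
    simp only [Finset.sum_range_succ] at ih ⊢
    linear_combination ih

/-- The indicator is the jump sum of a single jump of size `a` at time `c`; general jump sums are
finite sums of these by `jumpSum_eq_sum_indicator`. -/
lemma intervalIntegral_mul_indicator_Ici {γ : ℝ → ℝ} {c t : ℝ} (a : ℝ) (hc : 0 ≤ c) (hct : c ≤ t)
    (hγ : IntervalIntegrable γ volume 0 t) :
    IntervalIntegrable (fun w => γ w * (Ici c).indicator (fun _ => a) w) volume 0 t ∧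
    ∫ w in (0 : ℝ)..t, γ w * (Ici c).indicator (fun _ => a) w = a * ∫ w in c..t, γ w := by
  have e : (fun w => γ w * (Ici c).indicator (fun _ => a) w)
      = (Ici c).indicator fun w => γ w * a := by
    funext w; simp only [indicator]; split_ifs <;> simp
  have h0t := hc.trans hct
  have hi : IntervalIntegrable (fun w => γ w * (Ici c).indicator (fun _ => a) w) volume 0 t := by
    rw [e, intervalIntegrable_iff_integrableOn_Ioc_of_le h0t]
    exact ((intervalIntegrable_iff_integrableOn_Ioc_of_le h0t).1
      (hγ.mul_const a)).indicator measurableSet_Ici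
  refine ⟨hi, ?_⟩
  have hsub1 : uIcc 0 c ⊆ uIcc 0 t := by
    rw [uIcc_of_le hc, uIcc_of_le h0t]; exact Icc_subset_Icc_right hct
  have hsub2 : uIcc c t ⊆ uIcc 0 t := by
    rw [uIcc_of_le hct, uIcc_of_le h0t]; exact Icc_subset_Icc_left hc
  rw [← intervalIntegral.integral_add_adjacent_intervals (hi.mono_set hsub1) (hi.mono_set hsub2)]
  have h1 : ∫ w in (0 : ℝ)..c, γ w * (Ici c).indicator (fun _ => a) w = 0 := by
    refine intervalIntegral.integral_zero_ae ?_
    filter_upwards [compl_mem_ae_iff.2 (measure_singleton c)] with w hw hwc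
    rw [uIoc_of_le hc] at hwc
    have : w ∉ Ici c := fun h => hw (le_antisymm hwc.2 h)
    rw [indicator_of_notMem this, mul_zero]
  have h2 : ∫ w in c..t, γ w * (Ici c).indicator (fun _ => a) w = ∫ w in c..t, γ w * a := by
    refine intervalIntegral.integral_congr fun w hw => ?_
    rw [uIcc_of_le hct] at hw
    exact congrArg (γ w * ·) (indicator_of_mem (show w ∈ Ici c from hw.1) _)
  rw [h1, h2, zero_add, intervalIntegral.integral_mul_const, mul_comm]

variable {X : Type*}

lemma IsRegular.jumpSum_eq_sum_indicator {ω : ℕ → ℝ × X} (hω : IsRegular ω) (a : ℝ → X → X → ℝ)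
    {t : ℝ} {n : ℕ} (hn : ω ∈ jumpCountSet t n) {w : ℝ} (hw : w ≤ t) :
    jumpSum a ω w = ∑ k ∈ Finset.range n,
      (Ici (ω (k + 1)).1).indicator (fun _ => a (ω (k + 1)).1 (ω k).2 (ω (k + 1)).2) w := by
  rw [jumpSum, tsum_eq_sum (s := Finset.range n)]
  · refine Finset.sum_congr rfl fun k _ => ?_
    by_cases h : (ω (k + 1)).1 ≤ w
    · rw [if_pos h, indicator_of_mem (show w ∈ Ici (ω (k + 1)).1 from h)]
    · rw [if_neg h, indicator_of_notMem (show w ∉ Ici (ω (k + 1)).1 from h)]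
  · exact fun k hk => if_neg fun h =>
      hk (Finset.mem_range.2 ((hω.jump_le_iff hn k).1 (h.trans hw)))

/-- Freezing after `k` jumps removes the jump that takes place at the evaluation time, so the value
is the left limit of the jump sum there. -/
lemma IsRegular.jumpSum_freeze {ω : ℕ → ℝ × X} (hω : IsRegular ω) (a : ℝ → X → X → ℝ) (k : ℕ) :
    jumpSum a (MarkovJump.freeze k (ω (k + 1)).1 ω) (ω (k + 1)).1
      = ∑ j ∈ Finset.range k, a (ω (j + 1)).1 (ω j).2 (ω (j + 1)).2 := by
  have hk := hω.2 (Nat.le_succ k)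
  rw [(hω.freeze hk).jumpSum_eq a (freeze_mem_jumpCountSet hk)]
  refine Finset.sum_congr rfl fun j hj => ?_
  have hj := Finset.mem_range.1 hj
  rw [freeze_of_le (Nat.succ_le_of_lt hj), freeze_of_le hj.le]

lemma IsRegular.integral_freeze {ω : ℕ → ℝ × X} (hω : IsRegular ω) {f : ℝ → X → ℝ}
    (hf : ∀ x a b, IntervalIntegrable (fun w => f w x) volume a b) (k : ℕ) :
    ∫ w in (0 : ℝ)..(ω (k + 1)).1, onState (f w) (stateAt (MarkovJump.freeze k (ω (k + 1)).1 ω) w)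
      = ∫ w in (0 : ℝ)..(ω (k + 1)).1, onState (f w) (stateAt ω w) := by
  have hk := hω.2 (Nat.le_succ k)
  have hmem := freeze_mem_jumpCountSet hk
  have h1 : (MarkovJump.freeze k (ω (k + 1)).1 ω k).1 ≤ (ω (k + 1)).1 := hmem.1
  rw [((hω.freeze hk).integral_onState hf k h1 hmem.2.le).2, (hω.integral_onState hf k hk le_rfl).2,
    freeze_of_le le_rfl]
  congr 1
  refine Finset.sum_congr rfl fun j hj => ?_
  have hj := Finset.mem_range.1 hj
  rw [freeze_of_le (Nat.succ_le_of_lt hj), freeze_of_le hj.le]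

variable [MeasurableSpace X] (r : TransitionKernel X) (g : Perturbation X)

lemma IsRegular.responseMartingale_freeze {ω : ℕ → ℝ × X} (hω : IsRegular ω) (k : ℕ) :
    responseMartingale r g (MarkovJump.freeze k (ω (k + 1)).1 ω) (ω (k + 1)).1
      = ∑ j ∈ Finset.range k, g.toFun (ω (j + 1)).1 (ω j).2 (ω (j + 1)).2
        - ∫ w in (0 : ℝ)..(ω (k + 1)).1, onState (contraction r g.toFun w) (stateAt ω w) := by
  obtain ⟨M, hM⟩ := g.bounded
  rw [responseMartingale, hω.jumpSum_freeze, hω.integral_freeze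
    (fun x a b => MarkovJump.intervalIntegrable_contraction r g.measurable hM x a b)]

/-- Integration by parts for the product of a jump sum and the response martingale. -/
lemma IsGood.jumpSum_mul_responseMartingale (α : ℝ → X → X → ℝ) {t : ℝ} (ht : 0 ≤ t)
    {ω : ℕ → ℝ × X} (hω : IsGood t ω) :
    jumpSum α ω t * responseMartingale r g ω t
      = predictableIntegral (fun s x y => α s x y * g.toFun s x y) (fun _ _ => 1) t ω
        + predictableIntegral α (fun ω u => responseMartingale r g ω u) t ω
        + (predictableIntegral g.toFun (fun ω u => jumpSum α ω u) t ω
          - ∫ u in (0 : ℝ)..t,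
            onState (contraction r g.toFun u) (stateAt ω u) * jumpSum α ω u) := by
  obtain ⟨M, hM⟩ := g.bounded
  have hγ := hω.intervalIntegrable_contraction r g.measurable hM
  obtain ⟨hω, n, hn⟩ := hω
  set γ : ℝ → ℝ := fun w => onState (contraction r g.toFun w) (stateAt ω w) with hγdef
  set a : ℕ → ℝ := fun k => α (ω (k + 1)).1 (ω k).2 (ω (k + 1)).2 with ha
  set b : ℕ → ℝ := fun k => g.toFun (ω (k + 1)).1 (ω k).2 (ω (k + 1)).2 with hb
  have hle : ∀ k ∈ Finset.range n, (ω (k + 1)).1 ≤ t := fun k hk =>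
    (hω.jump_le_iff hn k).2 (Finset.mem_range.1 hk)
  -- Each jump of `α` stays in the sum from its own time up to `t`, so exchanging sum and integral
  -- leaves the integral of `γ` over that remaining interval.
  have key : ∫ u in (0 : ℝ)..t, γ u * jumpSum α ω u
      = ∑ k ∈ Finset.range n, a k * ∫ w in (ω (k + 1)).1..t, γ w := by
    have e : ∫ u in (0 : ℝ)..t, γ u * jumpSum α ω u
        = ∫ u in (0 : ℝ)..t, ∑ k ∈ Finset.range n,
          γ u * (Ici (ω (k + 1)).1).indicator (fun _ => a k) u := by
      refine intervalIntegral.integral_congr fun u hu => ?_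
      rw [uIcc_of_le ht] at hu
      rw [hω.jumpSum_eq_sum_indicator α hn hu.2, Finset.mul_sum]
    rw [e, intervalIntegral.integral_finsetSum fun k hk =>
      (intervalIntegral_mul_indicator_Ici (a k) (hω.nonneg _) (hle k hk) hγ).1]
    exact Finset.sum_congr rfl fun k hk =>
      (intervalIntegral_mul_indicator_Ici (a k) (hω.nonneg _) (hle k hk) hγ).2
  have split : ∀ k ∈ Finset.range n, ∫ w in (ω (k + 1)).1..t, γ w
      = (∫ w in (0 : ℝ)..t, γ w) - ∫ w in (0 : ℝ)..(ω (k + 1)).1, γ w := fun k hk => by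
    refine (intervalIntegral.integral_interval_sub_left hγ (hγ.mono_set ?_)).symm
    rw [uIcc_of_le ht, uIcc_of_le (hω.nonneg _)]
    exact Icc_subset_Icc_right (hle k hk)
  have key2 : ∑ k ∈ Finset.range n, a k * ∫ w in (ω (k + 1)).1..t, γ w
      = (∑ k ∈ Finset.range n, a k) * (∫ w in (0 : ℝ)..t, γ w)
        - ∑ k ∈ Finset.range n, a k * ∫ w in (0 : ℝ)..(ω (k + 1)).1, γ w := by
    rw [Finset.sum_mul, ← Finset.sum_sub_distrib]
    exact Finset.sum_congr rfl fun k hk => by rw [split k hk, mul_sub]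
  rw [hω.predictableIntegral_eq _ _ hn, hω.predictableIntegral_eq _ _ hn,
    hω.predictableIntegral_eq _ _ hn, key, key2, hω.jumpSum_eq α hn, responseMartingale,
    hω.jumpSum_eq g.toFun hn]
  have t1 : ∀ k, predictableTerm (fun s x y => α s x y * g.toFun s x y) (fun _ _ => 1) ω k
      = a k * b k := fun k => mul_one _
  have t2 : ∀ k, predictableTerm α (fun ω u => responseMartingale r g ω u) ω k
      = a k * ∑ j ∈ Finset.range k, b j - a k * ∫ w in (0 : ℝ)..(ω (k + 1)).1, γ w := fun k => by
    rw [predictableTerm, hω.responseMartingale_freeze r g k, mul_sub]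
  have t3 : ∀ k, predictableTerm g.toFun (fun ω u => jumpSum α ω u) ω k
      = b k * ∑ j ∈ Finset.range k, a j := fun k => by
    rw [predictableTerm, hω.jumpSum_freeze α k]
  simp only [t1, t2, t3, Finset.sum_sub_distrib]
  rw [mul_sub, sum_range_mul_sum_range a b n]
  ring

variable (ν : Measure X)

lemma lintegral_predictableSum_lt_top {t : ℝ}
    (hgood : ∀ᵐ ω ∂(unperturbedLaw r ν), IsGood t ω) {β : ℝ → X → X → ℝ}
    {H : (ℕ → ℝ × X) → ℝ → ℝ} {W : (ℕ → ℝ × X) → ℝ} (hW : Integrable W (unperturbedLaw r ν))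
    (hle : ∀ n ω, IsRegular ω → ω ∈ jumpCountSet t n →
      ∑ k ∈ Finset.range n, |predictableTerm β H ω k| ≤ W ω) :
    ∫⁻ ω, predictableSum (fun z => ‖z‖ₑ) β H t ω ∂(unperturbedLaw r ν) < ∞ := by
  refine (lintegral_mono_ae ?_).trans_lt hW.2
  filter_upwards [hgood] with ω ⟨hω, n, hn⟩
  rw [hω.predictableSum_eq _ β H hn]
  refine le_trans (le_of_eq ?_) ((ENNReal.ofReal_le_ofReal (hle n ω hω hn)).trans
    (Real.ofReal_le_enorm _))
  rw [ENNReal.ofReal_sum_of_nonneg fun _ _ => abs_nonneg _]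
  exact Finset.sum_congr rfl fun k _ => by rw [← ofReal_norm]; rfl

/-- The explicit form of the linear response of a jump sum. -/
lemma integral_jumpSum_mul_responseMartingale [IsProbabilityMeasure ν] {t : ℝ} (ht : 0 ≤ t)
    (hgood : ∀ᵐ ω ∂(unperturbedLaw r ν), IsGood t ω) {α : ℝ → X → X → ℝ}
    (hα : Measurable (fun q : ℝ × X × X => α q.1 q.2.1 q.2.2)) {ε : ℝ} (hε : 0 < ε)
    (hint : Integrable (fun ω => jumpSum (fun s x y => |α s x y|) ω t
      * Real.exp (ε * activity r g t ω)) (unperturbedLaw r ν)) :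
    Integrable (fun z : (ℕ → ℝ × X) × ℝ =>
      onState (contraction r (fun s x y => α s x y * g.toFun s x y) z.2) (stateAt z.1 z.2))
      ((unperturbedLaw r ν).prod (volume.restrict (Ioc 0 t))) ∧
    Integrable (fun z : (ℕ → ℝ × X) × ℝ =>
      onState (contraction r α z.2) (stateAt z.1 z.2) * responseMartingale r g z.1 z.2)
      ((unperturbedLaw r ν).prod (volume.restrict (Ioc 0 t))) ∧
    ∫ ω, jumpSum α ω t * responseMartingale r g ω t ∂(unperturbedLaw r ν)
      = ∫ z, onState (contraction r (fun s x y => α s x y * g.toFun s x y) z.2)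
          (stateAt z.1 z.2) ∂((unperturbedLaw r ν).prod (volume.restrict (Ioc 0 t)))
        + ∫ z, onState (contraction r α z.2) (stateAt z.1 z.2) * responseMartingale r g z.1 z.2
          ∂((unperturbedLaw r ν).prod (volume.restrict (Ioc 0 t))) := by
  have : IsProbabilityMeasure (unperturbedLaw r ν) := by rw [unperturbedLaw]; infer_instance
  obtain ⟨M, hM⟩ := g.bounded
  have hY := fun ω => activity_nonneg r g ht ω
  have hexp1 : ∀ ω, 1 ≤ Real.exp (ε * activity r g t ω) := fun ω =>
    Real.one_le_exp (mul_nonneg hε.le (hY ω))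
  have hexp2 : ∀ ω, activity r g t ω ≤ 1 / ε * Real.exp (ε * activity r g t ω) := fun ω => by
    rw [div_mul_eq_mul_div, one_mul, le_div_iff₀ hε]
    linarith [Real.add_one_le_exp (ε * activity r g t ω)]
  have hA : ∀ ω : ℕ → ℝ × X, 0 ≤ jumpSum (fun s x y => |α s x y|) ω t := fun ω =>
    jumpSum_nonneg (fun _ _ _ => abs_nonneg _) ω t
  have hmαg : Measurable (fun q : ℝ × X × X => α q.1 q.2.1 q.2.2 * g.toFun q.1 q.2.1 q.2.2) :=
    hα.mul g.measurable
  have hmono : ∀ (n k : ℕ) (c : ℕ → ℝ), k ∈ Finset.range n →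
      |∑ j ∈ Finset.range k, c j| ≤ ∑ j ∈ Finset.range n, |c j| := fun n k c hk =>
    (Finset.abs_sum_le_sum_abs _ _).trans (Finset.sum_le_sum_of_subset_of_nonneg
      (Finset.range_mono (Finset.mem_range.1 hk).le) fun _ _ _ => abs_nonneg _)
  -- The diagonal term: simultaneous jumps of the two factors.
  have I1 := integral_predictableSum r ν hgood (t := t)
    (β := fun s x y => α s x y * g.toFun s x y) hmαg (H := fun _ _ => 1) measurable_const
    (fun u _ _ _ _ _ _ _ _ _ => rfl)
    (lintegral_predictableSum_lt_top r ν hgood (hint.const_mul |M|) fun n ω hω hn => by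
      calc ∑ k ∈ Finset.range n, |predictableTerm (fun s x y => α s x y * g.toFun s x y)
            (fun _ _ => 1) ω k|
          ≤ ∑ k ∈ Finset.range n, |M| * |α (ω (k + 1)).1 (ω k).2 (ω (k + 1)).2| := by
            refine Finset.sum_le_sum fun k _ => ?_
            rw [predictableTerm, mul_one, abs_mul, mul_comm]
            exact mul_le_mul_of_nonneg_right ((hM _ _ _).trans (le_abs_self M)) (abs_nonneg _)
        _ = |M| * (jumpSum (fun s x y => |α s x y|) ω t * 1) := by
            rw [← Finset.mul_sum, hω.jumpSum_eq _ hn, mul_one]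
        _ ≤ _ := by
            have := hexp1 ω
            have := hA ω
            gcongr)
  -- The term in which the martingale is evaluated just before the jumps of `α`; there it is bounded
  -- by the activity.
  have I2 := integral_predictableSum r ν hgood (t := t) hα
    (H := fun ω u => responseMartingale r g ω u) (measurable_responseMartingale r g)
    (fun u hu => isLocal_responseMartingale r g hu)
    (lintegral_predictableSum_lt_top r ν hgood (hint.const_mul (1 / ε)) fun n ω hω hn => by
      have hG : ∀ k ∈ Finset.range n,
          |responseMartingale r g (freeze k (ω (k + 1)).1 ω) (ω (k + 1)).1|
            ≤ activity r g t ω := fun k hk => by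
        rw [hω.responseMartingale_freeze r g k]
        refine (abs_sub _ _).trans (add_le_add ?_ ?_)
        · rw [hω.jumpSum_eq g.abs.toFun hn]
          exact hmono n k _ hk
        · obtain ⟨M', hM'⟩ := g.abs.bounded
          exact IsGood.abs_integral_contraction_le ⟨hω, n, hn⟩ r g.abs.measurable hM'
            (fun _ _ _ => le_rfl) (hω.nonneg _) ((hω.jump_le_iff hn k).2 (Finset.mem_range.1 hk))
      calc ∑ k ∈ Finset.range n, |predictableTerm α (fun ω u => responseMartingale r g ω u) ω k|
          ≤ ∑ k ∈ Finset.range n, |α (ω (k + 1)).1 (ω k).2 (ω (k + 1)).2| * activity r g t ω := by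
            refine Finset.sum_le_sum fun k hk => ?_
            rw [predictableTerm, abs_mul]
            exact mul_le_mul_of_nonneg_left (hG k hk) (abs_nonneg _)
        _ = jumpSum (fun s x y => |α s x y|) ω t * activity r g t ω := by
            rw [← Finset.sum_mul, hω.jumpSum_eq _ hn]
        _ ≤ _ := by
            have := mul_le_mul_of_nonneg_left (hexp2 ω) (hA ω)
            linarith)
  -- The jump sum of `α` integrated against the martingale: the jump part and the compensating
  -- integral have the same mean, so this term drops out at the end.
  have I3 := integral_predictableSum r ν hgood (t := t) g.measurable
    (H := fun ω u => jumpSum α ω u) (measurable_jumpSum hα)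
    (fun u _ => isLocal_jumpSum α u)
    (lintegral_predictableSum_lt_top r ν hgood (hint.const_mul (1 / ε)) fun n ω hω hn => by
      calc ∑ k ∈ Finset.range n, |predictableTerm g.toFun (fun ω u => jumpSum α ω u) ω k|
          ≤ ∑ k ∈ Finset.range n, |g.toFun (ω (k + 1)).1 (ω k).2 (ω (k + 1)).2|
              * jumpSum (fun s x y => |α s x y|) ω t := by
            refine Finset.sum_le_sum fun k hk => ?_
            rw [predictableTerm, abs_mul, hω.jumpSum_freeze α k, hω.jumpSum_eq _ hn]
            exact mul_le_mul_of_nonneg_left (hmono n k _ hk) (abs_nonneg _)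
        _ = jumpSum g.abs.toFun ω t * jumpSum (fun s x y => |α s x y|) ω t := by
            rw [← Finset.sum_mul, hω.jumpSum_eq g.abs.toFun hn]
            rfl
        _ ≤ activity r g t ω * jumpSum (fun s x y => |α s x y|) ω t :=
            mul_le_mul_of_nonneg_right (le_add_of_nonneg_right (compensator_nonneg r g ht ω)) (hA ω)
        _ ≤ _ := by
            have := mul_le_mul_of_nonneg_left (hexp2 ω) (hA ω)
            linarith)
  have hprod3 := integral_prod _ I3.1
  have hint3 : Integrable (fun ω => ∫ u in Ioc 0 t,
    onState (contraction r g.toFun u) (stateAt ω u) * jumpSum α ω u) (unperturbedLaw r ν) :=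
    I3.1.integral_prod_left
  simp only [mul_one] at I1
  refine ⟨I1.1, I2.1, ?_⟩
  rw [← I1.2.2, ← I2.2.2]
  have e : ∫ ω, jumpSum α ω t * responseMartingale r g ω t ∂(unperturbedLaw r ν)
      = ∫ ω, (predictableIntegral (fun s x y => α s x y * g.toFun s x y) (fun _ _ => 1) t ω
        + predictableIntegral α (fun ω u => responseMartingale r g ω u) t ω
        + (predictableIntegral g.toFun (fun ω u => jumpSum α ω u) t ω
          - ∫ u in Ioc 0 t, onState (contraction r g.toFun u) (stateAt ω u) * jumpSum α ω u))
        ∂(unperturbedLaw r ν) := by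
    refine integral_congr_ae ?_
    filter_upwards [hgood] with ω hω
    rw [hω.jumpSum_mul_responseMartingale r g α ht, intervalIntegral.integral_of_le ht]
  have h12 : Integrable (fun ω =>
      predictableIntegral (fun s x y => α s x y * g.toFun s x y) (fun _ _ => 1) t ω
      + predictableIntegral α (fun ω u => responseMartingale r g ω u) t ω) (unperturbedLaw r ν) :=
    I1.2.1.add I2.2.1
  have h3 : Integrable (fun ω => predictableIntegral g.toFun (fun ω u => jumpSum α ω u) t ω
      - ∫ u in Ioc 0 t, onState (contraction r g.toFun u) (stateAt ω u) * jumpSum α ω u)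
      (unperturbedLaw r ν) := I3.2.1.sub hint3
  rw [e, integral_add h12 h3, integral_add I1.2.1 I2.2.1,
    integral_sub I3.2.1 hint3, I3.2.2, hprod3, sub_self, add_zero]

end IntegrationByParts

/-! ### Hölder's inequality against exponentials of the activity. -/

section Moments

variable {X : Type*} [MeasurableSpace X] (r : TransitionKernel X) (g : Perturbation X)
  (ν : Measure X)

/-- The exponential of a small multiple of the activity is in any space `L^q` with `q < ∞`. -/
lemma exists_memLp_exp_activity {t ε : ℝ} (hε : 0 < ε)
    (h : ∫⁻ ω, ENNReal.ofReal (Real.exp (ε * activity r g t ω)) ∂(unperturbedLaw r ν) < ∞)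
    {p : ℝ≥0∞} (hp : 1 < p) :
    ∃ q : ℝ≥0∞, ENNReal.HolderConjugate p q ∧ ∃ δ : ℝ, 0 < δ ∧
      MemLp (fun ω => Real.exp (δ * activity r g t ω)) q (unperturbedLaw r ν) := by
  have hpq := ENNReal.HolderConjugate.conjExponent hp.le
  set q := p.conjExponent with hq
  have hq1 : 1 ≤ q := ENNReal.HolderConjugate.one_le q p
  -- Strict inequality `1 < p` makes the conjugate exponent finite, so that `δ = ε / q` is positive;
  -- the `q`-th power of `exp (δ Y)` is then `exp (ε Y)`.
  have hqt : q ≠ ∞ := fun h => hp.ne' ((ENNReal.HolderConjugate.eq_top_iff_eq_one q p).1 h)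
  have hq0 : q ≠ 0 := (zero_lt_one.trans_le hq1).ne'
  have hqr : 0 < q.toReal := ENNReal.toReal_pos hq0 hqt
  refine ⟨q, hpq, ε / q.toReal, div_pos hε hqr,
    ((measurable_activity r g t).const_mul _).exp.aestronglyMeasurable, ?_⟩
  rw [eLpNorm_lt_top_iff_lintegral_rpow_enorm_lt_top hq0 hqt]
  refine lt_of_eq_of_lt (lintegral_congr fun ω => ?_) h
  rw [Real.enorm_eq_ofReal (Real.exp_pos _).le, ENNReal.ofReal_rpow_of_pos (Real.exp_pos _),
    ← Real.exp_mul]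
  congr 2
  field_simp

/-- Functionals with a moment of order `p > 1` are integrable against the exponential of a small
multiple of the activity. -/
lemma exists_integrable_mul_exp_activity {t ε : ℝ} (hε : 0 < ε)
    (h : ∫⁻ ω, ENNReal.ofReal (Real.exp (ε * activity r g t ω)) ∂(unperturbedLaw r ν) < ∞)
    {p : ℝ≥0∞} (hp : 1 < p) {F : (ℕ → ℝ × X) → ℝ} (hF : MemLp F p (unperturbedLaw r ν)) :
    ∃ δ : ℝ, 0 < δ ∧ Integrable (fun ω => F ω * Real.exp (δ * activity r g t ω))
      (unperturbedLaw r ν) := by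
  obtain ⟨q, hpq, δ, hδ, hW⟩ := exists_memLp_exp_activity r g ν hε h hp
  exact ⟨δ, hδ, hF.integrable_mul hW⟩

end Moments

/-! ### Linear response of time-integrated observables. -/

section TimeIntegrals

lemma enorm_onState {X : Type*} (f : X → ℝ) (o : Option X) :
    ‖onState f o‖ₑ = onState (fun x => ‖f x‖ₑ) o := by
  cases o with
  | none => simp [onState]
  | some x => rfl

variable {X : Type*} [MeasurableSpace X] (r : TransitionKernel X) (g : Perturbation X)
  (ν : Measure X) [IsProbabilityMeasure ν] {M : ℝ}

/-- A time integrated observable with integrable `L^p` norms, times an exponential of the activity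
which is in the conjugate space, is integrable on the product space. -/
lemma integrable_prod_onState_mul_exp_activity {t δ : ℝ} {p q : ℝ≥0∞}
    (hpq : ENNReal.HolderConjugate p q)
    (hW : MemLp (fun ω => Real.exp (δ * activity r g t ω)) q (unperturbedLaw r ν))
    {v : ℝ → X → ℝ} (hv : Measurable (Function.uncurry v))
    (hLp : ∫⁻ s in Ioc 0 t, eLpNorm (fun ω => onState (v s) (stateAt ω s)) p
      (unperturbedLaw r ν) < ∞) :
    Integrable (fun z : (ℕ → ℝ × X) × ℝ =>
      onState (v z.2) (stateAt z.1 z.2) * Real.exp (δ * activity r g t z.1))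
      ((unperturbedLaw r ν).prod (volume.restrict (Ioc 0 t))) := by
  have hP : IsProbabilityMeasure (unperturbedLaw r ν) := by rw [unperturbedLaw]; infer_instance
  have hmV := measurable_onState_stateAt hv
  have hm : Measurable fun z : (ℕ → ℝ × X) × ℝ =>
      onState (v z.2) (stateAt z.1 z.2) * Real.exp (δ * activity r g t z.1) :=
    hmV.mul (((measurable_activity r g t).comp measurable_fst).const_mul δ).exp
  refine ⟨hm.aestronglyMeasurable, ?_⟩
  rw [HasFiniteIntegral, lintegral_prod_symm' _ hm.enorm]
  have hle : ∀ s, ∫⁻ ω, ‖onState (v s) (stateAt ω s) * Real.exp (δ * activity r g t ω)‖ₑ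
      ∂(unperturbedLaw r ν) ≤ eLpNorm (fun ω => onState (v s) (stateAt ω s)) p
        (unperturbedLaw r ν)
        * eLpNorm (fun ω => Real.exp (δ * activity r g t ω)) q (unperturbedLaw r ν) := fun s => by
    have hms : Measurable fun ω => onState (v s) (stateAt ω s) :=
      hmV.comp (measurable_prodMk_right (y := s))
    have h := eLpNorm_smul_le_mul_eLpNorm (p := p) (q := q) (r := 1) hW.1 hms.aestronglyMeasurable
    rw [eLpNorm_one_eq_lintegral_enorm] at h
    exact h
  refine (lintegral_mono hle).trans_lt ?_
  rw [lintegral_mul_const' _ _ hW.2.ne]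
  exact ENNReal.mul_lt_top hLp hW.2

/-- The linear response of a time integrated observable. -/
lemma hasDerivAt_integral_intervalIntegral (hM0 : 0 ≤ M) (hM : ∀ s x y, |g.toFun s x y| ≤ M)
    {t : ℝ} (ht : 0 ≤ t)
    (hgood : ∀ᵐ ω ∂(unperturbedLaw r ν), IsGood t ω)
    (hgoodl : ∀ᶠ l in 𝓝 (0 : ℝ), ∀ᵐ ω ∂(perturbedLaw r g l ν), IsGood t ω)
    {δ : ℝ} (hδ : 0 < δ) {v : ℝ → X → ℝ} (hv : Measurable (Function.uncurry v))
    (hprod : Integrable (fun z : (ℕ → ℝ × X) × ℝ =>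
      onState (v z.2) (stateAt z.1 z.2) * Real.exp (δ * activity r g t z.1))
      ((unperturbedLaw r ν).prod (volume.restrict (Ioc 0 t)))) :
    (∀ᵐ s ∂(volume.restrict (Ioc 0 t)), Integrable
      (fun ω => onState (v s) (stateAt ω s) * responseMartingale r g ω s)
      (unperturbedLaw r ν)) ∧
    IntervalIntegrable (fun s => ∫ ω, onState (v s) (stateAt ω s) * responseMartingale r g ω s
      ∂(unperturbedLaw r ν)) volume 0 t ∧
    (∀ᶠ l in 𝓝 (0 : ℝ),
      (∀ᵐ ω ∂(perturbedLaw r g l ν), IntervalIntegrable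
        (fun s => onState (v s) (stateAt ω s)) volume 0 t) ∧
      Integrable (fun ω => ∫ s in (0 : ℝ)..t, onState (v s) (stateAt ω s))
        (perturbedLaw r g l ν)) ∧
    HasDerivAt (fun l : ℝ => ∫ ω, (∫ s in (0 : ℝ)..t, onState (v s) (stateAt ω s))
        ∂(perturbedLaw r g l ν))
      (∫ s in (0 : ℝ)..t, (∫ ω, onState (v s) (stateAt ω s) * responseMartingale r g ω s
        ∂(unperturbedLaw r ν))) 0 := by
  have : IsProbabilityMeasure (unperturbedLaw r ν) := by rw [unperturbedLaw]; infer_instance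
  have hmV := measurable_onState_stateAt hv
  have hmVs : ∀ s, Measurable fun ω : ℕ → ℝ × X => onState (v s) (stateAt ω s) := fun s =>
    hmV.comp measurable_prodMk_right
  have hmG : Measurable fun ω : ℕ → ℝ × X => responseMartingale r g ω t :=
    (measurable_responseMartingale r g).comp measurable_prodMk_right
  set F : (ℕ → ℝ × X) → ℝ := fun ω => ∫ s in (0 : ℝ)..t, onState (v s) (stateAt ω s) with hF
  have hmF : Measurable F := (measurable_integral_onState hv).comp measurable_prodMk_right
  have hFloc : IsLocal t F := isLocal_integral_stateAt v id ht
  have hFW : Integrable (fun ω => F ω * Real.exp (δ * activity r g t ω)) (unperturbedLaw r ν) := by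
    have h := hprod.integral_prod_left
    simp only [integral_mul_const] at h
    simpa only [hF, intervalIntegral.integral_of_le ht] using h
  have hU := hasDerivAt_integral_perturbedLaw r g ν hM0 hM hgood hgoodl hδ ht le_rfl hmF hFloc hFW
  -- The martingale property without conditional expectations: `v(s, X_s)` is local at `s` and also
  -- at `t`, so the response formula gives its derivative with `G_s` and with `G_t`, and derivatives
  -- are unique.
  have hsec : ∀ᵐ s ∂(volume.restrict (Ioc 0 t)),
      Integrable (fun ω => onState (v s) (stateAt ω s) * responseMartingale r g ω s)
        (unperturbedLaw r ν) ∧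
      ∫ ω, onState (v s) (stateAt ω s) * responseMartingale r g ω s ∂(unperturbedLaw r ν)
        = ∫ ω, onState (v s) (stateAt ω s) * responseMartingale r g ω t
          ∂(unperturbedLaw r ν) := by
    filter_upwards [hprod.prod_left_ae, ae_restrict_mem measurableSet_Ioc] with s hs hst
    have hloc : IsLocal s fun ω : ℕ → ℝ × X => onState (v s) (stateAt ω s) :=
      (isLocal_stateAt s).comp _
    have h1 := hasDerivAt_integral_perturbedLaw r g ν hM0 hM hgood hgoodl hδ hst.1.le hst.2
      (hmVs s) hloc hs
    have h2 := hasDerivAt_integral_perturbedLaw r g ν hM0 hM hgood hgoodl hδ ht le_rfl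
      (hmVs s) (hloc.mono hst.1.le hst.2) hs
    exact ⟨h1.1, h1.2.2.unique h2.2.2⟩
  have hprodG : Integrable (fun z : (ℕ → ℝ × X) × ℝ =>
      onState (v z.2) (stateAt z.1 z.2) * responseMartingale r g z.1 t)
      ((unperturbedLaw r ν).prod (volume.restrict (Ioc 0 t))) := by
    refine (hprod.abs.const_mul (1 / δ)).mono' (hmV.mul (hmG.comp measurable_fst)).aestronglyMeasurable
      ?_
    filter_upwards [Measure.quasiMeasurePreserving_fst.ae hgood] with z hz
    rw [Real.norm_eq_abs, abs_mul, abs_mul, Real.abs_exp, mul_left_comm]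
    refine mul_le_mul_of_nonneg_left ((hz.abs_responseMartingale_le r g ht le_rfl).trans ?_)
      (abs_nonneg _)
    rw [div_mul_eq_mul_div, one_mul, le_div_iff₀ hδ]
    linarith [Real.add_one_le_exp (δ * activity r g t z.1)]
  have hvalue : ∫ ω, F ω * responseMartingale r g ω t ∂(unperturbedLaw r ν)
      = ∫ s in (0 : ℝ)..t, (∫ ω, onState (v s) (stateAt ω s) * responseMartingale r g ω s
        ∂(unperturbedLaw r ν)) := by
    rw [intervalIntegral.integral_of_le ht,
      integral_congr_ae (hsec.mono fun s hs => hs.2), ← integral_integral_swap hprodG]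
    simp only [integral_mul_const, hF, intervalIntegral.integral_of_le ht]
  refine ⟨hsec.mono fun s hs => hs.1, ?_, ?_, hvalue ▸ hU.2.2⟩
  · rw [intervalIntegrable_iff_integrableOn_Ioc_of_le ht]
    exact hprodG.integral_prod_right.congr (hsec.mono fun s hs => hs.2.symm)
  · have hsmall : ∀ᶠ l in 𝓝 (0 : ℝ), |l| ≤ 1 ∧ |l| * Real.exp M ≤ δ := by
      have h1 : Tendsto (fun l : ℝ => |l|) (𝓝 0) (𝓝 0) := by
        simpa using (continuous_abs.tendsto (0 : ℝ))
      have h2 : Tendsto (fun l : ℝ => |l| * Real.exp M) (𝓝 0) (𝓝 0) := by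
        simpa using h1.mul_const (Real.exp M)
      filter_upwards [h1.eventually (ge_mem_nhds one_pos),
        h2.eventually (ge_mem_nhds hδ)] with l a b using ⟨a, b⟩
    filter_upwards [hU.2.1, hgoodl, hsmall] with l hl1 hl2 ⟨hl3, hl4⟩
    refine ⟨?_, hl1⟩
    have hmE : Measurable fun ω : ℕ → ℝ × X =>
        ∫⁻ s in Ioc 0 t, onState (fun x => ‖v s x‖ₑ) (stateAt ω s) :=
      Measurable.lintegral_prod_right'
        (f := fun z : (ℕ → ℝ × X) × ℝ => onState (fun x => ‖v z.2 x‖ₑ) (stateAt z.1 z.2))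
        (measurable_onState_stateAt (f := fun s x => ‖v s x‖ₑ) hv.enorm)
    -- Pathwise integrability under the perturbed law comes from the change of measure applied to
    -- the nonnegative local functional `∫ ‖v‖`.
    have hfin : ∫⁻ ω, (∫⁻ s in Ioc 0 t, onState (fun x => ‖v s x‖ₑ) (stateAt ω s))
        ∂(perturbedLaw r g l ν) < ∞ := by
      rw [lintegral_perturbedLaw r g ν hgood hl2 hmE (isLocal_lintegral_stateAt _ t)]
      have hlt := hprod.2
      rw [HasFiniteIntegral, lintegral_prod _ hprod.1.enorm] at hlt
      refine (lintegral_mono_ae ?_).trans_lt hlt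
      filter_upwards [hgood] with ω hω
      rw [← lintegral_mul_const' _ _ ENNReal.ofReal_ne_top]
      refine lintegral_mono fun s => ?_
      simp only
      rw [enorm_mul, enorm_onState, Real.enorm_eq_ofReal (Real.exp_pos _).le]
      gcongr
      refine (le_abs_self _).trans ((hω.abs_pathLogDensity_le r g hM0 hM ht le_rfl hl3).trans ?_)
      exact mul_le_mul_of_nonneg_right hl4 (activity_nonneg r g ht ω)
    filter_upwards [ae_lt_top hmE hfin.ne] with ω hω
    rw [intervalIntegrable_iff_integrableOn_Ioc_of_le ht]
    refine ⟨(hmV.comp measurable_prodMk_left).aestronglyMeasurable, ?_⟩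
    rw [HasFiniteIntegral]
    simpa only [enorm_onState] using hω

end TimeIntegrals

end MarkovJump

end

/-! ### Assembly of the linear response theorem. -/

theorem mainTheorem2 {X : Type*} [MeasurableSpace X] [MeasurableSingletonClass X]
    (r : TransitionKernel X) (ν : Measure X) [IsProbabilityMeasure ν]
    (hne : ∀ᵐ ω ∂(unperturbedLaw r ν), explosionTime ω = ∞)
    (g : Perturbation X) (t : ℝ) (ht : 0 ≤ t)
    (hC : ExpMomentCondition r ν t g.toFun) :
    -- for small `l` the perturbed process does not explode in `[0, t]`
    (∀ᶠ l in 𝓝 (0 : ℝ), ∀ᵐ ω ∂(perturbedLaw r g l ν),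
      ENNReal.ofReal t < explosionTime ω) ∧
    -- (1) observables at time `t`
    (∀ (v : X → ℝ) (p : ℝ≥0∞), Measurable v → 1 < p →
      MemLp (fun ω => onState v (stateAt ω t)) p
        (unperturbedLaw r ν) →
      Integrable (fun ω => onState v (stateAt ω t) *
        responseMartingale r g ω t) (unperturbedLaw r ν) ∧
      (∀ᶠ l in 𝓝 (0 : ℝ), Integrable
        (fun ω => onState v (stateAt ω t))
        (perturbedLaw r g l ν)) ∧
      HasDerivAt
        (fun l : ℝ => ∫ ω, onState v (stateAt ω t)
          ∂(perturbedLaw r g l ν))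
        (∫ ω, onState v (stateAt ω t) *
          responseMartingale r g ω t ∂(unperturbedLaw r ν))
        0) ∧
    -- (2) time-integrated observables
    (∀ (v : ℝ → X → ℝ) (p : ℝ≥0∞), Measurable (Function.uncurry v) → 1 < p →
      ∫⁻ s in Ioc 0 t, eLpNorm (fun ω => onState (v s) (stateAt ω s)) p
        (unperturbedLaw r ν) < ∞ →
      (∀ᵐ s ∂(volume.restrict (Ioc 0 t)), Integrable
        (fun ω => onState (v s) (stateAt ω s) *
          responseMartingale r g ω s) (unperturbedLaw r ν)) ∧
      IntervalIntegrable
        (fun s => ∫ ω, onState (v s) (stateAt ω s) *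
          responseMartingale r g ω s ∂(unperturbedLaw r ν)) volume 0 t ∧
      (∀ᶠ l in 𝓝 (0 : ℝ),
        (∀ᵐ ω ∂(perturbedLaw r g l ν), IntervalIntegrable
          (fun s => onState (v s) (stateAt ω s)) volume 0 t) ∧
        Integrable
          (fun ω => ∫ s in (0 : ℝ)..t, onState (v s) (stateAt ω s))
          (perturbedLaw r g l ν)) ∧
      HasDerivAt
        (fun l : ℝ => ∫ ω, (∫ s in (0 : ℝ)..t,
          onState (v s) (stateAt ω s)) ∂(perturbedLaw r g l ν))
        (∫ s in (0 : ℝ)..t, (∫ ω, onState (v s) (stateAt ω s) *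
          responseMartingale r g ω s ∂(unperturbedLaw r ν)))
        0) ∧
    -- (3) functionals that are additive over the jumps
    (∀ (α : ℝ → X → X → ℝ) (p : ℝ≥0∞),
      Measurable (fun q : ℝ × X × X => α q.1 q.2.1 q.2.2) →
      IsIntegrableJumpFunction r ν t α → 1 < p →
      MemLp (fun ω => jumpSum α ω t) p (unperturbedLaw r ν) →
      -- differentiability under the `L^p` bound on the functional itself
      (Integrable (fun ω => jumpSum α ω t * responseMartingale r g ω t)
        (unperturbedLaw r ν) ∧
      (∀ᶠ l in 𝓝 (0 : ℝ), Integrable (fun ω => jumpSum α ω t)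
        (perturbedLaw r g l ν)) ∧
      HasDerivAt
        (fun l : ℝ => ∫ ω, jumpSum α ω t ∂(perturbedLaw r g l ν))
        (∫ ω, jumpSum α ω t * responseMartingale r g ω t
          ∂(unperturbedLaw r ν))
        0) ∧
      -- the explicit formula, when the sum of `|α|` over the jumps has a moment of order `> 1`
      (∀ q : ℝ≥0∞, 1 < q →
        MemLp (fun ω => jumpSum (fun s x y => |α s x y|) ω t) q
          (unperturbedLaw r ν) →
        (∀ᵐ s ∂(volume.restrict (Ioc 0 t)),
          Integrable (fun ω => onState
            (contraction r (fun s x y => α s x y * g.toFun s x y) s)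
            (stateAt ω s)) (unperturbedLaw r ν) ∧
          Integrable (fun ω => onState (contraction r α s)
            (stateAt ω s) * responseMartingale r g ω s)
            (unperturbedLaw r ν)) ∧
        IntervalIntegrable (fun s => ∫ ω, onState
          (contraction r (fun s x y => α s x y * g.toFun s x y) s)
          (stateAt ω s) ∂(unperturbedLaw r ν)) volume 0 t ∧
        IntervalIntegrable (fun s => ∫ ω, onState (contraction r α s)
          (stateAt ω s) * responseMartingale r g ω s
          ∂(unperturbedLaw r ν)) volume 0 t ∧
        HasDerivAt
          (fun l : ℝ => ∫ ω, jumpSum α ω t ∂(perturbedLaw r g l ν))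
          ((∫ s in (0 : ℝ)..t, (∫ ω, onState
              (contraction r (fun s x y => α s x y * g.toFun s x y) s)
              (stateAt ω s) ∂(unperturbedLaw r ν))) +
            ∫ s in (0 : ℝ)..t, (∫ ω, onState (contraction r α s)
              (stateAt ω s) * responseMartingale r g ω s
              ∂(unperturbedLaw r ν)))
          0)) := by
  obtain ⟨M, hM'⟩ := g.bounded
  have hM0 : 0 ≤ max M 0 := le_max_right _ _
  have hM : ∀ s x y, |g.toFun s x y| ≤ max M 0 := fun s x y => (hM' s x y).trans (le_max_left _ _)
  have hP : IsProbabilityMeasure (unperturbedLaw r ν) := by rw [unperturbedLaw]; infer_instance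
  have hgood := ae_isGood r ν hne ht
  obtain ⟨θ, hθ0, hθ⟩ := exists_exp_compensator r g ν ht hgood hC
  obtain ⟨ε, hε, hexp⟩ := exists_exp_activity r g ν hM ht hgood hθ0 hθ
  have hgoodl : ∀ᶠ l in 𝓝 (0 : ℝ), ∀ᵐ ω ∂(perturbedLaw r g l ν), IsGood t ω := by
    have hcont : Continuous fun l : ℝ => 8 * |l| * Real.exp (4 * |l| * max M 0) := by fun_prop
    filter_upwards [(hcont.tendsto 0).eventually (ge_mem_nhds (by simpa using hθ0))] with l hl
    exact ae_isGood_perturbedLaw r g ν hM hne ht hθ hl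
  refine ⟨?_, ?_, ?_, ?_⟩
  · filter_upwards [hgoodl] with l hl
    filter_upwards [hl] with ω ⟨_, n, hn⟩
    exact lt_explosionTime_of_mem ht hn
  · intro v p hv hp hLp
    obtain ⟨δ, hδ, hint⟩ := exists_integrable_mul_exp_activity r g ν hε hexp hp hLp
    exact hasDerivAt_integral_perturbedLaw r g ν hM0 hM hgood hgoodl hδ ht le_rfl
      ((measurable_onState_stateAt (f := fun _ => v) (hv.comp measurable_snd)).comp
        (measurable_prodMk_right (y := t)))
      ((isLocal_stateAt t).comp (onState v)) hint
  · intro v p hv hp hLp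
    obtain ⟨q, hpq, δ, hδ, hW⟩ := exists_memLp_exp_activity r g ν hε hexp hp
    refine hasDerivAt_integral_intervalIntegral r g ν hM0 hM ht hgood hgoodl hδ hv ?_
    exact integrable_prod_onState_mul_exp_activity r g ν hpq hW hv hLp
  · intro α p hα _ hp hLp
    obtain ⟨δ, hδ, hint⟩ := exists_integrable_mul_exp_activity r g ν hε hexp hp hLp
    have hU := hasDerivAt_integral_perturbedLaw r g ν hM0 hM hgood hgoodl hδ ht le_rfl
      ((measurable_jumpSum hα).comp (measurable_prodMk_right (y := t))) (isLocal_jumpSum α t) hint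
    refine ⟨hU, fun q hq hLq => ?_⟩
    obtain ⟨δ', hδ', hint'⟩ := exists_integrable_mul_exp_activity r g ν hε hexp hq hLq
    -- The derivative is already known from `hU`; `he` rewrites its value as two integrals over path
    -- and time, which Fubini then orders with time outside.
    obtain ⟨i1, i2, he⟩ := integral_jumpSum_mul_responseMartingale r g ν ht hgood hα hδ' hint'
    refine ⟨?_, ?_, ?_, ?_⟩
    · filter_upwards [i1.prod_left_ae, i2.prod_left_ae] with s h1 h2 using ⟨h1, h2⟩
    · rw [intervalIntegrable_iff_integrableOn_Ioc_of_le ht]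
      exact i1.integral_prod_right
    · rw [intervalIntegrable_iff_integrableOn_Ioc_of_le ht]
      exact i2.integral_prod_right
    · rw [intervalIntegral.integral_of_le ht, intervalIntegral.integral_of_le ht,
        ← integral_prod_symm _ i1, ← integral_prod_symm _ i2, ← he]
      exact hU.2.2
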